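/- Conventions. A spacetime is a smooth Hausdorff second countable manifold $M$ (not necessarily connected, of any dimension) with a smooth Lorentzian metric of signature $(-+\cdots+)$ and a time-orientation; $\mathrm{dV}$ is its volume element, and $J_\pm^M(A)$ is the causal future/past of $A\subset M$. It is globally hyperbolic if it contains a Cauchy hypersurface, i.e. a subset met exactly once by every inextensible timelike curve. An open subset $\Omega\subset M$ is causally compatible if $J_\pm^\Omega(x)=J_\pm^M(x)\cap\Omega$ for all $x\in\Omega$. For a vector bundle $S\to M$, $C^\infty(M,S)$ and $C^\infty_c(M,S)$ are the spaces of smooth sections and of compactly supported smooth sections. An advanced (resp. retarded) Green's operator for a linear differential operator $P$ on $S$ is a linear map $G_\pm:C^\infty_c(M,S)\to C^\infty(M,S)$ with $PG_\pm\varphi=\varphi$, $G_\pm P\varphi=\varphi$ and $\operatorname{supp}(G_\pm\varphi)\subset J^M_\pm(\operatorname{supp}\varphi)$ for all $\varphi\in C^\infty_c(M,S)$ (sign $+$ for advanced, $-$ for retarded). $P$ is Green-hyperbolic if its restriction to every globally hyperbolic open subset of $M$ has advanced and retarded Green's operators. If $S$ carries a non-degenerate inner product, $P$ is formally self-adjoint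 if $\int_M\langle P\varphi,\psi\rangle\,\mathrm{dV}=\int_M\langle\varphi,P\psi\rangle\,\mathrm{dV}$ for all $\varphi,\psi\in C^\infty(M,S)$ with $\operatorname{supp}\varphi\cap\operatorname{supp}\psi$ compact. The category $\mathsf{GlobHypGreen}$ has as objects the triples $(M,S,P)$, where $M$ is a globally hyperbolic spacetime, $S\to M$ is a real vector bundle with a smooth non-degenerate (possibly indefinite) inner product $\langle\cdot,\cdot\rangle$, and $P$ is a formally self-adjoint Green-hyperbolic linear differential operator on sections of $S$. A morphism $(M_1,S_1,P_1)\to(M_2,S_2,P_2)$ is a pair $(f,F)$, where $f:M_1\to M_2$ is a time-orientation preserving isometric embedding with open and causally compatible image, and $F$ is a fibrewise isometric vector bundle isomorphism over $f$ such that $\mathrm{res}\circ P_2=P_1\circ\mathrm{res}$ on $C^\infty(M_2,S_2)$, where $\mathrm{res}(\varphi)=F^{-1}\circ\varphi\circ f$. For $\varphi\in C_c^\infty(M_1,S_1)$ let $\mathrm{ext}(\varphi)\in C_c^\infty(M_2,S_2)$ be the extension by zero of $F\circ\varphi\circ f^{-1}:f(M_1)\to S_2$. The category $\mathsf{Sympl}$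 has as objects the real vector spaces with a non-degenerate alternating bilinear form (symplectic vector spaces) and as morphisms the linear maps that preserve the forms (symplectic linear maps). Proposition. For every object $(M,S,P)$ of $\mathsf{GlobHypGreen}$ the advanced and the retarded Green's operators $G_+$ and $G_-$ of $P$ on $M$ are unique. Put $G:=G_+-G_-$. Then the integrals below converge, $$\mathrm{SYMPL}(M,S,P):=C_c^\infty(M,S)/\ker(G),\qquad \omega([\varphi],[\psi]):=\int_M\langle G\varphi,\psi\rangle\,\mathrm{dV},$$ is well defined, and $(\mathrm{SYMPL}(M,S,P),\omega)$ is a symplectic vector space. For every morphism $(f,F):(M_1,S_1,P_1)\to(M_2,S_2,P_2)$, extension by zero induces a symplectic linear map $\mathrm{SYMPL}(f,F):\mathrm{SYMPL}(M_1,S_1,P_1)\to\mathrm{SYMPL}(M_2,S_2,P_2)$, $[\varphi]\mapsto[\mathrm{ext}(\varphi)]$. Moreover $\mathrm{SYMPL}(\mathrm{id}_M,\mathrm{id}_S)=\mathrm{id}$ and $\mathrm{SYMPL}((f',F')\circ(f,F))=\mathrm{SYMPL}(f',F')\circ\mathrm{SYMPL}(f,F)$ for composable morphisms, so that $\mathrm{SYMPL}:\mathsf{GlobHypGreen}\to\mathsf{Sympl}$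 is a covariant functor. -/

import Mathlib

open Set Filter Topology MeasureTheory Bundle CategoryTheory
open scoped Manifold ContDiff

set_option linter.unusedSectionVars false
set_option linter.checkUnivs false

universe u v w

noncomputable section

namespace GreenHyp

/-! ### Spacetimes -/

/-- A smooth Lorentzian metric of signature `(-,+,…,+)` together with a time-orientation on the
smooth manifold `M`. The time-orientation is recorded by the sets `future x` of future-directed
causal (that is: non-zero, timelike or lightlike) tangent vectors; it is induced by some smooth
timelike vector field. -/
structure Spacetime (m : ℕ) (M : Type u) [TopologicalSpace M]
    [ChartedSpace (EuclideanSpace ℝ (Fin m)) M] [IsManifold (𝓡 m) ∞ M] where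
  metric (x : M) : TangentSpace (𝓡 m) x →L[ℝ] TangentSpace (𝓡 m) x →L[ℝ] ℝ
  metric_symm (x : M) (v w : TangentSpace (𝓡 m) x) : metric x v w = metric x w v
  lorentzian (x : M) : ∃ v : TangentSpace (𝓡 m) x, metric x v v < 0 ∧
    ∀ w : TangentSpace (𝓡 m) x, metric x v w = 0 → w ≠ 0 → 0 < metric x w w
  metric_smooth : ContMDiff (𝓡 m)
    ((𝓡 m).prod 𝓘(ℝ, EuclideanSpace ℝ (Fin m) →L[ℝ] EuclideanSpace ℝ (Fin m) →L[ℝ] ℝ)) ∞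
    (fun x ↦ TotalSpace.mk'
      (EuclideanSpace ℝ (Fin m) →L[ℝ] EuclideanSpace ℝ (Fin m) →L[ℝ] ℝ) x (metric x))
  future (x : M) : Set (TangentSpace (𝓡 m) x)
  time_orientation : ∃ T : ∀ x : M, TangentSpace (𝓡 m) x,
    ContMDiff (𝓡 m) (𝓡 m).tangent ∞ (fun x ↦ (⟨x, T x⟩ : TangentBundle (𝓡 m) M)) ∧
    (∀ x, metric x (T x) (T x) < 0) ∧
    ∀ x v, v ∈ future x ↔ metric x v v ≤ 0 ∧ metric x v (T x) < 0

/-- Countably many preferred charts cover a second countable manifold. -/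
theorem exists_chart_cover (m : ℕ) (M : Type u) [TopologicalSpace M]
    [ChartedSpace (EuclideanSpace ℝ (Fin m)) M] [SecondCountableTopology M] [Nonempty M] :
    ∃ c : ℕ → M, ⋃ i, (chartAt (EuclideanSpace ℝ (Fin m)) (c i)).source = univ := by
  obtain ⟨s, hs, hU⟩ := TopologicalSpace.countable_cover_nhds
    (fun x : M ↦ (chartAt (EuclideanSpace ℝ (Fin m)) x).open_source.mem_nhds
      (mem_chart_source (EuclideanSpace ℝ (Fin m)) x))
  have hne : s.Nonempty := by
    by_contra h
    rw [not_nonempty_iff_eq_empty] at h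
    subst h
    simp at hU
    exact (univ_nonempty (α := M)).ne_empty hU.symm
  obtain ⟨c, rfl⟩ := hs.exists_eq_range hne
  exact ⟨c, by simpa using hU⟩

section Causality

variable {m : ℕ} {M : Type u} [TopologicalSpace M]
  [ChartedSpace (EuclideanSpace ℝ (Fin m)) M] [IsManifold (𝓡 m) ∞ M]

/-- The velocity at time `t` of the curve segment `γ : [a, b] → M` (one-sided at the ends). -/
def velocity (γ : ℝ → M) (a b t : ℝ) : TangentSpace (𝓡 m) (γ t) :=
  mfderivWithin 𝓘(ℝ, ℝ) (𝓡 m) γ (Icc a b) t (1 : ℝ)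

namespace Spacetime

variable (L : Spacetime m M)

/-- `γ` restricted to `[a, b]` is a future-directed causal `C¹` curve running in `U`. -/
def IsCausalSegment (U : Set M) (γ : ℝ → M) (a b : ℝ) : Prop :=
  a < b ∧ ContMDiffOn 𝓘(ℝ, ℝ) (𝓡 m) 1 γ (Icc a b) ∧
    ∀ t ∈ Icc a b, γ t ∈ U ∧ velocity γ a b t ∈ L.future (γ t)

/-- `γ` restricted to `[a, b]` is a future-directed timelike `C¹` curve running in `U`. -/
def IsTimelikeSegment (U : Set M) (γ : ℝ → M) (a b : ℝ) : Prop :=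
  L.IsCausalSegment U γ a b ∧
    ∀ t ∈ Icc a b, L.metric (γ t) (velocity γ a b t) (velocity γ a b t) < 0

/-- `y` lies in the causal future of `x` in the open subset `U`: either `y = x`, or there is a
future-directed piecewise `C¹` causal curve (a concatenation of finitely many `C¹` pieces) in `U`
from `x` to `y`. -/
def CausalLE (U : Set M) : M → M → Prop :=
  Relation.ReflTransGen fun x y ↦ ∃ γ a b, L.IsCausalSegment U γ a b ∧ γ a = x ∧ γ b = y

/-- The causal future `J₊^U(A)` of `A ⊆ U` in the open subset `U`. -/
def causalFuture (U A : Set M) : Set M := {y | ∃ x ∈ A ∩ U, L.CausalLE U x y}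

/-- The causal past `J₋^U(A)` of `A ⊆ U` in the open subset `U`. -/
def causalPast (U A : Set M) : Set M := {y | ∃ x ∈ A ∩ U, L.CausalLE U y x}

/-- `Ω` is causally compatible: `J_±^Ω(x) = J_±^M(x) ∩ Ω` for all `x ∈ Ω`. -/
def IsCausallyCompatible (Ω : Set M) : Prop :=
  ∀ x ∈ Ω, L.causalFuture Ω {x} = L.causalFuture univ {x} ∩ Ω ∧
    L.causalPast Ω {x} = L.causalPast univ {x} ∩ Ω

/-- An inextensible future-directed timelike piecewise `C¹` curve in the open subset `U`,
parametrized by an open interval which we may take to be `ℝ`: near every parameter the curve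
consists of two `C¹` pieces, and it has no end point in `U`. -/
def IsInextensibleTimelike (U : Set M) (γ : ℝ → M) : Prop :=
  (∀ t, ∃ ε > 0, L.IsTimelikeSegment U γ (t - ε) t ∧ L.IsTimelikeSegment U γ t (t + ε)) ∧
    (¬ ∃ p ∈ U, Tendsto γ atTop (𝓝 p)) ∧ ¬ ∃ p ∈ U, Tendsto γ atBot (𝓝 p)

/-- `A` is a Cauchy hypersurface of the open subset `U`, regarded as a spacetime of its own: it is
met exactly once by every inextensible timelike curve. -/
def IsCauchyHypersurface (U A : Set M) : Prop :=
  A ⊆ U ∧ ∀ γ, L.IsInextensibleTimelike U γ → ∃! t, γ t ∈ A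

/-- The open subset `U`, regarded as a spacetime of its own, is globally hyperbolic. -/
def IsGloballyHyperbolic (U : Set M) : Prop := ∃ A, L.IsCauchyHypersurface U A

/-- The density `|det (g_{ij})|^{1/2}` of the volume element in the chart around `c`. -/
def chartDensity (c : M) (z : EuclideanSpace ℝ (Fin m)) : ENNReal :=
  let e := (chartAt (EuclideanSpace ℝ (Fin m)) c).symm
  let coordField : Fin m → TangentSpace (𝓡 m) (e z) := fun i ↦
    mfderiv 𝓘(ℝ, EuclideanSpace ℝ (Fin m)) (𝓡 m) e z (EuclideanSpace.single i (1 : ℝ))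
  ENNReal.ofReal √|(Matrix.of fun i j ↦ L.metric (e z) (coordField i) (coordField j)).det|

/-- The part of the volume element over the subset `A` of the domain of the chart around `c`:
the measure `|det (g_{ij})|^{1/2} dx¹ ⋯ dxᵐ`, carried over to `M`. -/
def chartVolume (c : M) (A : Set M) : @Measure M (borel M) :=
  letI : MeasurableSpace M := borel M
  Measure.map (chartAt (EuclideanSpace ℝ (Fin m)) c).symm
    ((volume.restrict ((chartAt (EuclideanSpace ℝ (Fin m)) c).target ∩
      (chartAt (EuclideanSpace ℝ (Fin m)) c).symm ⁻¹' A)).withDensity (L.chartDensity c))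

open Classical in
/-- The volume element `dV` of the spacetime, as a Borel measure: `M` is cut into countably many
disjoint Borel pieces, each inside a chart domain, and on a chart domain the measure is
`|det (g_{ij})|^{1/2} dx¹ ⋯ dxᵐ`. -/
def vol [SecondCountableTopology M] : @Measure M (borel M) :=
  letI : MeasurableSpace M := borel M
  if _h : Nonempty M then
    let c : ℕ → M := (exists_chart_cover m M).choose
    Measure.sum fun i ↦ L.chartVolume (c i)
      (disjointed (fun j ↦ (chartAt (EuclideanSpace ℝ (Fin m)) (c j)).source) i)
  else 0

end Spacetime

end Causality

/-! Transport of causal curves along embeddings; needed to compose morphisms. -/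

section Transport

variable {m n : ℕ} {M : Type u} [TopologicalSpace M]
  [ChartedSpace (EuclideanSpace ℝ (Fin m)) M] [IsManifold (𝓡 m) ∞ M]
  {N : Type u} [TopologicalSpace N]
  [ChartedSpace (EuclideanSpace ℝ (Fin n)) N] [IsManifold (𝓡 n) ∞ N]

namespace Spacetime

theorem CausalLE.mono {L : Spacetime m M} {U V : Set M} (h : U ⊆ V) {x y : M}
    (hxy : L.CausalLE U x y) : L.CausalLE V x y :=
  Relation.ReflTransGen.mono (fun _ _ ⟨γ, a, b, hγ, ha, hb⟩ ↦
    ⟨γ, a, b, ⟨hγ.1, hγ.2.1, fun t ht ↦ ⟨h (hγ.2.2 t ht).1, (hγ.2.2 t ht).2⟩⟩, ha, hb⟩) _ _ hxy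

theorem CausalLE.mem_iff {L : Spacetime m M} {U : Set M} {x y : M}
    (hxy : L.CausalLE U x y) : x ∈ U ↔ y ∈ U := by
  induction hxy with
  | refl => rfl
  | tail _ h ih =>
    obtain ⟨γ, a, b, hγ, rfl, rfl⟩ := h
    rw [ih]
    exact ⟨fun _ ↦ (hγ.2.2 b (right_mem_Icc.2 hγ.1.le)).1,
      fun _ ↦ (hγ.2.2 a (left_mem_Icc.2 hγ.1.le)).1⟩

theorem isCausallyCompatible_iff {L : Spacetime m M} {Ω : Set M} :
    L.IsCausallyCompatible Ω ↔ ∀ x ∈ Ω, ∀ y ∈ Ω, L.CausalLE univ x y → L.CausalLE Ω x y := by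
  constructor
  · intro h x hx y hy hxy
    have : y ∈ L.causalFuture univ {x} ∩ Ω := ⟨⟨x, ⟨rfl, mem_univ x⟩, hxy⟩, hy⟩
    rw [← (h x hx).1] at this
    obtain ⟨_, ⟨rfl, _⟩, h'⟩ := this
    exact h'
  · intro h x hx
    constructor
    · apply subset_antisymm
      · rintro y ⟨_, ⟨rfl, _⟩, hxy⟩
        exact ⟨⟨_, ⟨rfl, mem_univ _⟩, hxy.mono (subset_univ Ω)⟩, hxy.mem_iff.1 hx⟩
      · rintro y ⟨⟨_, ⟨rfl, _⟩, hxy⟩, hy⟩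
        exact ⟨_, ⟨rfl, hx⟩, h _ hx y hy hxy⟩
    · apply subset_antisymm
      · rintro y ⟨_, ⟨rfl, _⟩, hxy⟩
        exact ⟨⟨_, ⟨rfl, mem_univ _⟩, hxy.mono (subset_univ Ω)⟩, hxy.mem_iff.2 hx⟩
      · rintro y ⟨⟨_, ⟨rfl, _⟩, hxy⟩, hy⟩
        exact ⟨_, ⟨rfl, hx⟩, h y hy _ hx hxy⟩

theorem future_congr (L : Spacetime m M) {p q : M} (e : p = q) {v w : EuclideanSpace ℝ (Fin m)}
    (hvw : v = w) (h : (show TangentSpace (𝓡 m) p from v) ∈ L.future p) :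
    (show TangentSpace (𝓡 m) q from w) ∈ L.future q := by
  subst e hvw
  exact h

theorem velocity_comp {f : M → N} (hf : IsLocalDiffeomorph (𝓡 m) (𝓡 n) ∞ f) {γ : ℝ → M}
    {a b t : ℝ} (hab : a < b) (hγ : ContMDiffOn 𝓘(ℝ, ℝ) (𝓡 m) 1 γ (Icc a b)) (ht : t ∈ Icc a b) :
    velocity (m := n) (f ∘ γ) a b t
      = mfderiv (𝓡 m) (𝓡 n) f (γ t) (velocity (m := m) γ a b t) := by
  have hu : UniqueMDiffWithinAt 𝓘(ℝ, ℝ) (Icc a b) t :=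
    (uniqueDiffOn_Icc hab t ht).uniqueMDiffWithinAt
  have := mfderiv_comp_mfderivWithin (I := 𝓘(ℝ, ℝ)) (I' := 𝓡 m) (I'' := 𝓡 n) t
    ((hf (γ t)).mdifferentiableAt (by simp)) ((hγ t ht).mdifferentiableWithinAt (by simp)) hu
  exact congrArg (fun T : ℝ →L[ℝ] EuclideanSpace ℝ (Fin n) ↦ T 1) this

theorem CausalLE.map {L : Spacetime m M} {K : Spacetime n N} {f : M → N}
    (hf : IsLocalDiffeomorph (𝓡 m) (𝓡 n) ∞ f)
    (hfut : ∀ x v, mfderiv (𝓡 m) (𝓡 n) f x v ∈ K.future (f x) ↔ v ∈ L.future x)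
    {U : Set M} {x y : M} (h : L.CausalLE U x y) : K.CausalLE (f '' U) (f x) (f y) := by
  refine Relation.ReflTransGen.lift f ?_ _ _ h
  rintro _ _ ⟨γ, a, b, ⟨hab, hγ, hv⟩, rfl, rfl⟩
  refine ⟨f ∘ γ, a, b, ⟨hab, ?_, fun t ht ↦ ⟨mem_image_of_mem f (hv t ht).1, ?_⟩⟩, rfl, rfl⟩
  · exact (hf.contMDiff.of_le (by simp)).comp_contMDiffOn hγ
  · rw [velocity_comp hf hab hγ ht]
    exact (hfut _ _).2 (hv t ht).2

theorem CausalLE.of_map {L : Spacetime m M} {K : Spacetime n N} {f : M → N}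
    (hf : IsLocalDiffeomorph (𝓡 m) (𝓡 n) ∞ f) (hinj : Function.Injective f)
    (hfut : ∀ x v, mfderiv (𝓡 m) (𝓡 n) f x v ∈ K.future (f x) ↔ v ∈ L.future x)
    {x y : M} (h : K.CausalLE (range f) (f x) (f y)) : L.CausalLE univ x y := by
  have : Nonempty M := ⟨x⟩
  generalize hq : f y = q at h
  induction h generalizing y with
  | refl =>
    rw [hinj hq]
    exact Relation.ReflTransGen.refl
  | tail _ hseg ih =>
    obtain ⟨γ, a, b, ⟨hab, hγ, hv⟩, rfl, rfl⟩ := hseg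
    set δ : ℝ → M := Function.invFun f ∘ γ with hδ
    have hfδ : ∀ t ∈ Icc a b, f (δ t) = γ t := fun t ht ↦ Function.invFun_eq (hv t ht).1
    have hδs : ContMDiffOn 𝓘(ℝ, ℝ) (𝓡 m) 1 δ (Icc a b) := by
      intro t ht
      have hloc := hf (δ t)
      have h1 : ContMDiffAt (𝓡 n) (𝓡 m) 1 hloc.localInverse (γ t) :=
        hfδ t ht ▸ hloc.localInverse_contMDiffAt.of_le (by simp)
      refine (h1.comp_contMDiffWithinAt t (hγ t ht)).congr_of_eventuallyEq_of_mem ?_ ht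
      have hnhds : hloc.localInverse.source ∈ 𝓝 (γ t) :=
        hfδ t ht ▸ hloc.localInverse_open_source.mem_nhds hloc.localInverse_mem_source
      filter_upwards [(hγ t ht).continuousWithinAt hnhds, self_mem_nhdsWithin] with s hs hsI
      apply hinj
      rw [hfδ s hsI]
      exact (hloc.localInverse_right_inv hs).symm
    have hb : δ b = y := by
      apply hinj
      rw [hfδ b (right_mem_Icc.2 hab.le), hq]
    refine Relation.ReflTransGen.tail (ih (hfδ a (left_mem_Icc.2 hab.le)))
      ⟨δ, a, b, ⟨hab, hδs, fun t ht ↦ ⟨mem_univ _, ?_⟩⟩, rfl, hb⟩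
    rw [← hfut, ← velocity_comp hf hab hδs ht]
    refine K.future_congr (hfδ t ht).symm ?_ (hv t ht).2
    have := mfderivWithin_congr (I := 𝓘(ℝ, ℝ)) (I' := 𝓡 n) (x := t)
      (fun s hs ↦ (hfδ s hs).symm) (hfδ t ht).symm
    exact congrArg (fun T : ℝ →L[ℝ] EuclideanSpace ℝ (Fin n) ↦ T 1) this

end Spacetime

end Transport

/-! ### Sections and differential operators -/

section Sections

variable {m : ℕ} {M : Type u} [TopologicalSpace M]
  [ChartedSpace (EuclideanSpace ℝ (Fin m)) M]
  {F : Type w} [NormedAddCommGroup F] [NormedSpace ℝ F]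
  (S : M → Type v) [TopologicalSpace (TotalSpace F S)]
  [∀ x, TopologicalSpace (S x)] [∀ x, AddCommGroup (S x)] [∀ x, Module ℝ (S x)]
  [FiberBundle F S] [VectorBundle ℝ F S]

variable (m F) in
/-- The space `C^∞(Ω, S)` of smooth sections of `S` over the open subset `Ω`. So that `Ω = M` is
literally the case of global sections, a section over `Ω` is recorded as a family indexed by all
of `M` with the value `0` outside `Ω` (where nothing else is required of it). -/
structure Sec (Ω : Set M) where
  val (x : M) : S x
  smooth : ContMDiffOn (𝓡 m) ((𝓡 m).prod 𝓘(ℝ, F)) ∞ (fun x ↦ TotalSpace.mk' F x (val x)) Ω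
  eq_zero : ∀ x ∉ Ω, val x = 0

variable {S}

namespace Sec

variable {Ω : Set M}

instance : CoeFun (Sec m F S Ω) fun _ ↦ ∀ x, S x := ⟨Sec.val⟩

theorem val_injective : Function.Injective (Sec.val : Sec m F S Ω → ∀ x, S x) := by
  rintro ⟨σ, _, _⟩ ⟨τ, _, _⟩ rfl
  rfl

@[ext]
theorem ext {σ τ : Sec m F S Ω} (h : ∀ x, σ x = τ x) : σ = τ := val_injective (funext h)

instance : Zero (Sec m F S Ω) :=
  ⟨⟨0, (contMDiff_zeroSection ℝ S).contMDiffOn, fun _ _ ↦ rfl⟩⟩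

instance : Add (Sec m F S Ω) :=
  ⟨fun σ τ ↦ ⟨σ.val + τ.val, σ.smooth.add_section τ.smooth,
    fun x hx ↦ by simp [σ.eq_zero x hx, τ.eq_zero x hx]⟩⟩

instance : Neg (Sec m F S Ω) :=
  ⟨fun σ ↦ ⟨-σ.val, σ.smooth.neg_section, fun x hx ↦ by simp [σ.eq_zero x hx]⟩⟩

instance : Sub (Sec m F S Ω) :=
  ⟨fun σ τ ↦ ⟨σ.val - τ.val, σ.smooth.sub_section τ.smooth,
    fun x hx ↦ by simp [σ.eq_zero x hx, τ.eq_zero x hx]⟩⟩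

instance : SMul ℝ (Sec m F S Ω) :=
  ⟨fun a σ ↦ ⟨a • σ.val, σ.smooth.const_smul_section, fun x hx ↦ by simp [σ.eq_zero x hx]⟩⟩

theorem nsmul_smooth (n : ℕ) (σ : Sec m F S Ω) :
    ContMDiffOn (𝓡 m) ((𝓡 m).prod 𝓘(ℝ, F)) ∞ (fun x ↦ TotalSpace.mk' F x ((n • σ.val) x)) Ω := by
  have h : ((n : ℝ) • σ.val) = n • σ.val := by
    funext x
    simp [Nat.cast_smul_eq_nsmul]
  exact h ▸ ((n : ℝ) • σ).smooth

theorem zsmul_smooth (n : ℤ) (σ : Sec m F S Ω) :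
    ContMDiffOn (𝓡 m) ((𝓡 m).prod 𝓘(ℝ, F)) ∞ (fun x ↦ TotalSpace.mk' F x ((n • σ.val) x)) Ω := by
  have h : ((n : ℝ) • σ.val) = n • σ.val := by
    funext x
    simp [Int.cast_smul_eq_zsmul]
  exact h ▸ ((n : ℝ) • σ).smooth

instance : SMul ℕ (Sec m F S Ω) :=
  ⟨fun n σ ↦ ⟨n • σ.val, nsmul_smooth n σ, fun x hx ↦ by simp [σ.eq_zero x hx]⟩⟩

instance : SMul ℤ (Sec m F S Ω) :=
  ⟨fun n σ ↦ ⟨n • σ.val, zsmul_smooth n σ, fun x hx ↦ by simp [σ.eq_zero x hx]⟩⟩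

instance : AddCommGroup (Sec m F S Ω) :=
  val_injective.addCommGroup _ rfl (fun _ _ ↦ rfl) (fun _ ↦ rfl) (fun _ _ ↦ rfl)
    (fun _ _ ↦ rfl) fun _ _ ↦ rfl

@[simp]
theorem zero_apply (x : M) : (0 : Sec m F S Ω) x = 0 := rfl

@[simp]
theorem add_apply (σ τ : Sec m F S Ω) (x : M) : (σ + τ) x = σ x + τ x := rfl

@[simp]
theorem smul_apply (a : ℝ) (σ : Sec m F S Ω) (x : M) : (a • σ) x = a • σ x := rfl

instance : Module ℝ (Sec m F S Ω) where
  one_smul σ := by ext x; simp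
  mul_smul a b σ := by ext x; simp [mul_smul]
  smul_zero a := by ext x; simp
  smul_add a σ τ := by ext x; simp
  add_smul a b σ := by ext x; simp [add_smul]
  zero_smul σ := by ext x; simp

end Sec

/-- The support in `Ω` of a section over `Ω`: the closure in `Ω` of the set where it is non-zero. -/
def supp {Ω : Set M} (σ : Sec m F S Ω) : Set M := closure {x | σ x ≠ 0} ∩ Ω

variable (m F S) in
/-- The space `C_c^∞(Ω, S)` of smooth sections over `Ω` with compact support in `Ω`. -/
def SecC (Ω : Set M) : Submodule ℝ (Sec m F S Ω) where
  carrier := {σ | IsCompact (supp σ)}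
  add_mem' {σ τ} hσ hτ := by
    have hsub : supp (σ + τ) ⊆ supp σ ∪ supp τ := by
      rintro x ⟨hx, hxΩ⟩
      have : closure {x | (σ + τ) x ≠ 0} ⊆ closure ({x | σ x ≠ 0} ∪ {x | τ x ≠ 0}) := by
        apply closure_mono
        intro y hy
        by_contra h
        simp only [mem_union, mem_ofPred_eq, not_or, not_not] at h
        exact hy (by simp [h.1, h.2])
      rw [closure_union] at this
      exact (this hx).imp (fun h ↦ ⟨h, hxΩ⟩) fun h ↦ ⟨h, hxΩ⟩
    have heq : supp (σ + τ) = (supp σ ∪ supp τ) ∩ closure {x | (σ + τ) x ≠ 0} :=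
      subset_antisymm (fun x hx ↦ ⟨hsub hx, hx.1⟩)
        fun x hx ↦ ⟨hx.2, hx.1.elim (fun h ↦ h.2) fun h ↦ h.2⟩
    change IsCompact (supp (σ + τ))
    rw [heq]
    exact (hσ.union hτ).inter_right isClosed_closure
  zero_mem' := by simp [supp]
  smul_mem' a σ hσ := by
    have heq : supp (a • σ) = supp σ ∩ closure {x | (a • σ) x ≠ 0} := by
      refine subset_antisymm (fun x hx ↦ ⟨⟨closure_mono ?_ hx.1, hx.2⟩, hx.1⟩)
        fun x hx ↦ ⟨hx.2, hx.1.2⟩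
      intro y hy h
      exact hy (by simp [h])
    change IsCompact (supp (a • σ))
    rw [heq]
    exact hσ.inter_right isClosed_closure

/-- The section `σ`, written in the chart and the local trivialization around `c`. -/
def localRep (c : M) (σ : ∀ x, S x) (z : EuclideanSpace ℝ (Fin m)) : F :=
  (trivializationAt F S c ⟨(chartAt (EuclideanSpace ℝ (Fin m)) c).symm z,
    σ ((chartAt (EuclideanSpace ℝ (Fin m)) c).symm z)⟩).2

variable (m F S) in
/-- The part of the coordinate domain of the chart around `c` over which `S` is trivialized. -/
def localDomain (c : M) : Set (EuclideanSpace ℝ (Fin m)) :=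
  (chartAt (EuclideanSpace ℝ (Fin m)) c).target ∩
    (chartAt (EuclideanSpace ℝ (Fin m)) c).symm ⁻¹' (trivializationAt F S c).baseSet

/-- `P` is a linear differential operator with smooth coefficients: for some order `k`, it has in
local coordinates and local trivializations the form
`∑_{j ≤ k} ∑_{i₁,…,i_j} A_{i₁…i_j}(z) ∂_{i₁} ⋯ ∂_{i_j}`. -/
def IsDifferentialOperator (P : Sec m F S univ →ₗ[ℝ] Sec m F S univ) : Prop :=
  ∃ k : ℕ, ∀ c : M,
    ∃ A : ∀ j : ℕ, (Fin j → Fin m) → EuclideanSpace ℝ (Fin m) → F →L[ℝ] F,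
      (∀ j i, ContDiffOn ℝ ∞ (A j i) (localDomain m F S c)) ∧
      ∀ σ : Sec m F S univ, ∀ z ∈ localDomain m F S c,
        localRep c (P σ) z = ∑ j ∈ Finset.range (k + 1), ∑ i : Fin j → Fin m,
          A j i z (iteratedFDeriv ℝ j (localRep c σ.1) z
            fun l ↦ EuclideanSpace.single (i l) (1 : ℝ))

/-- `Q` is the restriction to `Ω` of the (local) operator `P`: where a section `u` over `Ω` agrees
near `x ∈ Ω` with a global section `σ`, the value of `Q u` at `x` is that of `P σ`. -/
def IsRestriction (P : Sec m F S univ →ₗ[ℝ] Sec m F S univ) (Ω : Set M)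
    (Q : Sec m F S Ω →ₗ[ℝ] Sec m F S Ω) : Prop :=
  ∀ (u : Sec m F S Ω) (σ : Sec m F S univ), ∀ x ∈ Ω,
    (∀ᶠ y in 𝓝 x, σ y = u y) → (Q u) x = (P σ) x

variable [IsManifold (𝓡 m) ∞ M] (L : Spacetime m M)

/-- `G` is an advanced Green's operator for the operator `Q` on `Ω`. -/
structure IsAdvancedGreen {Ω : Set M} (Q : Sec m F S Ω →ₗ[ℝ] Sec m F S Ω)
    (G : SecC m F S Ω →ₗ[ℝ] Sec m F S Ω) : Prop where
  apply_green (φ : SecC m F S Ω) : Q (G φ) = φ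
  green_apply (φ ψ : SecC m F S Ω) : (ψ : Sec m F S Ω) = Q φ → G ψ = φ
  supp_subset (φ : SecC m F S Ω) : supp (G φ) ⊆ L.causalFuture Ω (supp φ.1)

/-- `G` is a retarded Green's operator for the operator `Q` on `Ω`. -/
structure IsRetardedGreen {Ω : Set M} (Q : Sec m F S Ω →ₗ[ℝ] Sec m F S Ω)
    (G : SecC m F S Ω →ₗ[ℝ] Sec m F S Ω) : Prop where
  apply_green (φ : SecC m F S Ω) : Q (G φ) = φ
  green_apply (φ ψ : SecC m F S Ω) : (ψ : Sec m F S Ω) = Q φ → G ψ = φ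
  supp_subset (φ : SecC m F S Ω) : supp (G φ) ⊆ L.causalPast Ω (supp φ.1)

/-- `P` is Green-hyperbolic: its restriction to any globally hyperbolic subregion has advanced and
retarded Green's operators. -/
def IsGreenHyperbolic (P : Sec m F S univ →ₗ[ℝ] Sec m F S univ) : Prop :=
  ∀ Ω : Set M, IsOpen Ω → L.IsGloballyHyperbolic Ω →
    ∃ Q : Sec m F S Ω →ₗ[ℝ] Sec m F S Ω, IsRestriction P Ω Q ∧
      (∃ G, IsAdvancedGreen L Q G) ∧ ∃ G, IsRetardedGreen L Q G

/-- `P` is formally self-adjoint with respect to the inner product `h` on `S`. -/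
def IsFormallySelfAdjoint [SecondCountableTopology M] (h : ∀ x, S x →L[ℝ] S x →L[ℝ] ℝ)
    (P : Sec m F S univ →ₗ[ℝ] Sec m F S univ) : Prop :=
  ∀ φ ψ : Sec m F S univ, IsCompact (supp φ ∩ supp ψ) →
    ∫ x, h x ((P φ) x) (ψ x) ∂L.vol = ∫ x, h x (φ x) ((P ψ) x) ∂L.vol

end Sections

/-! ### The category `GlobHypGreen` -/

/-- An object `(M, S, P)`: a globally hyperbolic spacetime `M`, a real vector bundle `S` over `M`
with a smooth non-degenerate (not necessarily definite) inner product, and a formally self-adjoint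
Green-hyperbolic operator `P` on sections of `S`. -/
structure GlobHypGreen : Type (max (u + 1) (v + 1)) where
  m : ℕ
  M : Type u
  [topM : TopologicalSpace M]
  [t2M : T2Space M]
  [sccM : SecondCountableTopology M]
  [chartedM : ChartedSpace (EuclideanSpace ℝ (Fin m)) M]
  [manifoldM : IsManifold (𝓡 m) ∞ M]
  L : Spacetime m M
  globHyp : L.IsGloballyHyperbolic univ
  r : ℕ
  S : M → Type v
  [topTotal : TopologicalSpace (TotalSpace (EuclideanSpace ℝ (Fin r)) S)]
  [topS : ∀ x, TopologicalSpace (S x)]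
  [addS : ∀ x, AddCommGroup (S x)]
  [modS : ∀ x, Module ℝ (S x)]
  [topAddS : ∀ x, IsTopologicalAddGroup (S x)]
  [smulS : ∀ x, ContinuousConstSMul ℝ (S x)]
  [fiberS : FiberBundle (EuclideanSpace ℝ (Fin r)) S]
  [vectorS : VectorBundle ℝ (EuclideanSpace ℝ (Fin r)) S]
  [smoothS : ContMDiffVectorBundle ∞ (EuclideanSpace ℝ (Fin r)) S (𝓡 m)]
  inner : ∀ x, S x →L[ℝ] S x →L[ℝ] ℝ
  inner_symm : ∀ x v w, inner x v w = inner x w v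
  inner_nondegenerate : ∀ x v, (∀ w, inner x v w = 0) → v = 0
  inner_smooth : ContMDiff (𝓡 m)
    ((𝓡 m).prod 𝓘(ℝ, EuclideanSpace ℝ (Fin r) →L[ℝ] EuclideanSpace ℝ (Fin r) →L[ℝ] ℝ)) ∞
    (fun x ↦ TotalSpace.mk'
      (EuclideanSpace ℝ (Fin r) →L[ℝ] EuclideanSpace ℝ (Fin r) →L[ℝ] ℝ) x (inner x))
  P : Sec m (EuclideanSpace ℝ (Fin r)) S univ →ₗ[ℝ] Sec m (EuclideanSpace ℝ (Fin r)) S univ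
  differential : IsDifferentialOperator P
  selfAdjoint : IsFormallySelfAdjoint L inner P
  greenHyperbolic : IsGreenHyperbolic L P

namespace GlobHypGreen

attribute [instance] topM t2M sccM chartedM manifoldM topTotal topS addS modS topAddS smulS
  fiberS vectorS smoothS

/-- The standard fibre of the bundle of `X`. -/
abbrev Fib (X : GlobHypGreen.{u, v}) : Type := EuclideanSpace ℝ (Fin X.r)

/-- The space `C^∞(M, S)`. -/
abbrev Γ (X : GlobHypGreen.{u, v}) : Type (max u v) := Sec X.m X.Fib X.S univ

/-- The space `C_c^∞(M, S)`. -/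
abbrev Γc (X : GlobHypGreen.{u, v}) : Submodule ℝ X.Γ := SecC X.m X.Fib X.S univ

theorem exists_green (X : GlobHypGreen.{u, v}) :
    (∃ G, IsAdvancedGreen X.L X.P G) ∧ ∃ G, IsRetardedGreen X.L X.P G := by
  obtain ⟨Q, hQ, h⟩ := X.greenHyperbolic univ isOpen_univ X.globHyp
  have : Q = X.P := by
    ext u x
    exact hQ u u x (mem_univ x) (Eventually.of_forall fun _ ↦ rfl)
  exact this ▸ h

/-- The advanced Green's operator `G₊` of `P` on `M`. -/
def Gplus (X : GlobHypGreen.{u, v}) : X.Γc →ₗ[ℝ] X.Γ := X.exists_green.1.choose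

theorem isAdvancedGreen_Gplus (X : GlobHypGreen.{u, v}) : IsAdvancedGreen X.L X.P X.Gplus :=
  X.exists_green.1.choose_spec

/-- The retarded Green's operator `G₋` of `P` on `M`. -/
def Gminus (X : GlobHypGreen.{u, v}) : X.Γc →ₗ[ℝ] X.Γ := X.exists_green.2.choose

theorem isRetardedGreen_Gminus (X : GlobHypGreen.{u, v}) : IsRetardedGreen X.L X.P X.Gminus :=
  X.exists_green.2.choose_spec

/-- The operator `G = G₊ - G₋`. -/
def G (X : GlobHypGreen.{u, v}) : X.Γc →ₗ[ℝ] X.Γ := X.Gplus - X.Gminus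

/-- The vector space `SYMPL(M, S, P) = C_c^∞(M, S) / ker G`. -/
abbrev SymplSpace (X : GlobHypGreen.{u, v}) : Type (max u v) := X.Γc ⧸ LinearMap.ker X.G

/-- The residue class `[φ]`. -/
abbrev cls (X : GlobHypGreen.{u, v}) : X.Γc →ₗ[ℝ] X.SymplSpace := (LinearMap.ker X.G).mkQ

/-- The map of total spaces `S₁ → S₂` of a fibrewise map `F` over `f`. -/
def totalMap {X Y : GlobHypGreen.{u, v}} (f : X.M → Y.M) (F : ∀ x, X.S x ≃ₗ[ℝ] Y.S (f x))
    (p : TotalSpace X.Fib X.S) : TotalSpace Y.Fib Y.S := ⟨f p.1, F p.1 p.2⟩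

/-- The pair `(f, F)` consists of an embedding `f : M₁ → M₂` with open image (an injective local
diffeomorphism) and of an isomorphism `F` of smooth vector bundles from `S₁` onto the restriction
of `S₂` to the image of `f`. -/
structure IsBundleEmbedding {X Y : GlobHypGreen.{u, v}} (f : X.M → Y.M)
    (F : ∀ x, X.S x ≃ₗ[ℝ] Y.S (f x)) : Prop where
  injective : Function.Injective f
  localDiffeo : IsLocalDiffeomorph (𝓡 X.m) (𝓡 Y.m) ∞ f
  total_localDiffeo : IsLocalDiffeomorph ((𝓡 X.m).prod 𝓘(ℝ, X.Fib)) ((𝓡 Y.m).prod 𝓘(ℝ, Y.Fib)) ∞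
    (totalMap f F)

theorem IsBundleEmbedding.totalMap_injective {X Y : GlobHypGreen.{u, v}} {f : X.M → Y.M}
    {F : ∀ x, X.S x ≃ₗ[ℝ] Y.S (f x)} (h : IsBundleEmbedding f F) :
    Function.Injective (totalMap f F) := by
  rintro ⟨x, s⟩ ⟨y, t⟩ hst
  have hxy : x = y := h.injective (congrArg TotalSpace.proj hst)
  subst hxy
  have : F x s = F x t := by
    simpa [totalMap] using hst
  rw [(F x).injective this]

/-- Smoothness of a section of `S₁` can be tested after applying `F`. -/
theorem IsBundleEmbedding.contMDiffAt_of_comp {X Y : GlobHypGreen.{u, v}} {f : X.M → Y.M}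
    {F : ∀ x, X.S x ≃ₗ[ℝ] Y.S (f x)} (h : IsBundleEmbedding f F) (s : ∀ x, X.S x) (x : X.M)
    (hs : ContMDiffAt (𝓡 X.m) ((𝓡 Y.m).prod 𝓘(ℝ, Y.Fib)) ∞
      (fun x ↦ TotalSpace.mk' Y.Fib (f x) (F x (s x))) x) :
    ContMDiffAt (𝓡 X.m) ((𝓡 X.m).prod 𝓘(ℝ, X.Fib)) ∞
      (fun x ↦ TotalSpace.mk' X.Fib x (s x)) x := by
  have hΦ := h.total_localDiffeo ⟨x, s x⟩
  have h1 := hΦ.localInverse_contMDiffAt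
  have h2 := ContMDiffAt.comp (f := fun x ↦ TotalSpace.mk' Y.Fib (f x) (F x (s x))) x h1 hs
  refine h2.congr_of_eventuallyEq ?_
  have hev := hs.continuousAt (hΦ.localInverse_open_source.mem_nhds hΦ.localInverse_mem_source)
  filter_upwards [hev] with y hy
  apply h.totalMap_injective
  exact (hΦ.localInverse_right_inv hy).symm

/-- The restriction map `res(φ) = F⁻¹ ∘ φ ∘ f` from `C^∞(M₂, S₂)` to `C^∞(M₁, S₁)`. -/
def res {X Y : GlobHypGreen.{u, v}} {f : X.M → Y.M} {F : ∀ x, X.S x ≃ₗ[ℝ] Y.S (f x)}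
    (h : IsBundleEmbedding f F) : Y.Γ →ₗ[ℝ] X.Γ where
  toFun φ := ⟨fun x ↦ (F x).symm (φ (f x)), by
    refine fun x _ ↦ (h.contMDiffAt_of_comp _ x ?_).contMDiffWithinAt
    simp only [LinearEquiv.apply_symm_apply]
    have h1 : ContMDiffAt _ _ ∞ (fun y ↦ TotalSpace.mk' Y.Fib y (φ.1 y)) (f x) :=
      φ.smooth.contMDiffAt univ_mem
    exact h1.comp x (h.localDiffeo x).contMDiffAt,
    fun x hx ↦ (hx (mem_univ x)).elim⟩
  map_add' φ ψ := Sec.ext fun x ↦ by simp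
  map_smul' a φ := Sec.ext fun x ↦ by simp

open Classical in
/-- The extension by zero of `F ∘ φ ∘ f⁻¹` to `M₂`, as a family of vectors. -/
def extFun {X Y : GlobHypGreen.{u, v}} (f : X.M → Y.M) (F : ∀ x, X.S x ≃ₗ[ℝ] Y.S (f x))
    (φ : ∀ x, X.S x) (y : Y.M) : Y.S y :=
  if h : ∃ x, f x = y then h.choose_spec ▸ F h.choose (φ h.choose) else 0

theorem extFun_apply {X Y : GlobHypGreen.{u, v}} {f : X.M → Y.M} (hf : Function.Injective f)
    (F : ∀ x, X.S x ≃ₗ[ℝ] Y.S (f x)) (φ : ∀ x, X.S x) (x : X.M) :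
    extFun f F φ (f x) = F x (φ x) := by
  have h : ∃ x', f x' = f x := ⟨x, rfl⟩
  have key : ∀ (x' : X.M) (e : f x' = f x), (e ▸ F x' (φ x') : Y.S (f x)) = F x (φ x) := by
    intro x' e
    obtain rfl := hf e
    rfl
  rw [extFun, dif_pos h]
  exact key _ _

theorem extFun_of_notMem {X Y : GlobHypGreen.{u, v}} {f : X.M → Y.M}
    (F : ∀ x, X.S x ≃ₗ[ℝ] Y.S (f x)) (φ : ∀ x, X.S x) {y : Y.M} (hy : y ∉ range f) :
    extFun f F φ y = 0 := dif_neg hy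

theorem closure_extFun_subset {X Y : GlobHypGreen.{u, v}} {f : X.M → Y.M}
    {F : ∀ x, X.S x ≃ₗ[ℝ] Y.S (f x)} (h : IsBundleEmbedding f F) (φ : X.Γc) :
    IsCompact (f '' supp φ.1) ∧ {y | extFun f F φ.1 y ≠ 0} ⊆ f '' supp φ.1 := by
  refine ⟨IsCompact.image φ.2 h.localDiffeo.contMDiff.continuous, fun y hy ↦ ?_⟩
  by_cases hr : y ∈ range f
  · obtain ⟨x, rfl⟩ := hr
    refine ⟨x, ⟨subset_closure fun h0 ↦ hy ?_, mem_univ x⟩, rfl⟩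
    rw [extFun_apply h.injective, h0, map_zero]
  · exact (hy (extFun_of_notMem F _ hr)).elim

/-- The extension by zero `ext : C_c^∞(M₁, S₁) → C_c^∞(M₂, S₂)`. -/
def ext {X Y : GlobHypGreen.{u, v}} {f : X.M → Y.M} {F : ∀ x, X.S x ≃ₗ[ℝ] Y.S (f x)}
    (h : IsBundleEmbedding f F) : X.Γc →ₗ[ℝ] Y.Γc where
  toFun φ := ⟨⟨extFun f F φ.1, by
    refine fun y _ ↦ ContMDiffAt.contMDiffWithinAt ?_
    by_cases hr : y ∈ range f
    · obtain ⟨x, rfl⟩ := hr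
      have hf := h.localDiffeo x
      have h1 : ContMDiffAt _ _ ∞ (fun x ↦ TotalSpace.mk' X.Fib x (φ.1 x)) x :=
        φ.1.smooth.contMDiffAt univ_mem
      have h2 := ((h.total_localDiffeo _).contMDiffAt.comp x h1)
      have e : hf.localInverse (f x) = x := hf.localInverse_left_inv hf.localInverse_mem_target
      have h3 := ContMDiffAt.comp_of_eq (f := hf.localInverse) h2 hf.localInverse_contMDiffAt e
      refine h3.congr_of_eventuallyEq ?_
      filter_upwards [hf.localInverse_open_source.mem_nhds hf.localInverse_mem_source] with z hz
      have hz' := hf.localInverse_right_inv hz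
      have : ∀ x z, f x = z → TotalSpace.mk' Y.Fib z (extFun f F φ.1 z) =
          totalMap f F ⟨x, φ.1 x⟩ := by
        rintro x _ rfl
        rw [extFun_apply h.injective]
        rfl
      exact this _ z hz'
    · have hc := closure_extFun_subset h φ
      have hy : y ∉ f '' supp φ.1 := fun hy ↦ hr (image_subset_range _ _ hy)
      refine ((contMDiff_zeroSection ℝ Y.S) y).congr_of_eventuallyEq ?_
      filter_upwards [hc.1.isClosed.isOpen_compl.mem_nhds hy] with z hz
      have : extFun f F φ.1 z = 0 := by
        by_contra h0
        exact hz (hc.2 h0)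
      rw [this]
      rfl, fun y hy ↦ (hy (mem_univ y)).elim⟩, by
    have hc := closure_extFun_subset h φ
    exact hc.1.of_isClosed_subset (isClosed_closure.inter isClosed_univ)
      (inter_subset_left.trans (closure_minimal hc.2 hc.1.isClosed))⟩
  map_add' φ ψ := by
    apply Subtype.ext
    ext y
    by_cases hr : y ∈ range f
    · obtain ⟨x, rfl⟩ := hr
      simp [extFun_apply h.injective]
    · simp [extFun_of_notMem F _ hr]
  map_smul' a φ := by
    apply Subtype.ext
    ext y
    by_cases hr : y ∈ range f
    · obtain ⟨x, rfl⟩ := hr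
      simp [extFun_apply h.injective]
    · simp [extFun_of_notMem F _ hr]

/-- A morphism `(f, F)`: a time-orientation preserving isometric embedding `f` with open and
causally compatible image, and a fibrewise isometric vector bundle isomorphism `F` over `f` such
that `res ∘ P₂ = P₁ ∘ res`. -/
structure Hom (X Y : GlobHypGreen.{u, v}) : Type (max u v) where
  f : X.M → Y.M
  F : ∀ x, X.S x ≃ₗ[ℝ] Y.S (f x)
  isBundleEmbedding : IsBundleEmbedding f F
  isometry : ∀ x v w, Y.L.metric (f x) (mfderiv (𝓡 X.m) (𝓡 Y.m) f x v)
    (mfderiv (𝓡 X.m) (𝓡 Y.m) f x w) = X.L.metric x v w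
  map_future : ∀ x v, mfderiv (𝓡 X.m) (𝓡 Y.m) f x v ∈ Y.L.future (f x) ↔ v ∈ X.L.future x
  causallyCompatible : Y.L.IsCausallyCompatible (range f)
  fiber_isometry : ∀ x v w, Y.inner (f x) (F x v) (F x w) = X.inner x v w
  comm : ∀ φ : Y.Γ, res isBundleEmbedding (Y.P φ) = X.P (res isBundleEmbedding φ)

theorem IsBundleEmbedding.refl (X : GlobHypGreen.{u, v}) :
    IsBundleEmbedding (X := X) (Y := X) id (fun x ↦ LinearEquiv.refl ℝ (X.S x)) where
  injective := Function.injective_id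
  localDiffeo := (Diffeomorph.refl (𝓡 X.m) X.M ∞).isLocalDiffeomorph
  total_localDiffeo := (Diffeomorph.refl ((𝓡 X.m).prod 𝓘(ℝ, X.Fib))
    (TotalSpace X.Fib X.S) ∞).isLocalDiffeomorph

theorem IsBundleEmbedding.comp {X Y Z : GlobHypGreen.{u, v}} {f : X.M → Y.M}
    {F : ∀ x, X.S x ≃ₗ[ℝ] Y.S (f x)} {f' : Y.M → Z.M} {F' : ∀ x, Y.S x ≃ₗ[ℝ] Z.S (f' x)}
    (h' : IsBundleEmbedding f' F') (h : IsBundleEmbedding f F) :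
    IsBundleEmbedding (X := X) (Y := Z) (f' ∘ f) (fun x ↦ (F x).trans (F' (f x))) where
  injective := h'.injective.comp h.injective
  localDiffeo x := (h.localDiffeo x).comp _ _ (h'.localDiffeo (f x))
  total_localDiffeo p := (h.total_localDiffeo p).comp _ _ (h'.total_localDiffeo (totalMap f F p))

/-- The identity morphism `(id_M, id_S)`. -/
def Hom.id (X : GlobHypGreen.{u, v}) : Hom X X where
  f := _root_.id
  F x := LinearEquiv.refl ℝ (X.S x)
  isBundleEmbedding := IsBundleEmbedding.refl X
  isometry x v w := by simp [mfderiv_id]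
  map_future x v := by simp [mfderiv_id]
  causallyCompatible := by
    rw [range_id, Spacetime.isCausallyCompatible_iff]
    exact fun _ _ _ _ h ↦ h
  fiber_isometry _ _ _ := rfl
  comm _ := rfl

/-- The composition `(f', F') ∘ (f, F) = (f' ∘ f, F' ∘ F)`. -/
def Hom.comp {X Y Z : GlobHypGreen.{u, v}} (g : Hom Y Z) (h : Hom X Y) : Hom X Z where
  f := g.f ∘ h.f
  F x := (h.F x).trans (g.F (h.f x))
  isBundleEmbedding := g.isBundleEmbedding.comp h.isBundleEmbedding
  isometry x v w := by
    have e := mfderiv_comp x ((g.isBundleEmbedding.localDiffeo (h.f x)).mdifferentiableAt (by simp))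
      ((h.isBundleEmbedding.localDiffeo x).mdifferentiableAt (by simp))
    rw [e]
    exact (g.isometry _ _ _).trans (h.isometry _ _ _)
  map_future x v := by
    have e := mfderiv_comp x ((g.isBundleEmbedding.localDiffeo (h.f x)).mdifferentiableAt (by simp))
      ((h.isBundleEmbedding.localDiffeo x).mdifferentiableAt (by simp))
    rw [e]
    exact (g.map_future _ _).trans (h.map_future _ _)
  causallyCompatible := by
    have hg := Spacetime.isCausallyCompatible_iff.1 g.causallyCompatible
    have hh := Spacetime.isCausallyCompatible_iff.1 h.causallyCompatible
    rw [Spacetime.isCausallyCompatible_iff]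
    rintro _ ⟨x, rfl⟩ _ ⟨y, rfl⟩ hxy
    have h1 := hg _ (mem_range_self (h.f x)) _ (mem_range_self (h.f y)) hxy
    have h2 := Spacetime.CausalLE.of_map g.isBundleEmbedding.localDiffeo
      g.isBundleEmbedding.injective g.map_future h1
    have h3 := hh _ (mem_range_self x) _ (mem_range_self y) h2
    rw [range_comp]
    exact Spacetime.CausalLE.map g.isBundleEmbedding.localDiffeo g.map_future h3
  fiber_isometry x v w := (g.fiber_isometry _ _ _).trans (h.fiber_isometry _ _ _)
  comm φ := by
    have e : ∀ ψ : Z.Γ, res (g.isBundleEmbedding.comp h.isBundleEmbedding) ψ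
        = res h.isBundleEmbedding (res g.isBundleEmbedding ψ) := fun _ ↦ rfl
    rw [e, e, g.comm, h.comm]

/-- The category `GlobHypGreen`. -/
instance : Category.{max u v} GlobHypGreen.{u, v} where
  Hom := Hom
  id := Hom.id
  comp f g := g.comp f

/-- Extension by zero along a morphism. -/
abbrev Hom.ext {X Y : GlobHypGreen.{u, v}} (f : X ⟶ Y) : X.Γc →ₗ[ℝ] Y.Γc :=
  GlobHypGreen.ext (Hom.isBundleEmbedding f)

end GlobHypGreen

/-! ### Symplectic vector spaces -/

/-- Real symplectic vector spaces: vector spaces with a non-degenerate alternating form. -/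
structure Sympl : Type (w + 1) where
  V : Type w
  [addCommGroup : AddCommGroup V]
  [module : Module ℝ V]
  form : V →ₗ[ℝ] V →ₗ[ℝ] ℝ
  alternating : form.IsAlt
  nondegenerate : form.Nondegenerate

namespace Sympl

attribute [instance] addCommGroup module

/-- Symplectic linear maps. -/
@[ext]
structure Hom (V W : Sympl.{w}) : Type w where
  toLinearMap : V.V →ₗ[ℝ] W.V
  map_form : ∀ x y, W.form (toLinearMap x) (toLinearMap y) = V.form x y

/-- The category of real symplectic vector spaces and symplectic linear maps. -/
instance : Category.{w} Sympl.{w} where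
  Hom := Hom
  id V := ⟨LinearMap.id, fun _ _ ↦ rfl⟩
  comp f g := ⟨g.toLinearMap ∘ₗ f.toLinearMap, fun _ _ ↦
    (g.map_form _ _).trans (f.map_form _ _)⟩

end Sympl

end GreenHyp

end

open GreenHyp

/-!
Write `⟪σ, τ⟫ = ∫ ⟨σ, τ⟩ dV` (`pairing`) and `Γc` for the compactly supported smooth sections. The one
deep ingredient is geometric: in a globally hyperbolic spacetime the causal diamonds
`J₊(K₁) ∩ J₋(K₂)` of compact sets are relatively compact
(`Spacetime.IsGloballyHyperbolic.exists_compact_diamond`). Hence `supp (G₊ φ) ∩ supp (G₋ ψ)` is compact,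
formal self-adjointness of `P` applies to this pair of sections, and it gives
`⟪G₊ φ, ψ⟫ = ⟪φ, G₋ ψ⟫` (`pairing_advanced_eq`). The algebraic claims follow from this.

* Both Green's operators are determined by each other, as the pairing is non-degenerate
  (`eq_zero_of_forall_pairing_eq_zero`): they are unique.
* `⟪G φ, ψ⟫` is antisymmetric in `φ` and `ψ`, so it descends to `Γc ⧸ ker G`, where it is alternating,
  and it is non-degenerate there, again by non-degeneracy of the pairing.
* `ker G = P (Γc)` (`ker_G_eq_range`): if `G₊ φ = G₋ φ`, then this section has its support in a causal
  diamond. Since `P` commutes with extension by zero (`Hom.P_ext`, from locality of `P`), extension by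
  zero maps kernels into kernels.
* For a morphism, `res ∘ G₊ ∘ ext` and `res ∘ G₋ ∘ ext` are Green's operators on the source, hence the
  Green's operators there by uniqueness. As `ext` is adjoint to `res` (`Hom.pairing_ext`), the induced
  linear map preserves the symplectic forms.

The compactness of diamonds is proved without geodesics and without a limit curve theorem. In a chart,
a displacement into the past by `s exp (-C τ)`, with `τ` a local time function and `C` large, turns
causal curves into timelike ones (`exists_push_constant`, `Spacetime.exists_isPushNhd`). If points `y` of
a diamond went to infinity, follow the causal curves from `K₁` to `y` along an ultrafilter: they leave
one push neighbourhood after another, at points which converge along the ultrafilter to points `q k`.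
The neighbourhoods are chosen such that the sequence `q` cannot converge (`exists_escape`), and pushing
gives points `p k` close to `q k` with `p k ≪ p (k + 1)` and `p k ≪ y` for almost all `y`. The `p k` lie
on an inextensible timelike curve, which meets the Cauchy hypersurface at some `a ≪ y`. By time
reversal there is also `a'` in the hypersurface with `y ≪ a'`, and `a ≪ a'` is impossible.

The volume element, defined by cutting the manifold into pieces of chart domains, is shown to be given
by the density of any chart on the domain of that chart. So it is locally finite, positive on open
sets, and preserved by isometric open embeddings (`Spacetime.map_vol`).
-/

noncomputable section

namespace GreenHyp

/-! ### Lorentzian forms on a vector space -/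

section LorentzianForms

/-- In a Lorentzian vector space the orthogonal complement of *every* timelike vector is spacelike,
not just that of the one vector which witnesses the signature. -/
theorem pos_of_orthogonal_timelike {E : Type*} [AddCommGroup E] [Module ℝ E]
    (g : E →ₗ[ℝ] E →ₗ[ℝ] ℝ) (hs : ∀ v w, g v w = g w v)
    (hL : ∃ v, g v v < 0 ∧ ∀ w, g v w = 0 → w ≠ 0 → 0 < g w w)
    {t : E} (ht : g t t < 0) {w : E} (htw : g t w = 0) (hw : w ≠ 0) : 0 < g w w := by
  obtain ⟨v, hv, hpos⟩ := hL
  by_contra hneg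
  push Not at hneg
  have ht0 : t ≠ 0 := by rintro rfl; simp at ht
  have hvt : g v t ≠ 0 := fun h ↦ absurd (hpos t h ht0) (not_lt.2 ht.le)
  -- The plane spanned by `t` and `w` is non-positive and meets the hyperplane orthogonal to `v`.
  set u := g v w • t - g v t • w with hu
  have hvu : g v u = 0 := by simp [hu]; ring
  have hguu : g u u = g v w ^ 2 * g t t + g v t ^ 2 * g w w := by
    have : g w t = 0 := by rw [hs, htw]
    simp [hu, htw, this]; ring
  have hu0 : u ≠ 0 := by
    intro h
    have h1 : g t u = 0 := by rw [h]; simp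
    have h2 : g v w = 0 := by
      simp [hu, htw] at h1
      exact h1.resolve_right ht.ne
    rw [hu, h2, zero_smul, zero_sub, neg_eq_zero, smul_eq_zero] at h
    exact h.elim hvt hw
  have := hpos u hvu hu0
  nlinarith [mul_nonneg (sq_nonneg (g v w)) (neg_nonneg.2 ht.le),
    mul_nonneg (sq_nonneg (g v t)) (neg_nonneg.2 hneg)]

variable {E : Type*} [NormedAddCommGroup E] [NormedSpace ℝ E]

/-- Future-directed timelike vectors at `z`, for a field of bilinear forms `g` and a
time-orientation `T`. -/
def IsTL (g : E → E →L[ℝ] E →L[ℝ] ℝ) (T : E → E) (z v : E) : Prop :=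
  g z v v < 0 ∧ g z v (T z) < 0

/-- Being timelike and future-directed is an open condition on tangent vectors. -/
theorem eventually_isTL {g : E → E →L[ℝ] E →L[ℝ] ℝ} {T : E → E} {z₀ v₀ : E}
    (hg : ContinuousAt g z₀) (hT : ContinuousAt T z₀) (h : IsTL g T z₀ v₀) :
    ∀ᶠ p : E × E in 𝓝 (z₀, v₀), IsTL g T p.1 p.2 := by
  have hg' : ContinuousAt (fun p : E × E ↦ g p.1) (z₀, v₀) := hg.comp_of_eq continuousAt_fst rfl
  have hT' : ContinuousAt (fun p : E × E ↦ T p.1) (z₀, v₀) := hT.comp_of_eq continuousAt_fst rfl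
  have h2 : ContinuousAt (fun p : E × E ↦ p.2) (z₀, v₀) := continuousAt_snd
  exact ((hg'.clm_apply h2).clm_apply h2 |>.eventually_lt continuousAt_const h.1).and
    ((hg'.clm_apply h2).clm_apply hT' |>.eventually_lt continuousAt_const h.2)

theorem exists_norm_sub_le_of_contDiffAt {F : Type*} [NormedAddCommGroup F] [NormedSpace ℝ F]
    {f : E → F} {z₀ : E} (hf : ContDiffAt ℝ 1 f z₀) :
    ∃ K : NNReal, ∃ t ∈ 𝓝 z₀, ∀ x ∈ t, ∀ y ∈ t, ‖f x - f y‖ ≤ K * ‖x - y‖ := by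
  obtain ⟨K, t, ht, hK⟩ := hf.exists_lipschitzOnWith
  exact ⟨K, t, ht, fun x hx y hy ↦ hK.norm_sub_le hx hy⟩

variable [FiniteDimensional ℝ E]

/-- Near a point `z₀`, the linear function `τ = -g_{z₀}(T, ·)` is a time function: it grows at a
uniform rate along all causal vectors. -/
theorem exists_time_function {g : E → E →L[ℝ] E →L[ℝ] ℝ} {T : E → E} {z₀ : E}
    (hg : ContinuousAt g z₀) (hT : ContinuousAt T z₀) (hs : ∀ v w, g z₀ v w = g z₀ w v)
    (hlor : ∀ w, g z₀ (T z₀) w = 0 → w ≠ 0 → 0 < g z₀ w w) :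
    ∃ l > 0, ∀ᶠ z in 𝓝 z₀, ∀ v, g z v v ≤ 0 → g z v (T z) ≤ 0 → l * ‖v‖ ≤ - g z₀ (T z₀) v := by
  have hK : IsCompact (Metric.sphere (0 : E) 1 ∩ {v | g z₀ v v ≤ 0 ∧ g z₀ v (T z₀) ≤ 0}) := by
    refine (isCompact_sphere 0 1).inter_right ?_
    have h1 : Continuous fun v ↦ g z₀ v v := by fun_prop
    have h2 : Continuous fun v ↦ g z₀ v (T z₀) := by fun_prop
    exact (isClosed_le h1 continuous_const).inter (isClosed_le h2 continuous_const)
  have hpos : ∀ v ∈ Metric.sphere (0 : E) 1 ∩ {v | g z₀ v v ≤ 0 ∧ g z₀ v (T z₀) ≤ 0},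
      0 < - g z₀ (T z₀) v := by
    rintro v ⟨hv, h1, h2⟩
    have hv0 : v ≠ 0 := by rintro rfl; simp at hv
    rw [hs] at h2
    rcases h2.lt_or_eq with h | h
    · linarith
    · exact absurd (hlor v h hv0) (not_lt.2 h1)
  obtain ⟨l, hl, hlK⟩ : ∃ l > 0, ∀ v ∈ Metric.sphere (0 : E) 1 ∩
      {v | g z₀ v v ≤ 0 ∧ g z₀ v (T z₀) ≤ 0}, l < - g z₀ (T z₀) v := by
    rcases (Metric.sphere (0 : E) 1 ∩ {v | g z₀ v v ≤ 0 ∧ g z₀ v (T z₀) ≤ 0}).eq_empty_or_nonempty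
      with h | h
    · exact ⟨1, one_pos, by simp [h]⟩
    · obtain ⟨v, hv, hmin⟩ := hK.exists_isMinOn h
        (f := fun v ↦ - g z₀ (T z₀) v) (by fun_prop)
      have := hpos v hv
      exact ⟨(- g z₀ (T z₀) v) / 2, by linarith, fun w hw ↦ by
        have : - g z₀ (T z₀) v ≤ - g z₀ (T z₀) w := hmin hw
        linarith⟩
  refine ⟨l, hl, ?_⟩
  -- the strict inequality on the compact set of unit causal vectors persists for nearby `z`
  have key : ∀ᶠ z in 𝓝 z₀, ∀ v ∈ Metric.sphere (0 : E) 1,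
      g z v v ≤ 0 → g z v (T z) ≤ 0 → l < - g z₀ (T z₀) v := by
    refine (isCompact_sphere (0 : E) 1).eventually_forall_of_forall_eventually fun v hv ↦ ?_
    have hg' : ContinuousAt (fun p : E × E ↦ g p.1) (z₀, v) := hg.comp_of_eq continuousAt_fst rfl
    have hT' : ContinuousAt (fun p : E × E ↦ T p.1) (z₀, v) := hT.comp_of_eq continuousAt_fst rfl
    have h2 : ContinuousAt (fun p : E × E ↦ p.2) (z₀, v) := continuousAt_snd
    by_cases h : g z₀ v v ≤ 0 ∧ g z₀ v (T z₀) ≤ 0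
    · have : ContinuousAt (fun p : E × E ↦ - g z₀ (T z₀) p.2) (z₀, v) := by fun_prop
      filter_upwards [continuousAt_const.eventually_lt this (hlK v ⟨hv, h⟩)] with p hp _ _
        using hp
    · rw [not_and_or, not_le, not_le] at h
      rcases h with h | h
      · filter_upwards [continuousAt_const.eventually_lt ((hg'.clm_apply h2).clm_apply h2) h]
          with p hp h1 using absurd hp (not_lt.2 h1)
      · filter_upwards [continuousAt_const.eventually_lt ((hg'.clm_apply h2).clm_apply hT') h]
          with p hp _ h1 using absurd hp (not_lt.2 h1)
  filter_upwards [key] with z hz v h1 h2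
  rcases eq_or_ne v 0 with rfl | hv
  · simp
  have hn : 0 < ‖v‖ := norm_pos_iff.2 hv
  have := hz (‖v‖⁻¹ • v) (by simp [norm_smul, hn.ne'])
    (by
      simp only [map_smul, smul_apply, smul_eq_mul]
      exact mul_nonpos_of_nonneg_of_nonpos (by positivity)
        (mul_nonpos_of_nonneg_of_nonpos (by positivity) h1))
    (by
      simp only [map_smul, smul_apply, smul_eq_mul]
      exact mul_nonpos_of_nonneg_of_nonpos (by positivity) h2)
  simp only [map_smul, smul_eq_mul] at this
  rw [← mul_neg, ← div_eq_inv_mul, lt_div_iff₀ hn] at this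
  exact this.le

/-- Moving the base point of a causal vector `v` from `z` to `z - ε T` may turn `v` spacelike, but
by an amount of order `ε |v|²` only, as the metric is Lipschitz. Adding a multiple of `T` of order
`ε |v|` makes it timelike again. -/
theorem exists_push_constant {g : E → E →L[ℝ] E →L[ℝ] ℝ} {T : E → E} {z₀ : E}
    (hg : ContDiffAt ℝ 1 g z₀) (hT : ContinuousAt T z₀) (hs : ∀ z v w, g z v w = g z w v)
    (hTT : g z₀ (T z₀) (T z₀) < 0)
    (hlor : ∀ w, g z₀ (T z₀) w = 0 → w ≠ 0 → 0 < g z₀ w w) :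
    ∃ C : ℝ, ∃ r > 0, ∀ z ∈ Metric.ball z₀ r, ∀ v, g z v v ≤ 0 → g z v (T z) < 0 →
      ∀ ε > 0, z - ε • T z₀ ∈ Metric.ball z₀ r →
        IsTL g T (z - ε • T z₀) (v + (C * ε * (- g z₀ (T z₀) v)) • T z₀) := by
  obtain ⟨l, hl, hτ⟩ := exists_time_function hg.continuousAt hT (hs z₀) hlor
  obtain ⟨K, t, ht, hK⟩ := exists_norm_sub_le_of_contDiffAt hg
  set e := T z₀ with he
  have hgc := hg.continuousAt
  have hTL : IsTL g T z₀ e := ⟨hTT, hTT⟩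
  have hTLe : ∀ᶠ z in 𝓝 z₀, IsTL g T z e :=
    (continuousAt_id.prodMk continuousAt_const : ContinuousAt (fun z ↦ (z, e)) z₀).eventually
      (eventually_isTL hgc hT hTL)
  have hn1 : ∀ᶠ z in 𝓝 z₀, ‖(g z).flip e - (g z₀).flip e‖ < l / 2 := by
    have : ContinuousAt (fun z ↦ ‖(g z).flip e - (g z₀).flip e‖) z₀ := by
      have : ContinuousAt (fun z ↦ (g z).flip) z₀ :=
        (ContinuousLinearMap.flipₗᵢ ℝ E E ℝ).continuous.continuousAt.comp hgc
      fun_prop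
    exact this.eventually_lt continuousAt_const (by simpa using half_pos hl)
  have hn2 : ∀ᶠ z in 𝓝 z₀, ‖(g z).flip (T z) - (g z₀).flip e‖ < l / 2 := by
    have : ContinuousAt (fun z ↦ ‖(g z).flip (T z) - (g z₀).flip e‖) z₀ := by
      have : ContinuousAt (fun z ↦ (g z).flip) z₀ :=
        (ContinuousLinearMap.flipₗᵢ ℝ E E ℝ).continuous.continuousAt.comp hgc
      fun_prop
    exact this.eventually_lt continuousAt_const (by simpa [he] using half_pos hl)
  obtain ⟨r, hr, hball⟩ := Metric.eventually_nhds_iff_ball.1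
    (hτ.and ((eventually_mem_set.2 ht).and (hTLe.and (hn1.and hn2))))
  refine ⟨(K * ‖e‖ + 1) / l ^ 2, r, hr, fun z hz v h1 h2 ε hε hz' ↦ ?_⟩
  obtain ⟨hzτ, hzt, -, -, -⟩ := hball z hz
  obtain ⟨-, hzt', hze, hz1, hz2⟩ := hball _ hz'
  set z' := z - ε • e with hz'def
  set κ := (K * ‖e‖ + 1) / l ^ 2 * ε * (- g z₀ e v) with hκ
  have hv0 : 0 < ‖v‖ := by
    rw [norm_pos_iff]
    rintro rfl
    simp at h2
  have hτv := hzτ v h1 h2.le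
  set n := ‖v‖ with hn
  have hτ0 : 0 < - g z₀ e v := lt_of_lt_of_le (by positivity) hτv
  have hκl : (K * ‖e‖ + 1) * ε * n ≤ κ * l := by
    rw [hκ]
    calc (K * ‖e‖ + 1) * ε * n = (K * ‖e‖ + 1) / l ^ 2 * ε * (l * n) * l := by field_simp
      _ ≤ _ := by gcongr
  have hκ0 : 0 < κ := by
    have : 0 < (K * ‖e‖ + 1) * ε * n := by positivity
    exact pos_of_mul_pos_left (lt_of_lt_of_le this hκl) hl.le
  -- `-g_{z₀}(v, e)` is at least `l ‖v‖`, and the functionals `g_{z'}(·, e)` and `g_{z'}(·, T z')`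
  -- differ from `g_{z₀}(·, e)` by at most `l / 2` in norm
  have hb1 : g z' v e ≤ - (l / 2 * n) := by
    have := ((g z').flip e - (g z₀).flip e).le_of_opNorm_le hz1.le v
    rw [Real.norm_eq_abs] at this
    have := (abs_le.1 this).2
    simp only [sub_apply, ContinuousLinearMap.flip_apply] at this
    rw [hs z₀ v e] at this
    linarith
  have hb2 : g z' v (T z') ≤ - (l / 2 * n) := by
    have := ((g z').flip (T z') - (g z₀).flip e).le_of_opNorm_le hz2.le v
    rw [Real.norm_eq_abs] at this
    have := (abs_le.1 this).2
    simp only [sub_apply, ContinuousLinearMap.flip_apply] at this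
    rw [hs z₀ v e] at this
    linarith
  -- `v` is causal at `z`, so that at `z'` it fails to be causal by the Lipschitz error only
  have hb3 : g z' v v ≤ K * (ε * ‖e‖) * n * n := by
    have h3 := hK _ hzt' _ hzt
    have h4 : ‖z' - z‖ = ε * ‖e‖ := by
      rw [hz'def, sub_sub_cancel_left, norm_neg, norm_smul, Real.norm_of_nonneg hε.le]
    rw [h4] at h3
    have := ((g z' - g z).le_opNorm₂ v v).trans
      (mul_le_mul_of_nonneg_right (mul_le_mul_of_nonneg_right h3 (norm_nonneg v)) (norm_nonneg v))
    rw [Real.norm_eq_abs] at this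
    have := (abs_le.1 this).2
    simp only [sub_apply] at this
    linarith
  have hn0 : 0 < l / 2 * n := by positivity
  constructor
  · have hexp : g z' (v + κ • e) (v + κ • e) = g z' v v + 2 * κ * g z' v e + κ ^ 2 * g z' e e := by
      simp only [map_add, map_smul, add_apply, smul_apply,
        smul_eq_mul]
      rw [hs z' e v]
      ring
    rw [hexp]
    have h5 : κ ^ 2 * g z' e e < 0 := mul_neg_of_pos_of_neg (by positivity) hze.1
    have h6 : 2 * κ * g z' v e ≤ 2 * κ * (-(l / 2 * n)) := by gcongr
    have h7 : (K * ‖e‖ + 1) * ε * n * n ≤ κ * l * n := by gcongr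
    nlinarith [mul_pos (mul_pos hε hv0) hv0]
  · simp only [map_add, map_smul, add_apply, smul_apply,
      smul_eq_mul]
    have := mul_neg_of_pos_of_neg hκ0 hze.2
    linarith

end LorentzianForms

end GreenHyp

end

noncomputable section

namespace GreenHyp

/-! ### The metric in a chart -/

namespace Spacetime

section Chart

variable {m : ℕ} {M : Type u} [TopologicalSpace M]
  [ChartedSpace (EuclideanSpace ℝ (Fin m)) M] [IsManifold (𝓡 m) ∞ M] (L : Spacetime m M)

/-- The inverse of the preferred chart around `c`. -/
abbrev chartInv (c : M) : EuclideanSpace ℝ (Fin m) → M :=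
  (chartAt (EuclideanSpace ℝ (Fin m)) c).symm

/-- The derivative of the inverse chart around `c`, as a map out of the coordinate space. -/
def chartFrame (c : M) (z : EuclideanSpace ℝ (Fin m)) :
    EuclideanSpace ℝ (Fin m) →L[ℝ] TangentSpace (𝓡 m) (chartInv c z) :=
  mfderiv (𝓡 m) (𝓡 m) (chartInv c) z

/-- The metric in the coordinates of the chart around `c`. -/
def chartMetric (c : M) (z : EuclideanSpace ℝ (Fin m)) :
    EuclideanSpace ℝ (Fin m) →L[ℝ] EuclideanSpace ℝ (Fin m) →L[ℝ] ℝ :=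
  let g : EuclideanSpace ℝ (Fin m) →L[ℝ] EuclideanSpace ℝ (Fin m) →L[ℝ] ℝ := L.metric (chartInv c z)
  let D : EuclideanSpace ℝ (Fin m) →L[ℝ] EuclideanSpace ℝ (Fin m) := chartFrame c z
  g.bilinearComp D D

theorem chartMetric_apply (c : M) (z v w : EuclideanSpace ℝ (Fin m)) :
    L.chartMetric c z v w = L.metric (chartInv c z) (chartFrame c z v) (chartFrame c z w) := rfl

theorem chartMetric_symm (c : M) (z v w : EuclideanSpace ℝ (Fin m)) :
    L.chartMetric c z v w = L.chartMetric c z w v := L.metric_symm _ _ _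

/-- A timelike vector field which induces the time-orientation. -/
def timeField (x : M) : TangentSpace (𝓡 m) x := L.time_orientation.choose x

theorem timeField_smooth : ContMDiff (𝓡 m) (𝓡 m).tangent ∞
    (fun x ↦ (⟨x, L.timeField x⟩ : TangentBundle (𝓡 m) M)) :=
  L.time_orientation.choose_spec.1

theorem timeField_timelike (x : M) : L.metric x (L.timeField x) (L.timeField x) < 0 :=
  L.time_orientation.choose_spec.2.1 x

theorem mem_future_iff (x : M) (v : TangentSpace (𝓡 m) x) :
    v ∈ L.future x ↔ L.metric x v v ≤ 0 ∧ L.metric x v (L.timeField x) < 0 :=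
  L.time_orientation.choose_spec.2.2 x v

/-- The vector field `timeField` in the coordinates of the chart around `c`. -/
def chartTime (c : M) (z : EuclideanSpace ℝ (Fin m)) : EuclideanSpace ℝ (Fin m) :=
  mfderiv (𝓡 m) (𝓡 m) (chartAt (EuclideanSpace ℝ (Fin m)) c) (chartInv c z)
    (L.timeField (chartInv c z))

variable {L} {c : M} {z : EuclideanSpace ℝ (Fin m)}

theorem chartFrame_mfderiv (hz : z ∈ (chartAt (EuclideanSpace ℝ (Fin m)) c).target)
    (v : TangentSpace (𝓡 m) (chartInv c z)) :
    chartFrame c z (mfderiv (𝓡 m) (𝓡 m) (chartAt (EuclideanSpace ℝ (Fin m)) c) (chartInv c z) v)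
      = v := by
  have hI : IsManifold (𝓡 m) 1 M := .of_le (n := ∞) (by simp)
  have h := (mdifferentiable_chart (I := 𝓡 m) c).symm_comp_deriv
    ((chartAt (EuclideanSpace ℝ (Fin m)) c).map_target hz)
  have h2 := (chartAt (EuclideanSpace ℝ (Fin m)) c).right_inv hz
  rw [h2] at h
  exact congrArg (fun T ↦ T v) h

theorem mfderiv_chartFrame (hz : z ∈ (chartAt (EuclideanSpace ℝ (Fin m)) c).target)
    (v : EuclideanSpace ℝ (Fin m)) :
    mfderiv (𝓡 m) (𝓡 m) (chartAt (EuclideanSpace ℝ (Fin m)) c) (chartInv c z) (chartFrame c z v)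
      = v := by
  have hI : IsManifold (𝓡 m) 1 M := .of_le (n := ∞) (by simp)
  have h := (mdifferentiable_chart (I := 𝓡 m) c).comp_symm_deriv hz
  exact congrArg (fun T ↦ T v) h

theorem chartFrame_injective (hz : z ∈ (chartAt (EuclideanSpace ℝ (Fin m)) c).target) :
    Function.Injective (chartFrame c z) :=
  Function.LeftInverse.injective (mfderiv_chartFrame hz)

theorem chartFrame_mem_future_iff (hz : z ∈ (chartAt (EuclideanSpace ℝ (Fin m)) c).target)
    (v : EuclideanSpace ℝ (Fin m)) :
    chartFrame c z v ∈ L.future (chartInv c z) ↔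
      L.chartMetric c z v v ≤ 0 ∧ L.chartMetric c z v (L.chartTime c z) < 0 := by
  rw [mem_future_iff, chartMetric_apply, chartMetric_apply, chartTime, chartFrame_mfderiv hz]

theorem chartMetric_chartTime_neg (hz : z ∈ (chartAt (EuclideanSpace ℝ (Fin m)) c).target) :
    L.chartMetric c z (L.chartTime c z) (L.chartTime c z) < 0 := by
  rw [chartMetric_apply, chartTime, chartFrame_mfderiv hz]
  exact L.timeField_timelike _

theorem metric_pos_of_orthogonal_timeField {x : M} {w : TangentSpace (𝓡 m) x}
    (h : L.metric x (L.timeField x) w = 0) (hw : w ≠ 0) : 0 < L.metric x w w := by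
  let g : TangentSpace (𝓡 m) x →ₗ[ℝ] TangentSpace (𝓡 m) x →ₗ[ℝ] ℝ :=
    LinearMap.mk₂ ℝ (fun v w ↦ L.metric x v w) (by simp) (by simp) (by simp) (by simp)
  exact pos_of_orthogonal_timelike g (fun v w ↦ L.metric_symm x v w) (L.lorentzian x)
    (L.timeField_timelike x) h hw

theorem chartMetric_pos_of_orthogonal
    (hz : z ∈ (chartAt (EuclideanSpace ℝ (Fin m)) c).target) {w : EuclideanSpace ℝ (Fin m)}
    (h : L.chartMetric c z (L.chartTime c z) w = 0) (hw : w ≠ 0) : 0 < L.chartMetric c z w w := by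
  rw [chartMetric_apply, chartTime, chartFrame_mfderiv hz] at h
  exact metric_pos_of_orthogonal_timeField h fun h0 ↦
    hw (chartFrame_injective hz (h0.trans (map_zero (chartFrame c z)).symm))

theorem contMDiffAt_chartFrame (hz : z ∈ (chartAt (EuclideanSpace ℝ (Fin m)) c).target)
    (v : EuclideanSpace ℝ (Fin m)) :
    ContMDiffAt (𝓡 m) (𝓡 m).tangent ∞
      (fun z ↦ (⟨chartInv c z, chartFrame c z v⟩ : TangentBundle (𝓡 m) M)) z := by
  have h0 := (contMDiffOn_chart_symm (I := 𝓡 m) (n := ∞) (x := c))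
  have ho := (chartAt (EuclideanSpace ℝ (Fin m)) c).open_target
  have h1 := h0.contMDiffOn_tangentMapWithin (m := ∞) (by simp) ho.uniqueMDiffOn
  have h2 : ContMDiff (𝓡 m) (𝓡 m).tangent ∞
      (fun z : EuclideanSpace ℝ (Fin m) ↦
        (⟨z, v⟩ : TangentBundle (𝓡 m) (EuclideanSpace ℝ (Fin m)))) :=
    contMDiff_vectorSpace_iff_contDiff.2 contDiff_const
  have h3 := h1.comp h2.contMDiffOn (s := (chartAt (EuclideanSpace ℝ (Fin m)) c).target)
    (fun z hz ↦ hz)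
  refine ((h3 z hz).contMDiffAt (ho.mem_nhds hz)).congr_of_eventuallyEq ?_
  filter_upwards [ho.mem_nhds hz] with y hy
  simp only [Function.comp, tangentMapWithin]
  rw [mfderivWithin_of_isOpen ho hy]
  rfl

theorem contDiffOn_chartMetric :
    ContDiffOn ℝ ∞ (L.chartMetric c) (chartAt (EuclideanSpace ℝ (Fin m)) c).target := by
  refine contDiffOn_clm_apply.2 fun v ↦ contDiffOn_clm_apply.2 fun w z hz ↦ ?_
  have h0 : ContMDiffAt (𝓡 m) (𝓡 m) ∞ (chartInv c) z :=
    (contMDiffOn_chart_symm (I := 𝓡 m) (n := ∞) (x := c)).contMDiffAt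
      ((chartAt (EuclideanSpace ℝ (Fin m)) c).open_target.mem_nhds hz)
  have hm := (L.metric_smooth (chartInv c z)).comp z h0
  have : ContMDiffAt (𝓡 m) ((𝓡 m).prod 𝓘(ℝ, ℝ)) ∞ (fun y ↦ (⟨chartInv c y,
      L.metric (chartInv c y) (chartFrame c y v) (chartFrame c y w)⟩ :
        TotalSpace ℝ (Bundle.Trivial M ℝ))) z := by
    apply ContMDiffAt.clm_bundle_apply₂ (F₁ := EuclideanSpace ℝ (Fin m))
      (F₂ := EuclideanSpace ℝ (Fin m))
    · exact hm
    · exact contMDiffAt_chartFrame hz v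
    · exact contMDiffAt_chartFrame hz w
  rw [Bundle.contMDiffAt_totalSpace] at this
  exact this.2.contDiffAt.contDiffWithinAt

theorem continuousAt_chartTime (hz : z ∈ (chartAt (EuclideanSpace ℝ (Fin m)) c).target) :
    ContinuousAt (L.chartTime c) z := by
  have h0 : ContMDiffAt (𝓡 m) (𝓡 m) ∞ (chartInv c) z :=
    (contMDiffOn_chart_symm (I := 𝓡 m) (n := ∞) (x := c)).contMDiffAt
      ((chartAt (EuclideanSpace ℝ (Fin m)) c).open_target.mem_nhds hz)
  have ho := (chartAt (EuclideanSpace ℝ (Fin m)) c).open_source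
  have h1 := (contMDiffOn_chart (I := 𝓡 m) (n := ∞) (x := c)).contMDiffOn_tangentMapWithin
    (m := ∞) (by simp) ho.uniqueMDiffOn
  have h2 := (L.timeField_smooth (chartInv c z)).comp z h0
  have hz' : chartInv c z ∈ (chartAt (EuclideanSpace ℝ (Fin m)) c).source :=
    (chartAt (EuclideanSpace ℝ (Fin m)) c).map_target hz
  have h3 := (h1.contMDiffAt (x := ⟨chartInv c z, L.timeField (chartInv c z)⟩)
    ((ho.preimage (FiberBundle.continuous_proj _ _)).mem_nhds hz')).comp z h2
  have h4 : ContMDiffAt (𝓡 m) (𝓡 m).tangent ∞ (fun y : EuclideanSpace ℝ (Fin m) ↦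
      (⟨y, L.chartTime c y⟩ : TangentBundle (𝓡 m) (EuclideanSpace ℝ (Fin m)))) z := by
    refine h3.congr_of_eventuallyEq ?_
    filter_upwards [(chartAt (EuclideanSpace ℝ (Fin m)) c).open_target.mem_nhds hz] with y hy
    simp only [Function.comp, tangentMapWithin]
    rw [mfderivWithin_of_isOpen ho ((chartAt (EuclideanSpace ℝ (Fin m)) c).map_target hy)]
    have hmk : ∀ y y' v : EuclideanSpace ℝ (Fin m), y' = y →
        (⟨y, v⟩ : TangentBundle (𝓡 m) (EuclideanSpace ℝ (Fin m))) = ⟨y', v⟩ := by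
      rintro y _ v rfl
      rfl
    exact hmk _ _ _ ((chartAt (EuclideanSpace ℝ (Fin m)) c).right_inv hy)
  exact (contMDiffAt_vectorSpace_iff_contDiffAt.1 h4).continuousAt

end Chart

end Spacetime

end GreenHyp

end

noncomputable section

namespace GreenHyp

/-! ### Timelike curves, reparametrization and time reversal -/

namespace Spacetime

variable {m : ℕ} {M : Type u} [TopologicalSpace M]
  [ChartedSpace (EuclideanSpace ℝ (Fin m)) M] [IsManifold (𝓡 m) ∞ M]

/-- The velocity of a curve as an element of the model space, so that the velocities of two curves
which agree can be compared without transport along an equality of base points. -/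
def vel (γ : ℝ → M) (a b t : ℝ) : EuclideanSpace ℝ (Fin m) := velocity (m := m) γ a b t

theorem vel_congr {γ γ' : ℝ → M} {a b t : ℝ} (h : EqOn γ γ' (Icc a b)) (ht : t ∈ Icc a b) :
    vel (m := m) γ a b t = vel γ' a b t := by
  have := mfderivWithin_congr (I := 𝓘(ℝ, ℝ)) (I' := 𝓡 m) h (h ht)
  exact congrArg (fun T : ℝ →L[ℝ] EuclideanSpace ℝ (Fin m) ↦ T 1) this

theorem vel_comp_affine {γ : ℝ → M} {a b a' b' s d t : ℝ}
    (hγ : ContMDiffOn 𝓘(ℝ, ℝ) (𝓡 m) 1 γ (Icc a b)) (hab' : a' < b')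
    (hm : MapsTo (fun t ↦ s * t + d) (Icc a' b') (Icc a b)) (ht : t ∈ Icc a' b') :
    vel (m := m) (γ ∘ fun t ↦ s * t + d) a' b' t = s • vel (m := m) γ a b (s * t + d) := by
  have hu : UniqueMDiffWithinAt 𝓘(ℝ, ℝ) (Icc a' b') t :=
    (uniqueDiffOn_Icc hab' t ht).uniqueMDiffWithinAt
  have hα : HasDerivWithinAt (fun t : ℝ ↦ s * t + d) s (Icc a' b') t := by
    simpa using (((hasDerivAt_id t).const_mul s).add_const d).hasDerivWithinAt
  have h1 := mfderivWithin_comp (I := 𝓘(ℝ, ℝ)) (I' := 𝓘(ℝ, ℝ)) (I'' := 𝓡 m) t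
    (f := fun t ↦ s * t + d)
    ((hγ _ (hm ht)).mdifferentiableWithinAt (by simp))
    hα.differentiableWithinAt.mdifferentiableWithinAt hm hu
  have h2 : mfderivWithin 𝓘(ℝ, ℝ) 𝓘(ℝ, ℝ) (fun t : ℝ ↦ s * t + d) (Icc a' b') t (1 : ℝ) = s := by
    rw [mfderivWithin_eq_fderivWithin]
    exact hα.derivWithin (uniqueDiffOn_Icc hab' t ht)
  have h3 := congrArg (fun T : ℝ →L[ℝ] EuclideanSpace ℝ (Fin m) ↦ T 1) h1
  refine h3.trans ?_
  have h4 : ∀ (T : ℝ →L[ℝ] EuclideanSpace ℝ (Fin m)), T s = s • T 1 := fun T ↦ by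
    rw [← map_smul, smul_eq_mul, mul_one]
  refine Eq.trans ?_ (h4 _)
  exact congrArg (mfderivWithin 𝓘(ℝ, ℝ) (𝓡 m) γ (Icc a b) (s * t + d) :
    ℝ →L[ℝ] EuclideanSpace ℝ (Fin m)) h2

variable (L : Spacetime m M)

/-- The spacetime with the opposite time-orientation. -/
def dual : Spacetime m M where
  metric := L.metric
  metric_symm := L.metric_symm
  lorentzian := L.lorentzian
  metric_smooth := L.metric_smooth
  future x := {v | -v ∈ L.future x}
  time_orientation := ⟨fun x ↦ -L.timeField x, L.timeField_smooth.neg_section,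
    fun x ↦ by simpa using L.timeField_timelike x, fun x v ↦ by
      change -v ∈ L.future x ↔ _
      rw [mem_future_iff]
      simp⟩

variable {L}

theorem dual_dual : L.dual.dual = L := by
  cases L
  simp [dual]

theorem mem_dual_future {x : M} {v : TangentSpace (𝓡 m) x} :
    v ∈ L.dual.future x ↔ -v ∈ L.future x := Iff.rfl

theorem smul_mem_future {x : M} {v : TangentSpace (𝓡 m) x} (hv : v ∈ L.future x) {s : ℝ}
    (hs : 0 < s) : s • v ∈ L.future x := by
  rw [mem_future_iff] at hv ⊢
  simp only [map_smul, smul_apply, smul_eq_mul]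
  exact ⟨mul_nonpos_of_nonneg_of_nonpos hs.le (mul_nonpos_of_nonneg_of_nonpos hs.le hv.1),
    mul_neg_of_pos_of_neg hs hv.2⟩

/-- Future-directed causal vectors, with the vector taken in the model space. -/
def IsCausalVec (L : Spacetime m M) (x : M) (v : EuclideanSpace ℝ (Fin m)) : Prop :=
  (show TangentSpace (𝓡 m) x from v) ∈ L.future x

/-- Timelike vectors, with the vector taken in the model space. -/
def IsTimelikeVec (L : Spacetime m M) (x : M) (v : EuclideanSpace ℝ (Fin m)) : Prop :=
  L.metric x (show TangentSpace (𝓡 m) x from v) (show TangentSpace (𝓡 m) x from v) < 0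

theorem isCausalSegment_iff {U : Set M} {γ : ℝ → M} {a b : ℝ} :
    L.IsCausalSegment U γ a b ↔ a < b ∧ ContMDiffOn 𝓘(ℝ, ℝ) (𝓡 m) 1 γ (Icc a b) ∧
      ∀ t ∈ Icc a b, γ t ∈ U ∧ L.IsCausalVec (γ t) (vel γ a b t) := Iff.rfl

theorem isTimelikeSegment_iff {U : Set M} {γ : ℝ → M} {a b : ℝ} :
    L.IsTimelikeSegment U γ a b ↔ L.IsCausalSegment U γ a b ∧
      ∀ t ∈ Icc a b, L.IsTimelikeVec (γ t) (vel γ a b t) := Iff.rfl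

theorem IsCausalSegment.congr {U : Set M} {γ γ' : ℝ → M} {a b : ℝ}
    (h : L.IsCausalSegment U γ a b) (he : EqOn γ γ' (Icc a b)) : L.IsCausalSegment U γ' a b := by
  rw [isCausalSegment_iff] at h ⊢
  refine ⟨h.1, h.2.1.congr fun t ht ↦ (he ht).symm, fun t ht ↦ ?_⟩
  rw [← vel_congr he ht, ← he ht]
  exact h.2.2 t ht

theorem IsTimelikeSegment.congr {U : Set M} {γ γ' : ℝ → M} {a b : ℝ}
    (h : L.IsTimelikeSegment U γ a b) (he : EqOn γ γ' (Icc a b)) :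
    L.IsTimelikeSegment U γ' a b := by
  rw [isTimelikeSegment_iff] at h ⊢
  refine ⟨h.1.congr he, fun t ht ↦ ?_⟩
  rw [← vel_congr he ht, ← he ht]
  exact h.2 t ht

theorem contMDiffOn_comp_affine {γ : ℝ → M} {a b a' b' s d : ℝ}
    (hγ : ContMDiffOn 𝓘(ℝ, ℝ) (𝓡 m) 1 γ (Icc a b))
    (hm : MapsTo (fun t ↦ s * t + d) (Icc a' b') (Icc a b)) :
    ContMDiffOn 𝓘(ℝ, ℝ) (𝓡 m) 1 (γ ∘ fun t ↦ s * t + d) (Icc a' b') := by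
  have : ContDiff ℝ 1 fun t : ℝ ↦ s * t + d := by fun_prop
  exact hγ.comp this.contMDiff.contMDiffOn hm

theorem IsCausalSegment.comp_affine {U : Set M} {γ : ℝ → M} {a b a' b' s d : ℝ}
    (h : L.IsCausalSegment U γ a b) (hab' : a' < b') (hs : 0 < s)
    (hm : MapsTo (fun t ↦ s * t + d) (Icc a' b') (Icc a b)) :
    L.IsCausalSegment U (γ ∘ fun t ↦ s * t + d) a' b' := by
  rw [isCausalSegment_iff]
  refine ⟨hab', contMDiffOn_comp_affine h.2.1 hm, fun t ht ↦ ⟨(h.2.2 _ (hm ht)).1, ?_⟩⟩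
  rw [vel_comp_affine h.2.1 hab' hm ht]
  exact smul_mem_future (h.2.2 _ (hm ht)).2 hs

theorem IsTimelikeVec.smul {x : M} {v : EuclideanSpace ℝ (Fin m)} (h : L.IsTimelikeVec x v) {s : ℝ}
    (hs : s ≠ 0) : L.IsTimelikeVec x (s • v) := by
  have hm : ∀ u : TangentSpace (𝓡 m) x, L.metric x (s • u) (s • u) = s * s * L.metric x u u :=
    fun u ↦ by simp only [map_smul, smul_apply, smul_eq_mul, mul_assoc]
  have : 0 < s * s := mul_self_pos.2 hs
  exact (hm v).trans_lt (mul_neg_of_pos_of_neg this h)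

theorem IsTimelikeSegment.comp_affine {U : Set M} {γ : ℝ → M} {a b a' b' s d : ℝ}
    (h : L.IsTimelikeSegment U γ a b) (hab' : a' < b') (hs : 0 < s)
    (hm : MapsTo (fun t ↦ s * t + d) (Icc a' b') (Icc a b)) :
    L.IsTimelikeSegment U (γ ∘ fun t ↦ s * t + d) a' b' := by
  rw [isTimelikeSegment_iff]
  refine ⟨h.1.comp_affine hab' hs hm, fun t ht ↦ ?_⟩
  rw [vel_comp_affine h.1.2.1 hab' hm ht]
  exact IsTimelikeVec.smul (h.2 _ (hm ht)) hs.ne'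

theorem IsCausalSegment.mono {U : Set M} {γ : ℝ → M} {a b a' b' : ℝ}
    (h : L.IsCausalSegment U γ a b) (hab' : a' < b') (ha : a ≤ a') (hb : b' ≤ b) :
    L.IsCausalSegment U γ a' b' := by
  have := h.comp_affine (s := 1) (d := 0) hab' one_pos
    (fun t ht ↦ ⟨by linarith [ht.1], by linarith [ht.2]⟩)
  exact this.congr fun t _ ↦ by simp

theorem IsTimelikeSegment.mono {U : Set M} {γ : ℝ → M} {a b a' b' : ℝ}
    (h : L.IsTimelikeSegment U γ a b) (hab' : a' < b') (ha : a ≤ a') (hb : b' ≤ b) :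
    L.IsTimelikeSegment U γ a' b' := by
  have := h.comp_affine (s := 1) (d := 0) hab' one_pos
    (fun t ht ↦ ⟨by linarith [ht.1], by linarith [ht.2]⟩)
  exact this.congr fun t _ ↦ by simp

theorem mapsTo_neg_Icc (a b : ℝ) :
    MapsTo (fun t : ℝ ↦ (-1) * t + 0) (Icc (-b) (-a)) (Icc a b) :=
  fun t ht ↦ ⟨by linarith [ht.2], by linarith [ht.1]⟩

theorem IsCausalSegment.dual {U : Set M} {γ : ℝ → M} {a b : ℝ}
    (h : L.IsCausalSegment U γ a b) :
    L.dual.IsCausalSegment U (γ ∘ fun t ↦ -1 * t + 0) (-b) (-a) := by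
  have hab : -b < -a := neg_lt_neg h.1
  rw [isCausalSegment_iff]
  refine ⟨hab, contMDiffOn_comp_affine h.2.1 (mapsTo_neg_Icc a b), fun t ht ↦
    ⟨(h.2.2 _ (mapsTo_neg_Icc a b ht)).1, ?_⟩⟩
  rw [vel_comp_affine h.2.1 hab (mapsTo_neg_Icc a b) ht, neg_one_smul]
  refine mem_dual_future.2 ?_
  have := (h.2.2 _ (mapsTo_neg_Icc a b ht)).2
  rwa [← neg_neg (velocity γ a b _)] at this

theorem IsTimelikeSegment.dual {U : Set M} {γ : ℝ → M} {a b : ℝ}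
    (h : L.IsTimelikeSegment U γ a b) :
    L.dual.IsTimelikeSegment U (γ ∘ fun t ↦ -1 * t + 0) (-b) (-a) := by
  have hab : -b < -a := neg_lt_neg h.1.1
  rw [isTimelikeSegment_iff]
  refine ⟨h.1.dual, fun t ht ↦ ?_⟩
  rw [vel_comp_affine h.1.2.1 hab (mapsTo_neg_Icc a b) ht]
  exact IsTimelikeVec.smul (L := L) (h.2 _ (mapsTo_neg_Icc a b ht)) (by norm_num)

theorem CausalLE.dual {U : Set M} {x y : M} (h : L.CausalLE U x y) : L.dual.CausalLE U y x := by
  induction h with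
  | refl => exact Relation.ReflTransGen.refl
  | tail _ hseg ih =>
    obtain ⟨γ, a, b, hγ, rfl, rfl⟩ := hseg
    exact Relation.ReflTransGen.head ⟨_, _, _, hγ.dual, by simp, by simp⟩ ih

/-- `γ` is timelike on a short interval to the right of `t`. -/
def IsTimelikeRight (L : Spacetime m M) (γ : ℝ → M) (t : ℝ) : Prop :=
  ∃ ε > 0, L.IsTimelikeSegment univ γ t (t + ε)

/-- `γ` is timelike on a short interval to the left of `t`. -/
def IsTimelikeLeft (L : Spacetime m M) (γ : ℝ → M) (t : ℝ) : Prop :=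
  ∃ ε > 0, L.IsTimelikeSegment univ γ (t - ε) t

theorem IsTimelikeRight.congr {γ γ' : ℝ → M} {t δ : ℝ} (h : L.IsTimelikeRight γ t) (hδ : 0 < δ)
    (he : EqOn γ γ' (Icc t (t + δ))) : L.IsTimelikeRight γ' t := by
  obtain ⟨ε, hε, h⟩ := h
  refine ⟨min ε δ, lt_min hε hδ, ?_⟩
  refine (h.mono (by linarith [lt_min hε hδ]) le_rfl (by linarith [min_le_left ε δ])).congr ?_
  exact he.mono (Icc_subset_Icc_right (by linarith [min_le_right ε δ]))

theorem IsTimelikeLeft.congr {γ γ' : ℝ → M} {t δ : ℝ} (h : L.IsTimelikeLeft γ t) (hδ : 0 < δ)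
    (he : EqOn γ γ' (Icc (t - δ) t)) : L.IsTimelikeLeft γ' t := by
  obtain ⟨ε, hε, h⟩ := h
  refine ⟨min ε δ, lt_min hε hδ, ?_⟩
  refine (h.mono (by linarith [lt_min hε hδ]) (by linarith [min_le_left ε δ]) le_rfl).congr ?_
  exact he.mono (Icc_subset_Icc_left (by linarith [min_le_right ε δ]))

theorem IsTimelikeRight.comp_affine {γ : ℝ → M} {t s d : ℝ}
    (h : L.IsTimelikeRight γ (s * t + d)) (hs : 0 < s) :
    L.IsTimelikeRight (γ ∘ fun t ↦ s * t + d) t := by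
  obtain ⟨ε, hε, h⟩ := h
  refine ⟨ε / s, by positivity, h.comp_affine (by linarith [div_pos hε hs]) hs ?_⟩
  refine fun u hu ↦ ⟨by nlinarith [hu.1], ?_⟩
  have := mul_le_mul_of_nonneg_left hu.2 hs.le
  rw [mul_add, mul_div_cancel₀ _ hs.ne'] at this
  linarith

theorem IsTimelikeLeft.comp_affine {γ : ℝ → M} {t s d : ℝ}
    (h : L.IsTimelikeLeft γ (s * t + d)) (hs : 0 < s) :
    L.IsTimelikeLeft (γ ∘ fun t ↦ s * t + d) t := by
  obtain ⟨ε, hε, h⟩ := h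
  refine ⟨ε / s, by positivity, h.comp_affine (by linarith [div_pos hε hs]) hs ?_⟩
  refine fun u hu ↦ ⟨?_, by nlinarith [hu.2]⟩
  have := mul_le_mul_of_nonneg_left hu.1 hs.le
  rw [mul_sub, mul_div_cancel₀ _ hs.ne'] at this
  linarith

theorem IsTimelikeLeft.dual {γ : ℝ → M} {t : ℝ} (h : L.IsTimelikeLeft γ t) :
    L.dual.IsTimelikeRight (γ ∘ fun t ↦ -1 * t + 0) (-t) := by
  obtain ⟨ε, hε, h⟩ := h
  have := h.dual
  rw [neg_sub, sub_eq_neg_add] at this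
  exact ⟨ε, hε, this⟩

theorem IsTimelikeRight.dual {γ : ℝ → M} {t : ℝ} (h : L.IsTimelikeRight γ t) :
    L.dual.IsTimelikeLeft (γ ∘ fun t ↦ -1 * t + 0) (-t) := by
  obtain ⟨ε, hε, h⟩ := h
  have := h.dual
  rw [neg_add'] at this
  exact ⟨ε, hε, this⟩

/-- A future-directed timelike piecewise `C¹` curve on `[a, b]`. -/
structure IsTimelikePath (L : Spacetime m M) (γ : ℝ → M) (a b : ℝ) : Prop where
  lt : a < b
  right : ∀ t ∈ Ico a b, L.IsTimelikeRight γ t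
  left : ∀ t ∈ Ioc a b, L.IsTimelikeLeft γ t

/-- The chronological relation `x ≪ y`: there is a future-directed timelike curve from `x` to
`y`. -/
def ChronLT (L : Spacetime m M) (x y : M) : Prop :=
  ∃ γ a b, L.IsTimelikePath γ a b ∧ γ a = x ∧ γ b = y

theorem IsTimelikePath.congr {γ γ' : ℝ → M} {a b : ℝ} (h : L.IsTimelikePath γ a b)
    (he : EqOn γ γ' (Icc a b)) : L.IsTimelikePath γ' a b where
  lt := h.lt
  right t ht := (h.right t ht).congr (sub_pos.2 ht.2)
    (he.mono (Icc_subset_Icc ht.1 (by linarith)))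
  left t ht := (h.left t ht).congr (sub_pos.2 ht.1)
    (he.mono (Icc_subset_Icc (by linarith) ht.2))

theorem IsTimelikePath.trans {γ : ℝ → M} {a b c : ℝ} (h : L.IsTimelikePath γ a b)
    (h' : L.IsTimelikePath γ b c) : L.IsTimelikePath γ a c where
  lt := h.lt.trans h'.lt
  right t ht := (lt_or_ge t b).elim (fun h1 ↦ h.right t ⟨ht.1, h1⟩) fun h1 ↦ h'.right t ⟨h1, ht.2⟩
  left t ht := (le_or_gt t b).elim (fun h1 ↦ h.left t ⟨ht.1, h1⟩) fun h1 ↦ h'.left t ⟨h1, ht.2⟩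

theorem IsTimelikePath.comp_affine {γ : ℝ → M} {a b a' b' s d : ℝ} (h : L.IsTimelikePath γ a b)
    (hs : 0 < s) (ha : s * a' + d = a) (hb : s * b' + d = b) :
    L.IsTimelikePath (γ ∘ fun t ↦ s * t + d) a' b' where
  lt := by
    have := h.lt
    rw [← ha, ← hb, add_lt_add_iff_right, mul_lt_mul_iff_right₀ hs] at this
    exact this
  right t ht := (h.right _ ⟨by nlinarith [ht.1], by nlinarith [ht.2]⟩).comp_affine hs
  left t ht := (h.left _ ⟨by nlinarith [ht.1], by nlinarith [ht.2]⟩).comp_affine hs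

theorem IsTimelikePath.dual {γ : ℝ → M} {a b : ℝ} (h : L.IsTimelikePath γ a b) :
    L.dual.IsTimelikePath (γ ∘ fun t ↦ -1 * t + 0) (-b) (-a) where
  lt := neg_lt_neg h.lt
  right t ht := by
    have := (h.left (-t) ⟨by linarith [ht.2], by linarith [ht.1]⟩).dual
    rwa [neg_neg] at this
  left t ht := by
    have := (h.right (-t) ⟨by linarith [ht.2], by linarith [ht.1]⟩).dual
    rwa [neg_neg] at this

theorem IsTimelikeSegment.isTimelikePath {γ : ℝ → M} {a b : ℝ}
    (h : L.IsTimelikeSegment univ γ a b) : L.IsTimelikePath γ a b where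
  lt := h.1.1
  right t ht := ⟨b - t, sub_pos.2 ht.2, h.mono (by linarith [ht.2]) ht.1 (by linarith)⟩
  left t ht := ⟨t - a, sub_pos.2 ht.1, h.mono (by linarith [ht.1]) (by linarith) ht.2⟩

/-- A timelike curve can be reparametrized to any given interval. -/
theorem ChronLT.exists_path {x y : M} (h : L.ChronLT x y) {a b : ℝ} (hab : a < b) :
    ∃ γ, L.IsTimelikePath γ a b ∧ γ a = x ∧ γ b = y := by
  obtain ⟨γ, a', b', hγ, rfl, rfl⟩ := h
  have hab' := sub_pos.2 hγ.lt
  have hs : 0 < (b' - a') / (b - a) := div_pos hab' (sub_pos.2 hab)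
  have hne : b - a ≠ 0 := (sub_pos.2 hab).ne'
  have ha : (b' - a') / (b - a) * a + (a' - (b' - a') / (b - a) * a) = a' := by ring
  have hb : (b' - a') / (b - a) * b + (a' - (b' - a') / (b - a) * a) = b' := by
    field_simp; ring
  exact ⟨_, hγ.comp_affine hs ha hb, by simp only [Function.comp, ha],
    by simp only [Function.comp, hb]⟩

theorem ChronLT.trans {x y z : M} (h : L.ChronLT x y) (h' : L.ChronLT y z) : L.ChronLT x z := by
  obtain ⟨γ, hγ, rfl, hy⟩ := h.exists_path (zero_lt_one' ℝ)
  obtain ⟨γ', hγ', hy', rfl⟩ := h'.exists_path (one_lt_two (α := ℝ))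
  refine ⟨fun t ↦ if t ≤ 1 then γ t else γ' t, 0, 2, ?_, by simp, by norm_num⟩
  refine IsTimelikePath.trans (b := 1) (hγ.congr fun t ht ↦ by simp [ht.2])
    (hγ'.congr fun t ht ↦ ?_)
  rcases ht.1.eq_or_lt with rfl | h
  · simp [hy, hy']
  · simp [not_le.2 h]

theorem ChronLT.dual {x y : M} (h : L.ChronLT x y) : L.dual.ChronLT y x := by
  obtain ⟨γ, a, b, hγ, rfl, rfl⟩ := h
  exact ⟨_, _, _, hγ.dual, by simp, by simp⟩

theorem chronLT_dual_iff {x y : M} : L.dual.ChronLT y x ↔ L.ChronLT x y :=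
  ⟨fun h ↦ by simpa [dual_dual] using h.dual, ChronLT.dual⟩

end Spacetime

end GreenHyp

end

noncomputable section

namespace GreenHyp

/-! ### Pushing causal curves to timelike ones inside a chart -/

namespace Spacetime

variable {m : ℕ} {M : Type u} [TopologicalSpace M]
  [ChartedSpace (EuclideanSpace ℝ (Fin m)) M] [IsManifold (𝓡 m) ∞ M] {L : Spacetime m M}

theorem vel_chartInv_comp {c : M} {β : ℝ → EuclideanSpace ℝ (Fin m)} {a b t : ℝ} (hab : a < b)
    (hβ : ContDiffOn ℝ 1 β (Icc a b)) (ht : t ∈ Icc a b)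
    (hz : β t ∈ (chartAt (EuclideanSpace ℝ (Fin m)) c).target) :
    vel (m := m) (chartInv c ∘ β) a b t = chartFrame c (β t) (derivWithin β (Icc a b) t) := by
  have hI : IsManifold (𝓡 m) 1 M := .of_le (n := ∞) (by simp)
  have hu : UniqueMDiffWithinAt 𝓘(ℝ, ℝ) (Icc a b) t :=
    (uniqueDiffOn_Icc hab t ht).uniqueMDiffWithinAt
  have h1 := mfderiv_comp_mfderivWithin (I := 𝓘(ℝ, ℝ)) (I' := 𝓡 m) (I'' := 𝓡 m) t
    (f := β) ((mdifferentiable_chart (I := 𝓡 m) c).mdifferentiableAt_symm hz)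
    ((hβ.differentiableOn (by simp)) t ht).mdifferentiableWithinAt hu
  rw [mfderivWithin_eq_fderivWithin] at h1
  exact congrArg (fun T : ℝ →L[ℝ] EuclideanSpace ℝ (Fin m) ↦ T 1) h1

/-- A curve in coordinates with timelike velocity gives a timelike curve in the manifold. -/
theorem isTimelikeSegment_chartInv_comp {c : M} {β : ℝ → EuclideanSpace ℝ (Fin m)} {a b : ℝ}
    (hab : a < b) (hβ : ContDiffOn ℝ 1 β (Icc a b))
    (hz : ∀ t ∈ Icc a b, β t ∈ (chartAt (EuclideanSpace ℝ (Fin m)) c).target)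
    (hT : ∀ t ∈ Icc a b,
      IsTL (L.chartMetric c) (L.chartTime c) (β t) (derivWithin β (Icc a b) t)) :
    L.IsTimelikeSegment univ (chartInv c ∘ β) a b := by
  rw [isTimelikeSegment_iff, isCausalSegment_iff]
  refine ⟨⟨hab, ?_, fun t ht ↦ ⟨mem_univ _, ?_⟩⟩, fun t ht ↦ ?_⟩
  · exact ((contMDiffOn_chart_symm (I := 𝓡 m) (n := ∞) (x := c)).of_le (by simp)).comp
      hβ.contMDiffOn hz
  · rw [vel_chartInv_comp hab hβ ht (hz t ht)]
    exact (chartFrame_mem_future_iff (hz t ht) _).2 ⟨(hT t ht).1.le, (hT t ht).2⟩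
  · rw [vel_chartInv_comp hab hβ ht (hz t ht)]
    exact (hT t ht).1

/-- The coordinate expression of a causal curve has causal velocity. -/
theorem IsCausalSegment.chart {c : M} {U : Set M} {γ : ℝ → M} {a b : ℝ}
    (h : L.IsCausalSegment U γ a b) (hU : U ⊆ (chartAt (EuclideanSpace ℝ (Fin m)) c).source) :
    ContDiffOn ℝ 1 (chartAt (EuclideanSpace ℝ (Fin m)) c ∘ γ) (Icc a b) ∧ ∀ t ∈ Icc a b,
      let z := chartAt (EuclideanSpace ℝ (Fin m)) c (γ t)
      let v := derivWithin (chartAt (EuclideanSpace ℝ (Fin m)) c ∘ γ) (Icc a b) t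
      L.chartMetric c z v v ≤ 0 ∧ L.chartMetric c z v (L.chartTime c z) < 0 := by
  have hc : ContDiffOn ℝ 1 (chartAt (EuclideanSpace ℝ (Fin m)) c ∘ γ) (Icc a b) := by
    rw [← contMDiffOn_iff_contDiffOn]
    exact ((contMDiffOn_chart (I := 𝓡 m) (n := ∞) (x := c)).of_le (by simp)).comp
      h.2.1 fun t ht ↦ hU (h.2.2 t ht).1
  refine ⟨hc, fun t ht ↦ ?_⟩
  have hs := hU (h.2.2 t ht).1
  have hz : chartAt (EuclideanSpace ℝ (Fin m)) c (γ t) ∈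
    (chartAt (EuclideanSpace ℝ (Fin m)) c).target :=
      (chartAt (EuclideanSpace ℝ (Fin m)) c).map_source hs
  have he : EqOn γ (chartInv c ∘ (chartAt (EuclideanSpace ℝ (Fin m)) c ∘ γ)) (Icc a b) :=
    fun s hs ↦ ((chartAt (EuclideanSpace ℝ (Fin m)) c).left_inv (hU (h.2.2 s hs).1)).symm
  have h2 := (isCausalSegment_iff.1 (h.congr he)).2.2 t ht
  rw [vel_chartInv_comp h.1 hc ht hz] at h2
  exact (chartFrame_mem_future_iff hz _).1 h2.2

theorem IsTimelikeSegment.chart {c : M} {U : Set M} {γ : ℝ → M} {a b : ℝ}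
    (h : L.IsTimelikeSegment U γ a b) (hU : U ⊆ (chartAt (EuclideanSpace ℝ (Fin m)) c).source)
    {t : ℝ} (ht : t ∈ Icc a b) :
    IsTL (L.chartMetric c) (L.chartTime c) (chartAt (EuclideanSpace ℝ (Fin m)) c (γ t))
      (derivWithin (chartAt (EuclideanSpace ℝ (Fin m)) c ∘ γ) (Icc a b) t) := by
  obtain ⟨hc, h1⟩ := h.1.chart hU
  refine ⟨?_, (h1 t ht).2⟩
  have hz : chartAt (EuclideanSpace ℝ (Fin m)) c (γ t) ∈
    (chartAt (EuclideanSpace ℝ (Fin m)) c).target :=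
      (chartAt (EuclideanSpace ℝ (Fin m)) c).map_source (hU (h.1.2.2 t ht).1)
  have he : EqOn γ (chartInv c ∘ (chartAt (EuclideanSpace ℝ (Fin m)) c ∘ γ)) (Icc a b) :=
    fun s hs ↦ ((chartAt (EuclideanSpace ℝ (Fin m)) c).left_inv (hU (h.1.2.2 s hs).1)).symm
  have h2 := (isTimelikeSegment_iff.1 (h.congr he)).2 t ht
  rw [vel_chartInv_comp h.1.1 hc ht hz] at h2
  exact h2

theorem chronLT_of_line {c : M} {z v : EuclideanSpace ℝ (Fin m)} {h : ℝ} (hh : 0 < h)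
    (hz : ∀ t ∈ Icc 0 h, z + t • v ∈ (chartAt (EuclideanSpace ℝ (Fin m)) c).target ∧
      IsTL (L.chartMetric c) (L.chartTime c) (z + t • v) v) :
    L.ChronLT (chartInv c z) (chartInv c (z + h • v)) := by
  have hd : ∀ t, HasDerivAt (fun t : ℝ ↦ z + t • v) v t := fun t ↦ by
    simpa using ((hasDerivAt_id t).smul_const v).const_add z
  have hβ : ContDiff ℝ 1 (fun t : ℝ ↦ z + t • v) := by fun_prop
  refine ⟨chartInv c ∘ fun t ↦ z + t • v, 0, h, ?_, by simp, by simp⟩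
  refine (isTimelikeSegment_chartInv_comp hh hβ.contDiffOn (fun t ht ↦ (hz t ht).1)
    fun t ht ↦ ?_).isTimelikePath
  rw [(hd t).hasDerivWithinAt.derivWithin (uniqueDiffOn_Icc hh t ht)]
  exact (hz t ht).2

/-- A relatively compact open set `U` together with a family of maps `Ψ s`, `0 < s < s₀`, which
move the points of a compact set `K ⊇ U` a little into the past and turn causal curves in `K` into
timelike ones. The displacement tends to zero with `s`. From any point of `U` some timelike curve
leads out of `U`. -/
structure IsPushNhd (L : Spacetime m M) (U K : Set M) (Ψ : ℝ → M → M) (s₀ : ℝ) : Prop where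
  isOpen : IsOpen U
  isCompact : IsCompact K
  subset : U ⊆ K
  pos : 0 < s₀
  push : ∀ s ∈ Ioo 0 s₀, ∀ x y, L.CausalLE K x y → Ψ s x = Ψ s y ∨ L.ChronLT (Ψ s x) (Ψ s y)
  cont : ∀ s ∈ Ioo 0 s₀, ContinuousOn (Ψ s) K
  anti : ∀ s ∈ Ioo 0 s₀, ∀ s' ∈ Ioo s s₀, ∀ x ∈ K, L.ChronLT (Ψ s' x) (Ψ s x)
  lt : ∀ s ∈ Ioo 0 s₀, ∀ x ∈ K, L.ChronLT (Ψ s x) x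
  lim : ∀ x ∈ K, Tendsto (fun s ↦ Ψ s x) (𝓝[>] 0) (𝓝 x)
  exit : ∀ x ∈ U, ∃ y ∉ U, L.ChronLT x y

theorem hasDerivWithinAt_push {E : Type*} [NormedAddCommGroup E] [NormedSpace ℝ E] (τ : E →L[ℝ] ℝ)
    (e : E) (C s : ℝ) {β : ℝ → E} {v : E} {I : Set ℝ} {t : ℝ} (hβ : HasDerivWithinAt β v I t) :
    HasDerivWithinAt (fun t ↦ β t - (s * Real.exp (-C * τ (β t))) • e)
      (v + (C * (s * Real.exp (-C * τ (β t))) * τ v) • e) I t := by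
  have h1 : HasDerivWithinAt (fun t ↦ τ (β t)) (τ v) I t :=
    τ.hasFDerivAt.comp_hasDerivWithinAt t hβ
  have h2 := hβ.sub ((((h1.const_mul (-C)).exp).const_mul s).smul_const e)
  refine h2.congr_deriv ?_
  rw [sub_eq_add_neg, ← neg_smul]
  congr 2
  ring

set_option maxHeartbeats 1000000 in
/-- Every point has a push neighbourhood. In the chart around `c`, let `e` be the timelike vector
`T` at `c` and `τ = -g(e, ·)` a local time function; the push is `z ↦ z - s exp (-C τ(z)) e`. The
derivative of the factor `exp (-C τ)` along a causal curve adds just the multiple of `e` to the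
velocity which by `exists_push_constant` makes it timelike at the displaced point. -/
theorem exists_isPushNhd [T2Space M] (L : Spacetime m M) (c : M) :
    ∃ U K Ψ s₀, L.IsPushNhd U K Ψ s₀ ∧ c ∈ U := by
  set φ := chartAt (EuclideanSpace ℝ (Fin m)) c with hφ
  set z₀ := φ c with hz₀
  have hz₀t : z₀ ∈ φ.target := φ.map_source (mem_chart_source _ c)
  set g := L.chartMetric c with hg
  set T := L.chartTime c with hT
  set e := T z₀ with he
  have hgs : ContDiffAt ℝ ∞ g z₀ :=
    contDiffOn_chartMetric.contDiffAt (φ.open_target.mem_nhds hz₀t)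
  have hTc : ContinuousAt T z₀ := continuousAt_chartTime hz₀t
  have hTT : g z₀ e e < 0 := chartMetric_chartTime_neg hz₀t
  have he0 : 0 < ‖e‖ := by
    rw [norm_pos_iff]
    intro h
    rw [h] at hTT
    simp at hTT
  obtain ⟨C, r₁, hr₁, hC⟩ := exists_push_constant (hgs.of_le (by simp)) hTc
    (fun z v w ↦ L.chartMetric_symm c z v w) hTT
    (fun w h hw ↦ chartMetric_pos_of_orthogonal hz₀t h hw)
  have hTLe : ∀ᶠ z in 𝓝 z₀, IsTL g T z e :=
    (continuousAt_id.prodMk continuousAt_const : ContinuousAt (fun z ↦ (z, e)) z₀).eventually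
      (eventually_isTL hgs.continuousAt hTc ⟨hTT, hTT⟩)
  obtain ⟨r₂, hr₂, hball⟩ := Metric.eventually_nhds_iff_ball.1
    (hTLe.and (φ.open_target.mem_nhds hz₀t))
  set r := min r₁ r₂ / 2 with hr
  have hr0 : 0 < r := half_pos (lt_min hr₁ hr₂)
  have hrr₁ : r + r ≤ r₁ := by rw [hr, add_halves]; exact min_le_left _ _
  have hrr₂ : r + r ≤ r₂ := by rw [hr, add_halves]; exact min_le_right _ _
  have hbt : Metric.ball z₀ (r + r) ⊆ φ.target := fun z hz ↦
    (hball z (Metric.ball_subset_ball hrr₂ hz)).2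
  have hcb : Metric.closedBall z₀ r ⊆ Metric.ball z₀ (r + r) :=
    Metric.closedBall_subset_ball (by linarith)
  -- straight lines in the direction of `e` are timelike
  have hline : ∀ z ∈ Metric.ball z₀ (r + r), ∀ h : ℝ, 0 < h → z + h • e ∈ Metric.ball z₀ (r + r) →
      L.ChronLT (chartInv c z) (chartInv c (z + h • e)) := by
    intro z hz h hh hz'
    refine chronLT_of_line hh fun t ht ↦ ?_
    have hm : z + t • e ∈ Metric.ball z₀ (r + r) := by
      refine (convex_ball z₀ (r + r)).segment_subset hz hz' ?_
      rw [segment_eq_image']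
      refine ⟨t / h, ⟨by have := ht.1; positivity, (div_le_one hh).2 ht.2⟩, ?_⟩
      simp only [add_sub_cancel_left, smul_smul]
      rw [div_mul_cancel₀ _ hh.ne']
    exact ⟨hbt hm, (hball _ (Metric.ball_subset_ball hrr₂ hm)).1⟩
  set τ : EuclideanSpace ℝ (Fin m) →L[ℝ] ℝ := - g z₀ e with hτ
  obtain ⟨B, hB⟩ := (isCompact_closedBall z₀ r).exists_bound_of_continuousOn
    (f := fun z ↦ Real.exp (-C * τ z) * ‖e‖) (by fun_prop)
  set s₀ := r / max B 1 with hs₀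
  have hB1 : 0 < max B 1 := lt_of_lt_of_le one_pos (le_max_right _ _)
  have hs₀pos : 0 < s₀ := div_pos hr0 hB1
  -- the push in coordinates, and its displacement
  set ψ : ℝ → EuclideanSpace ℝ (Fin m) → EuclideanSpace ℝ (Fin m) :=
    fun s z ↦ z - (s * Real.exp (-C * τ z)) • e with hψ
  have hψb : ∀ s ∈ Ioo 0 s₀, ∀ z ∈ Metric.closedBall z₀ r, ψ s z ∈ Metric.ball z₀ (r + r) := by
    intro s hs z hz
    have h1 : ‖(s * Real.exp (-C * τ z)) • e‖ < r := by
      rw [norm_smul, Real.norm_of_nonneg (by have := hs.1; positivity), mul_assoc]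
      have h2 : Real.exp (-C * τ z) * ‖e‖ ≤ max B 1 :=
        (le_abs_self _).trans ((hB z hz).trans (le_max_left _ _))
      calc s * (Real.exp (-C * τ z) * ‖e‖) ≤ s * max B 1 := by have := hs.1; gcongr
        _ < s₀ * max B 1 := by have := hs.2; gcongr
        _ = r := by rw [hs₀, div_mul_cancel₀ _ hB1.ne']
    rw [Metric.mem_closedBall, dist_eq_norm] at hz
    rw [Metric.mem_ball, dist_eq_norm, hψ]
    calc ‖z - (s * Real.exp (-C * τ z)) • e - z₀‖
        = ‖(z - z₀) - (s * Real.exp (-C * τ z)) • e‖ := by congr 1; abel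
      _ ≤ ‖z - z₀‖ + ‖(s * Real.exp (-C * τ z)) • e‖ := norm_sub_le _ _
      _ < r + r := by linarith
  have hKφ : ∀ x ∈ chartInv c '' Metric.closedBall z₀ r,
      φ x ∈ Metric.closedBall z₀ r ∧ x ∈ φ.source := by
    rintro _ ⟨z, hz, rfl⟩
    have := φ.right_inv (hbt (hcb hz))
    exact ⟨by rwa [this], φ.map_target (hbt (hcb hz))⟩
  refine ⟨chartInv c '' Metric.ball z₀ r, chartInv c '' Metric.closedBall z₀ r,
    fun s x ↦ chartInv c (ψ s (φ x)), s₀, ⟨?_, ?_, ?_, hs₀pos, ?_, ?_, ?_, ?_, ?_, ?_⟩, ?_⟩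
  · exact φ.symm.isOpen_image_of_subset_source Metric.isOpen_ball
      (Metric.ball_subset_closedBall.trans (hcb.trans hbt))
  · exact (isCompact_closedBall z₀ r).image_of_continuousOn
      (φ.symm.continuousOn.mono (hcb.trans hbt))
  · exact image_mono Metric.ball_subset_closedBall
  · intro s hs x y hxy
    induction hxy with
    | refl => exact .inl rfl
    | tail _ hseg ih =>
      obtain ⟨γ, a, b, hγ, rfl, rfl⟩ := hseg
      obtain ⟨hc1, hc2⟩ := hγ.chart (c := c) fun x hx ↦ (hKφ x hx).2
      have hd : ∀ t ∈ Icc a b, HasDerivWithinAt (fun t ↦ ψ s (φ (γ t))) _ (Icc a b) t :=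
        fun t ht ↦ hasDerivWithinAt_push τ e C s
          ((hc1.differentiableOn (by simp)) t ht).hasDerivWithinAt
      have hstep : L.ChronLT (chartInv c (ψ s (φ (γ a)))) (chartInv c (ψ s (φ (γ b)))) := by
        refine ⟨chartInv c ∘ fun t ↦ ψ s (φ (γ t)), a, b, ?_, rfl, rfl⟩
        have hψs : ContDiff ℝ 1 (ψ s) := by fun_prop
        refine (isTimelikeSegment_chartInv_comp hγ.1 (hψs.comp_contDiffOn hc1) (fun t ht ↦ ?_)
          fun t ht ↦ ?_).isTimelikePath
        · exact hbt (hψb s hs _ (hKφ _ (hγ.2.2 t ht).1).1)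
        · have hdt := (hd t ht).derivWithin (uniqueDiffOn_Icc hγ.1 t ht)
          change derivWithin (ψ s ∘ φ ∘ γ) (Icc a b) t = _ at hdt
          rw [hdt]
          have hmem := hKφ _ (hγ.2.2 t ht).1
          exact hC _ (Metric.ball_subset_ball hrr₁ (hcb hmem.1)) _ (hc2 t ht).1 (hc2 t ht).2 _
            (mul_pos hs.1 (Real.exp_pos _))
            (Metric.ball_subset_ball hrr₁ (hψb s hs _ hmem.1))
      rcases ih with h | h
      · exact .inr (h ▸ hstep)
      · exact .inr (h.trans hstep)
  · intro s hs
    have hψs : Continuous (ψ s) := by fun_prop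
    have h1 : ContinuousOn φ (chartInv c '' Metric.closedBall z₀ r) :=
      φ.continuousOn.mono fun x hx ↦ (hKφ x hx).2
    exact φ.symm.continuousOn.comp (hψs.comp_continuousOn h1)
      fun x hx ↦ hbt (hψb s hs _ (hKφ x hx).1)
  · intro s hs s' hs' x hx
    have hx' := (hKφ x hx).1
    have h1 := hψb s hs _ hx'
    have h2 := hψb s' ⟨hs.1.trans hs'.1, hs'.2⟩ _ hx'
    have h3 : ψ s (φ x) = ψ s' (φ x) + ((s' - s) * Real.exp (-C * τ (φ x))) • e := by
      simp only [hψ, sub_mul, sub_smul]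
      abel
    rw [h3] at h1 ⊢
    exact hline _ h2 _ (mul_pos (sub_pos.2 hs'.1) (Real.exp_pos _)) h1
  · intro s hs x hx
    have hx' := (hKφ x hx).1
    have h1 := hψb s hs _ hx'
    have h3 : φ x = ψ s (φ x) + (s * Real.exp (-C * τ (φ x))) • e := by
      simp only [hψ, sub_add_cancel]
    have h4 := hline _ h1 _ (mul_pos hs.1 (Real.exp_pos _)) (h3 ▸ hcb hx')
    rw [← h3] at h4
    rwa [show chartInv c (φ x) = x from φ.left_inv (hKφ x hx).2] at h4
  · intro x hx
    have h1 : Tendsto (fun s ↦ ψ s (φ x)) (𝓝 0) (𝓝 (φ x)) := by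
      have : Continuous fun s ↦ ψ s (φ x) := by fun_prop
      simpa [hψ] using this.tendsto 0
    have h2 : ContinuousAt φ.symm (φ x) :=
      φ.symm.continuousAt (hbt (hcb (hKφ x hx).1))
    have h3 := h2.tendsto.comp (h1.mono_left (nhdsWithin_le_nhds (s := Ioi 0)))
    rwa [φ.left_inv (hKφ x hx).2] at h3
  · rintro _ ⟨z, hz, rfl⟩
    obtain ⟨h, hh, heq⟩ : ∃ h ∈ Icc 0 (2 * r / ‖e‖), ‖z + h • e - z₀‖ = r := by
      have hc : ContinuousOn (fun h : ℝ ↦ ‖z + h • e - z₀‖) (Icc 0 (2 * r / ‖e‖)) := by fun_prop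
      refine intermediate_value_Icc (by positivity) hc ⟨?_, ?_⟩
      · simpa [dist_eq_norm] using (Metric.mem_ball.1 hz).le
      · have h1 : ‖(2 * r / ‖e‖) • e‖ = 2 * r := by
          rw [norm_smul, Real.norm_of_nonneg (by positivity), div_mul_cancel₀ _ he0.ne']
        have h2 : ‖(2 * r / ‖e‖) • e‖ ≤ ‖z + (2 * r / ‖e‖) • e - z₀‖ + ‖z - z₀‖ := by
          calc ‖(2 * r / ‖e‖) • e‖ = ‖(z + (2 * r / ‖e‖) • e - z₀) - (z - z₀)‖ := by
                congr 1; abel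
            _ ≤ _ := norm_sub_le _ _
        have h3 := Metric.mem_ball.1 hz
        rw [dist_eq_norm] at h3
        linarith
    have hmem : z + h • e ∈ Metric.closedBall z₀ r := by
      rw [Metric.mem_closedBall, dist_eq_norm, heq]
    have hh0 : 0 < h := by
      refine hh.1.lt_of_ne fun h0 ↦ ?_
      rw [← h0, zero_smul, add_zero, ← dist_eq_norm] at heq
      exact absurd heq (Metric.mem_ball.1 hz).ne
    refine ⟨chartInv c (z + h • e), ?_,
      hline z (hcb (Metric.ball_subset_closedBall hz)) h hh0 (hcb hmem)⟩
    rintro ⟨z', hz', heq'⟩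
    have := φ.symm.injOn (hbt (hcb (Metric.ball_subset_closedBall hz'))) (hbt (hcb hmem)) heq'
    rw [this, Metric.mem_ball, dist_eq_norm, heq] at hz'
    exact lt_irrefl _ hz'
  · exact ⟨z₀, Metric.mem_ball_self hr0, φ.left_inv (mem_chart_source _ c)⟩

theorem IsTimelikeSegment.of_subset {U V : Set M} {γ : ℝ → M} {a b : ℝ}
    (h : L.IsTimelikeSegment U γ a b) (hV : ∀ t ∈ Icc a b, γ t ∈ V) :
    L.IsTimelikeSegment V γ a b :=
  ⟨⟨h.1.1, h.1.2.1, fun t ht ↦ ⟨hV t ht, (h.1.2.2 t ht).2⟩⟩, h.2⟩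

theorem IsTimelikePath.mono {γ : ℝ → M} {a b a' b' : ℝ} (h : L.IsTimelikePath γ a b)
    (hab' : a' < b') (ha : a ≤ a') (hb : b' ≤ b) : L.IsTimelikePath γ a' b' where
  lt := hab'
  right t ht := h.right t ⟨ha.trans ht.1, ht.2.trans_le hb⟩
  left t ht := h.left t ⟨ha.trans_lt ht.1, ht.2.trans hb⟩

/-- Chronological futures are open: near the end point of a timelike curve one can replace the last
bit of the curve by a straight line in a chart. -/
theorem isOpen_chronFuture (p : M) : IsOpen {q | L.ChronLT p q} := by
  rw [isOpen_iff_mem_nhds]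
  rintro q ⟨γ, a, b, hγ, rfl, rfl⟩
  obtain ⟨ε, hε, hseg⟩ := hγ.left b ⟨hγ.lt, le_rfl⟩
  set φ := chartAt (EuclideanSpace ℝ (Fin m)) (γ b) with hφ
  have hsrc : φ.source ∈ 𝓝 (γ b) := φ.open_source.mem_nhds (mem_chart_source _ _)
  -- shorten the last piece of the curve so that it lies in the chart
  obtain ⟨δ, hδ, hδε, hδs⟩ : ∃ δ > 0, δ ≤ ε ∧ ∀ t ∈ Icc (b - δ) b, γ t ∈ φ.source := by
    have hc := (hseg.1.2.1.continuousOn b (right_mem_Icc.2 (by linarith))).eventually hsrc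
    obtain ⟨δ, hδ, h⟩ := Metric.mem_nhdsWithin_iff.1 hc
    refine ⟨min (δ / 2) ε, lt_min (by positivity) hε, min_le_right _ _, fun t ht ↦ h ⟨?_, ?_⟩⟩
    · rw [Metric.mem_ball, Real.dist_eq, abs_lt]
      exact ⟨by linarith [ht.1, min_le_left (δ / 2) ε], by linarith [ht.2]⟩
    · exact ⟨by linarith [ht.1, min_le_right (δ / 2) ε], ht.2⟩
  have hbδ : b - δ < b := by linarith
  have hseg' := (hseg.mono hbδ (by linarith) le_rfl).of_subset hδs
  obtain ⟨hc1, -⟩ := hseg'.1.chart (c := γ b) subset_rfl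
  have hTL := hseg'.chart (c := γ b) subset_rfl (right_mem_Icc.2 hbδ.le)
  set β := φ ∘ γ with hβ
  set v := derivWithin β (Icc (b - δ) b) b with hv
  have hzt : φ (γ b) ∈ φ.target := φ.map_source (mem_chart_source _ _)
  have hd : HasDerivWithinAt β v (Ioo (b - δ) b) b :=
    (((hc1.differentiableOn (by simp)) b (right_mem_Icc.2 hbδ.le)).hasDerivWithinAt).mono
      Ioo_subset_Icc_self
  rw [hasDerivWithinAt_iff_tendsto_slope' (by simp), nhdsWithin_Ioo_eq_nhdsLT hbδ] at hd
  have hbc : Tendsto β (𝓝[<] b) (𝓝 (φ (γ b))) := by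
    have := (hc1.continuousOn b (right_mem_Icc.2 hbδ.le)).mono Ioo_subset_Icc_self
    rwa [ContinuousWithinAt, nhdsWithin_Ioo_eq_nhdsLT hbδ] at this
  have hTLe := eventually_isTL (contDiffOn_chartMetric.contDiffAt
    (φ.open_target.mem_nhds hzt)).continuousAt (continuousAt_chartTime hzt) hTL
  obtain ⟨r, hr, hball⟩ := Metric.eventually_nhds_iff_ball.1
    (hTLe.and (continuousAt_fst.eventually (φ.open_target.mem_nhds hzt)))
  have hball' : ∀ z ∈ Metric.ball (φ (γ b)) r, ∀ u ∈ Metric.ball v r,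
      IsTL (L.chartMetric (γ b)) (L.chartTime (γ b)) z u ∧ z ∈ φ.target := fun z hz u hu ↦
    hball (z, u) (by rw [← ball_prod_same]; exact ⟨hz, hu⟩)
  obtain ⟨t, ⟨ht1, ht2⟩, htv, htz⟩ : ∃ t, t ∈ Ioo (max a (b - δ)) b ∧
      slope β b t ∈ Metric.ball v (r / 2) ∧ β t ∈ Metric.ball (φ (γ b)) r :=
    ((eventually_mem_set.2 (Ioo_mem_nhdsLT (max_lt hγ.lt hbδ))).and
      ((hd.eventually (Metric.ball_mem_nhds _ (half_pos hr))).and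
        (hbc.eventually (Metric.ball_mem_nhds _ hr)))).exists
  have hta : a < t := (le_max_left _ _).trans_lt ht1
  have htδ : b - δ < t := (le_max_right _ _).trans_lt ht1
  have hbt : 0 < b - t := sub_pos.2 ht2
  have hpt : L.ChronLT (γ a) (γ t) := ⟨γ, a, t, hγ.mono hta le_rfl ht2.le, rfl, rfl⟩
  have hinv : chartInv (γ b) (β t) = γ t := φ.left_inv (hδs t ⟨htδ.le, ht2.le⟩)
  -- every point close to the end point can be reached from `γ t` along a straight line
  have hW : ∀ w ∈ Metric.ball (φ (γ b)) r ∩ Metric.ball (φ (γ b)) (r / 2 * (b - t)),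
      L.ChronLT (γ a) (chartInv (γ b) w) := by
    rintro w ⟨hw1, hw2⟩
    set u := (b - t)⁻¹ • (w - β t) with hu
    have hwu : β t + (b - t) • u = w := by
      rw [hu, smul_smul, mul_inv_cancel₀ hbt.ne', one_smul, add_sub_cancel]
    have hub : u ∈ Metric.ball v r := by
      have h1 : u - v = (b - t)⁻¹ • (w - φ (γ b)) + (slope β b t - v) := by
        have : slope β b t = (b - t)⁻¹ • (φ (γ b) - β t) := by
          rw [slope_def_module, ← neg_sub b t, ← neg_sub (β b) (β t), inv_neg, neg_smul_neg]
          rfl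
        rw [this, hu, smul_sub, smul_sub, smul_sub]
        abel
      rw [Metric.mem_ball, dist_eq_norm] at htv hw2 ⊢
      rw [h1]
      have h2 : ‖(b - t)⁻¹ • (w - φ (γ b))‖ < r / 2 := by
        rw [norm_smul, norm_inv, Real.norm_of_nonneg hbt.le, ← div_eq_inv_mul, div_lt_iff₀ hbt]
        exact hw2
      linarith [norm_add_le ((b - t)⁻¹ • (w - φ (γ b))) (slope β b t - v)]
    have hline := chronLT_of_line (L := L) (c := γ b) (z := β t) (v := u) hbt fun s hs ↦ by
      have hm : β t + s • u ∈ Metric.ball (φ (γ b)) r := by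
        refine (convex_ball _ r).segment_subset htz (hwu ▸ hw1) ?_
        rw [segment_eq_image']
        refine ⟨s / (b - t), ⟨by have := hs.1; positivity, (div_le_one hbt).2 hs.2⟩, ?_⟩
        simp only [add_sub_cancel_left, smul_smul]
        rw [div_mul_cancel₀ _ hbt.ne']
      exact ⟨(hball' _ hm _ hub).2, (hball' _ hm _ hub).1⟩
    rw [hwu, hinv] at hline
    exact hpt.trans hline
  have hnear : ∀ᶠ x in 𝓝 (γ b),
      φ x ∈ Metric.ball (φ (γ b)) r ∩ Metric.ball (φ (γ b)) (r / 2 * (b - t)) :=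
    (φ.continuousAt (mem_chart_source _ _)).eventually
      (inter_mem (Metric.ball_mem_nhds _ hr) (Metric.ball_mem_nhds _ (by positivity)))
  filter_upwards [hnear, hsrc] with x hx hxs
  have := hW _ hx
  rwa [show chartInv (γ b) (φ x) = x from φ.left_inv hxs] at this

theorem isOpen_chronPast (q : M) : IsOpen {p | L.ChronLT p q} := by
  have := isOpen_chronFuture (L := L.dual) q
  simpa only [chronLT_dual_iff] using this

end Spacetime

end GreenHyp

end

noncomputable section

namespace GreenHyp

/-! ### Compactness of causal diamonds -/

/-- In a regular second countable space every open cover `U` by neighbourhoods contains a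
subfamily such that a sequence which leaves at each step the set assigned to its current point
cannot converge. -/
theorem exists_escape {X : Type*} [TopologicalSpace X] [RegularSpace X]
    [SecondCountableTopology X] (U : X → Set X) (hUo : ∀ c, IsOpen (U c)) (hc : ∀ c, c ∈ U c) :
    ∃ s : X → X, (∀ q, q ∈ U (s q)) ∧
      ∀ q : ℕ → X, (∀ k, q (k + 1) ∉ U (s (q k))) → ∀ p, ¬ Tendsto q atTop (𝓝 p) := by
  rcases isEmpty_or_nonempty X with hX | hX
  · exact ⟨id, fun q ↦ hX.elim q, fun _ _ p ↦ hX.elim p⟩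
  choose V hVn hVc hVU using fun c ↦ exists_mem_nhds_isClosed_subset
    ((hUo c).mem_nhds (hc c))
  obtain ⟨t, ht, hcov⟩ := TopologicalSpace.countable_cover_nhds
    (fun c ↦ interior_mem_nhds.2 (hVn c))
  have hne : t.Nonempty := by
    by_contra h
    rw [not_nonempty_iff_eq_empty] at h
    subst h
    simp at hcov
    exact (univ_nonempty (α := X)).ne_empty hcov.symm
  obtain ⟨c, rfl⟩ := ht.exists_eq_range hne
  have hex : ∀ q, ∃ i, q ∈ interior (V (c i)) := fun q ↦ by
    have : q ∈ ⋃ x ∈ range c, interior (V x) := hcov ▸ mem_univ q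
    simpa using this
  classical
  refine ⟨fun q ↦ c (Nat.find (hex q)),
    fun q ↦ hVU _ (interior_subset (Nat.find_spec (hex q))), fun q hq p hp ↦ ?_⟩
  obtain ⟨j, hj⟩ := hex p
  have hle : ∀ᶠ k in atTop, Nat.find (hex (q k)) ≤ j := by
    filter_upwards [hp.eventually (isOpen_interior.mem_nhds hj)] with k hk
    exact Nat.find_min' _ hk
  -- some index is used infinitely often
  obtain ⟨i, hi⟩ : ∃ i, ∃ᶠ k in atTop, Nat.find (hex (q k)) = i := by
    by_contra hno
    push Not at hno
    have h1 : ∀ᶠ k in atTop, ∀ i ∈ Finset.range (j + 1), ¬ Nat.find (hex (q k)) = i :=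
      (Finset.eventually_all _).2 fun i _ ↦ by simpa using hno i
    obtain ⟨k, hk, hk'⟩ := (h1.and hle).exists
    exact hk _ (Finset.mem_range.2 (Nat.lt_succ_of_le hk')) rfl
  have hpV : p ∈ V (c i) := by
    refine (hVc (c i)).mem_of_frequently_of_tendsto (hi.mono fun k hk ↦ ?_) hp
    exact hk ▸ interior_subset (Nat.find_spec (hex (q k)))
  have hpU : U (c i) ∈ 𝓝 p := (hUo _).mem_nhds (hVU _ hpV)
  obtain ⟨k, hk, hk'⟩ := (hi.and_eventually ((hp.comp (tendsto_add_atTop_nat 1)).eventually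
    hpU)).exists
  refine hq k ?_
  change q (k + 1) ∈ U (c (Nat.find (hex (q k))))
  rw [hk]
  exact hk'

namespace Spacetime

variable {m : ℕ} {M : Type u} [TopologicalSpace M]
  [ChartedSpace (EuclideanSpace ℝ (Fin m)) M] [IsManifold (𝓡 m) ∞ M] {L : Spacetime m M}

theorem IsCausalSegment.of_subset {U V : Set M} {γ : ℝ → M} {a b : ℝ}
    (h : L.IsCausalSegment U γ a b) (hV : ∀ t ∈ Icc a b, γ t ∈ V) :
    L.IsCausalSegment V γ a b :=
  ⟨h.1, h.2.1, fun t ht ↦ ⟨hV t ht, (h.2.2 t ht).2⟩⟩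

theorem IsCausalSegment.causalLE {U : Set M} {γ : ℝ → M} {a b : ℝ}
    (h : L.IsCausalSegment U γ a b) : L.CausalLE U (γ a) (γ b) :=
  Relation.ReflTransGen.single ⟨γ, a, b, h, rfl, rfl⟩

namespace IsPushNhd

variable {U K : Set M} {Ψ : ℝ → M → M} {s₀ : ℝ}

theorem Ioo_mem (h : L.IsPushNhd U K Ψ s₀) : Ioo 0 s₀ ∈ 𝓝[>] (0 : ℝ) := Ioo_mem_nhdsGT h.pos

theorem eventually_chronLT (h : L.IsPushNhd U K Ψ s₀) {p q : M} (hq : q ∈ K)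
    (hpq : L.ChronLT p q) : ∀ᶠ s in 𝓝[>] (0 : ℝ), L.ChronLT p (Ψ s q) :=
  (h.lim q hq).eventually ((isOpen_chronFuture p).mem_nhds hpq)

/-- Push-up inside a push neighbourhood: `p ≪ Ψ s y ≪ Ψ s z ≪ z` for small `s`. -/
theorem chronLT_of_causalLE (h : L.IsPushNhd U K Ψ s₀) {p y z : M} (hy : y ∈ K)
    (hpy : L.ChronLT p y) (hyz : L.CausalLE K y z) : L.ChronLT p z := by
  obtain ⟨s, h1, hs⟩ := ((h.eventually_chronLT hy hpy).and
    (eventually_mem_set.2 h.Ioo_mem)).exists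
  have h3 := h.lt s hs z (hyz.mem_iff.1 hy)
  rcases h.push s hs y z hyz with h2 | h2
  · exact (h2 ▸ h1).trans h3
  · exact (h1.trans h2).trans h3

end IsPushNhd

/-- Push-up along one causal segment, by a subdivision subordinate to push neighbourhoods. -/
theorem ChronLT.trans_segment [T2Space M] {p : M} {γ : ℝ → M} {a b : ℝ}
    (hγ : L.IsCausalSegment univ γ a b) (h : L.ChronLT p (γ a)) : L.ChronLT p (γ b) := by
  choose U K Ψ s₀ hU hc using fun c ↦ L.exists_isPushNhd c
  have hcont : Continuous fun t : Icc a b ↦ γ t :=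
    continuousOn_iff_continuous_domRestrict.1 hγ.2.1.continuousOn
  obtain ⟨t, ht0, htm, ⟨n, hn⟩, ht⟩ := exists_monotone_Icc_subset_open_cover_Icc hγ.1.le
    (c := fun c : M ↦ (fun t : Icc a b ↦ γ t) ⁻¹' U c) (fun c ↦ (hU c).isOpen.preimage hcont)
    (fun t _ ↦ mem_iUnion.2 ⟨γ t, hc _⟩)
  have hind : ∀ k, L.ChronLT p (γ (t k)) := by
    intro k
    induction k with
    | zero => rwa [ht0]
    | succ k ih =>
      obtain ⟨c, hcs⟩ := ht k
      rcases (htm k.le_succ).eq_or_lt with he | hlt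
      · rwa [← he]
      · have hmem : ∀ s ∈ Icc (t k : ℝ) (t (k + 1)), γ s ∈ K c := fun s hs ↦
          (hU c).subset (@hcs ⟨s, (t k).2.1.trans hs.1, hs.2.trans (t (k + 1)).2.2⟩ hs)
        exact (hU c).chronLT_of_causalLE (hmem _ (left_mem_Icc.2 hlt.le)) ih
          ((hγ.mono hlt (t k).2.1 (t (k + 1)).2.2).of_subset hmem).causalLE
  have := hind n
  rwa [hn n le_rfl] at this

/-- Push-up: a timelike curve followed by a causal one can be replaced by a timelike curve. -/
theorem ChronLT.trans_causalLE [T2Space M] {p y z : M} (h : L.ChronLT p y)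
    (hyz : L.CausalLE univ y z) : L.ChronLT p z := by
  induction hyz with
  | refl => exact h
  | tail _ hseg ih =>
    obtain ⟨γ, a, b, hγ, rfl, rfl⟩ := hseg
    exact ih.trans_segment hγ

/-- A causal curve which leaves an open set `U` has a first point outside `U`. -/
theorem CausalLE.exists_exit {U : Set M} (hU : IsOpen U) {w y : M}
    (h : L.CausalLE univ w y) (hw : w ∈ U) (hy : y ∉ U) :
    ∃ e ∈ closure U, e ∉ U ∧ L.CausalLE (closure U) w e ∧ L.CausalLE univ e y := by
  induction h using Relation.ReflTransGen.head_induction_on with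
  | refl => exact absurd hw hy
  | head hseg hrest ih =>
    obtain ⟨γ, a, b, hγ, rfl, rfl⟩ := hseg
    by_cases hin : ∀ t ∈ Icc a b, γ t ∈ U
    · obtain ⟨e, he, heU, h1, h2⟩ := ih (hin b (right_mem_Icc.2 hγ.1.le))
      exact ⟨e, he, heU, Relation.ReflTransGen.head ⟨γ, a, b,
        hγ.of_subset fun t ht ↦ subset_closure (hin t ht), rfl, rfl⟩ h1, h2⟩
    · push Not at hin
      have hcl : IsClosed (Icc a b ∩ γ ⁻¹' Uᶜ) :=
        hγ.2.1.continuousOn.preimage_isClosed_of_isClosed isClosed_Icc hU.isClosed_compl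
      have hcomp : IsCompact (Icc a b ∩ γ ⁻¹' Uᶜ) :=
        isCompact_Icc.of_isClosed_subset hcl inter_subset_left
      obtain ⟨T, ⟨hT, hTU⟩, hmin⟩ := hcomp.exists_isLeast
        (let ⟨t, ht, htU⟩ := hin; ⟨t, ht, htU⟩)
      have hlt : ∀ t ∈ Ico a T, γ t ∈ U := fun t ht ↦ by
        by_contra hn
        exact absurd (hmin ⟨⟨ht.1, ht.2.le.trans hT.2⟩, hn⟩) (not_le.2 ht.2)
      have haT : a < T := hT.1.lt_of_ne fun h0 ↦ hTU (h0 ▸ hw)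
      have hclT : γ T ∈ closure U := by
        have h1 : ContinuousWithinAt γ (Ico a T) T :=
          (hγ.2.1.continuousOn T hT).mono (Ico_subset_Icc_self.trans (Icc_subset_Icc_right hT.2))
        refine closure_mono (image_subset_iff.2 hlt) (h1.mem_closure_image ?_)
        rw [closure_Ico haT.ne]
        exact right_mem_Icc.2 haT.le
      refine ⟨γ T, hclT, hTU, ?_, ?_⟩
      · refine ((hγ.mono haT le_rfl hT.2).of_subset fun t ht ↦ ?_).causalLE
        rcases ht.2.eq_or_lt with rfl | h
        · exact hclT
        · exact subset_closure (hlt t ⟨ht.1, h⟩)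
      · rcases hT.2.eq_or_lt with he | h
        · rw [he]
          exact hrest
        · exact (hγ.mono h hT.1 le_rfl).causalLE.trans hrest

/-- Infinitely many timelike curves can be concatenated to one curve defined on all of `ℝ`. -/
theorem exists_concatenation (p : ℤ → M) (hp : ∀ k, L.ChronLT (p k) (p (k + 1))) :
    ∃ γ : ℝ → M, (∀ k : ℤ, γ k = p k) ∧
      ∀ t, L.IsTimelikeLeft γ t ∧ L.IsTimelikeRight γ t := by
  choose c hc hcl hcr using fun k : ℤ ↦
    (hp k).exists_path (a := (k : ℝ)) (b := (k : ℝ) + 1) (by linarith)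
  set γ : ℝ → M := fun t ↦ c ⌊t⌋ t with hγ
  have hγk : ∀ k : ℤ, EqOn (c k) γ (Icc (k : ℝ) (k + 1)) := by
    intro k t ht
    rcases ht.2.eq_or_lt with rfl | h
    · have : ⌊(k : ℝ) + 1⌋ = k + 1 := by simp
      simp only [hγ, this, hcr]
      have := hcl (k + 1)
      push_cast at this
      exact this.symm
    · have : ⌊t⌋ = k := Int.floor_eq_iff.2 ⟨ht.1, h⟩
      simp only [hγ, this]
  have hpath := fun k ↦ (hc k).congr (hγk k)
  refine ⟨γ, fun k ↦ by simp [hγ, hcl], fun t ↦ ⟨?_, ?_⟩⟩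
  · refine (hpath (⌈t⌉ - 1)).left t ⟨?_, ?_⟩
    · push_cast
      linarith [Int.ceil_lt_add_one t]
    · push_cast
      linarith [Int.le_ceil t]
  · exact (hpath ⌊t⌋).right t ⟨Int.floor_le t, Int.lt_floor_add_one t⟩

theorem isInextensibleTimelike_of_forall {γ : ℝ → M}
    (h : ∀ t, L.IsTimelikeLeft γ t ∧ L.IsTimelikeRight γ t)
    (htop : ∀ p, ¬ Tendsto γ atTop (𝓝 p)) (hbot : ∀ p, ¬ Tendsto γ atBot (𝓝 p)) :
    L.IsInextensibleTimelike univ γ := by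
  refine ⟨fun t ↦ ?_, fun ⟨p, _, hp⟩ ↦ htop p hp, fun ⟨p, _, hp⟩ ↦ hbot p hp⟩
  obtain ⟨⟨ε, hε, hl⟩, ε', hε', hr⟩ := h t
  have h0 := lt_min hε hε'
  exact ⟨min ε ε', h0, hl.mono (by linarith) (by linarith [min_le_left ε ε']) le_rfl,
    hr.mono (by linarith) le_rfl (by linarith [min_le_right ε ε'])⟩

/-- A sequence of points without limit, each in the chronological future of the one before. -/
structure IsEndless (L : Spacetime m M) (p : ℕ → M) : Prop where
  step : ∀ k, L.ChronLT (p k) (p (k + 1))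
  not_tendsto : ∀ x, ¬ Tendsto p atTop (𝓝 x)

section SecondCountable

variable [T2Space M] [SecondCountableTopology M]

theorem metrizableSpace_of_charted (m : ℕ) (M : Type u) [TopologicalSpace M]
    [ChartedSpace (EuclideanSpace ℝ (Fin m)) M] [T2Space M] [SecondCountableTopology M] :
    TopologicalSpace.MetrizableSpace M := by
  have := ChartedSpace.locallyCompactSpace (EuclideanSpace ℝ (Fin m)) M
  exact TopologicalSpace.metrizableSpace_of_t3_secondCountable M

/-- At every point starts an endless sequence: leave the push neighbourhoods chosen by `exists_escape`
one after the other. -/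
theorem exists_isEndless (L : Spacetime m M) (x : M) : ∃ p, L.IsEndless p ∧ p 0 = x := by
  have := metrizableSpace_of_charted m M
  choose U K Ψ s₀ hU hc using fun c ↦ L.exists_isPushNhd c
  obtain ⟨s, hs, hesc⟩ := exists_escape U (fun c ↦ (hU c).isOpen) hc
  choose f hf hf' using fun q ↦ (hU (s q)).exit q (hs q)
  exact ⟨fun k ↦ f^[k] x, ⟨fun k ↦ by rw [Function.iterate_succ_apply']; exact hf' _,
    hesc _ fun k ↦ by rw [Function.iterate_succ_apply']; exact hf _⟩, rfl⟩

/-- Through a sequence without end in the future, and one without end in the past, there is an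
inextensible timelike curve. -/
theorem exists_inextensible {p q : ℕ → M} (hp : L.IsEndless p) (hq : L.dual.IsEndless q)
    (h0 : p 0 = q 0) : ∃ γ, L.IsInextensibleTimelike univ γ ∧ ∀ k : ℕ, γ k = p k := by
  obtain ⟨γ, hγ, hγt⟩ := exists_concatenation (L := L)
    (fun k : ℤ ↦ if 0 ≤ k then p k.toNat else q (-k).toNat) (fun k ↦ by
      rcases le_or_gt 0 k with h | h
      · have h1 : (k + 1).toNat = k.toNat + 1 := by omega
        rw [if_pos h, if_pos (by omega), h1]
        exact hp.step _
      · have h1 : (-k).toNat = (-(k + 1)).toNat + 1 := by omega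
        have h2 := chronLT_dual_iff.1 (hq.step (-(k + 1)).toNat)
        rw [if_neg (by omega), h1]
        rcases (show k + 1 ≤ 0 by omega).eq_or_lt with h3 | h3
        · rw [if_pos (by omega)]
          rw [h3] at h2 ⊢
          simpa [h0] using h2
        · rw [if_neg (by omega)]
          exact h2)
  have hγp : ∀ k : ℕ, γ k = p k := fun k ↦ by simpa using hγ k
  have hγq : ∀ k : ℕ, γ (-(k : ℝ)) = q k := fun k ↦ by
    have := hγ (-(k : ℤ))
    push_cast at this
    rw [this]
    rcases k.eq_zero_or_pos with rfl | hk
    · simp [h0]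
    · rw [if_neg (by omega)]
      congr 1
      omega
  refine ⟨γ, isInextensibleTimelike_of_forall hγt (fun x hx ↦ ?_) (fun x hx ↦ ?_), hγp⟩
  · refine hp.not_tendsto x ((hx.comp tendsto_natCast_atTop_atTop).congr hγp)
  · exact hq.not_tendsto x
      ((hx.comp (tendsto_neg_atTop_atBot.comp tendsto_natCast_atTop_atTop)).congr hγq)

theorem IsInextensibleTimelike.chronLT {γ : ℝ → M} (h : L.IsInextensibleTimelike univ γ)
    {s t : ℝ} (hst : s < t) : L.ChronLT (γ s) (γ t) :=
  ⟨γ, s, t, ⟨hst, fun u _ ↦ let ⟨ε, hε, h1⟩ := h.1 u; ⟨ε, hε, h1.2⟩,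
    fun u _ ↦ let ⟨ε, hε, h1⟩ := h.1 u; ⟨ε, hε, h1.1⟩⟩, rfl, rfl⟩

theorem IsInextensibleTimelike.dual {γ : ℝ → M} (h : L.IsInextensibleTimelike univ γ) :
    L.dual.IsInextensibleTimelike univ (γ ∘ fun t ↦ -1 * t + 0) := by
  have e : (fun t : ℝ ↦ -1 * t + 0) = Neg.neg := by funext t; simp
  refine isInextensibleTimelike_of_forall (fun t ↦ ?_) (fun p hp ↦ ?_) (fun p hp ↦ ?_)
  · obtain ⟨ε, hε, hl, hr⟩ := h.1 (-t)
    have h1 := IsTimelikeRight.dual ⟨ε, hε, hr⟩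
    have h2 := IsTimelikeLeft.dual ⟨ε, hε, hl⟩
    rw [neg_neg] at h1 h2
    exact ⟨h1, h2⟩
  · rw [e] at hp
    refine h.2.2 ⟨p, mem_univ p, ?_⟩
    simpa [Function.comp_def] using hp.comp tendsto_neg_atBot_atTop
  · rw [e] at hp
    refine h.2.1 ⟨p, mem_univ p, ?_⟩
    simpa [Function.comp_def] using hp.comp tendsto_neg_atTop_atBot

theorem IsCauchyHypersurface.dual {A : Set M} (h : L.IsCauchyHypersurface univ A) :
    L.dual.IsCauchyHypersurface univ A := by
  refine ⟨h.1, fun γ hγ ↦ ?_⟩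
  have h1 := hγ.dual
  rw [dual_dual] at h1
  obtain ⟨t, ht, huniq⟩ := h.2 _ h1
  refine ⟨-1 * t + 0, ht, fun s hs ↦ ?_⟩
  have := huniq (-s) (by simpa using hs)
  rw [← this]
  simp

/-- A Cauchy hypersurface lies in the past of the tail of every endless sequence. -/
theorem IsCauchyHypersurface.exists_chronLT {A : Set M} (hA : L.IsCauchyHypersurface univ A)
    {p : ℕ → M} (hp : L.IsEndless p) : ∃ a ∈ A, ∃ k, L.ChronLT a (p k) := by
  obtain ⟨q, hq, hq0⟩ := L.dual.exists_isEndless (p 0)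
  obtain ⟨γ, hγ, hγp⟩ := exists_inextensible hp hq hq0.symm
  obtain ⟨t, ht, -⟩ := hA.2 γ hγ
  obtain ⟨k, hk⟩ := exists_nat_gt t
  exact ⟨γ t, ht, k, hγp k ▸ hγ.chronLT hk⟩

/-- No two points of a Cauchy hypersurface are joined by a timelike curve: an inextensible one through
both would meet the hypersurface twice. -/
theorem IsCauchyHypersurface.achronal {A : Set M} (hA : L.IsCauchyHypersurface univ A) {a a' : M}
    (ha : a ∈ A) (ha' : a' ∈ A) : ¬ L.ChronLT a a' := by
  intro h
  obtain ⟨q, hq, hq0⟩ := L.dual.exists_isEndless a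
  obtain ⟨p, hp, hp0⟩ := L.exists_isEndless a'
  have hp' : L.IsEndless (fun k ↦ Nat.casesOn k a p) :=
    ⟨fun k ↦ by
      cases k with
      | zero => exact (congrArg _ hp0).mpr h
      | succ k => exact hp.step k,
    fun x hx ↦ hp.not_tendsto x ((tendsto_add_atTop_iff_nat 1).2 hx)⟩
  obtain ⟨γ, hγ, hγp⟩ := exists_inextensible hp' hq hq0.symm
  have h0 : γ (0 : ℕ) ∈ A := by rw [hγp]; exact ha
  have h1 : γ (1 : ℕ) ∈ A := by rw [hγp]; exact (congrArg (· ∈ A) hp0).mpr ha'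
  have := (hA.2 γ hγ).unique h0 h1
  norm_num at this

/-- One step in the construction of a timelike curve that shadows a family of causal curves with
end points `y` going to infinity. The curves start near `q` and leave `U` near a point `q'`. -/
theorem IsPushNhd.exists_step {U K : Set M} {Ψ : ℝ → M → M} {s₀ : ℝ}
    (hU : L.IsPushNhd U K Ψ s₀) {𝒰 : Ultrafilter M} (h𝒰 : (𝒰 : Filter M) ≤ cocompact M)
    {w : M → M} {p q : M} (hq : q ∈ U) (hw : Tendsto w 𝒰 (𝓝 q))
    (hwle : ∀ᶠ y in 𝒰, L.CausalLE univ (w y) y) (hpq : L.ChronLT p q)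
    {N : M → Set M} (hN : ∀ x, N x ∈ 𝓝 x) :
    ∃ q' w' p', q' ∉ U ∧ Tendsto w' 𝒰 (𝓝 q') ∧ (∀ᶠ y in 𝒰, L.CausalLE univ (w' y) y) ∧
      L.ChronLT p p' ∧ L.ChronLT p' q' ∧ p' ∈ N q' := by
  have hclK : closure U ⊆ K := closure_minimal hU.subset hU.isCompact.isClosed
  have hwU : ∀ᶠ y in 𝒰, w y ∈ U := hw.eventually (hU.isOpen.mem_nhds hq)
  have hyK : ∀ᶠ y in (𝒰 : Filter M), y ∉ K := h𝒰 hU.isCompact.compl_mem_cocompact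
  have hex : ∀ᶠ y in 𝒰, ∃ e ∈ closure U, e ∉ U ∧ L.CausalLE (closure U) (w y) e ∧
      L.CausalLE univ e y := by
    filter_upwards [hwU, hyK, hwle] with y h1 h2 h3
    exact h3.exists_exit hU.isOpen h1 fun h ↦ h2 (hU.subset h)
  obtain ⟨w', hw'⟩ := hex.choice
  have hcomp : IsCompact (closure U ∩ Uᶜ) :=
    (hU.isCompact.of_isClosed_subset isClosed_closure hclK).inter_right hU.isOpen.isClosed_compl
  obtain ⟨q', hq', hlim⟩ := hcomp.ultrafilter_le_nhds (𝒰.map w') (by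
    rw [Ultrafilter.coe_map, le_principal_iff, mem_map]
    filter_upwards [hw'] with y hy using ⟨hy.1, hy.2.1⟩)
  have hlim' : Tendsto w' 𝒰 (𝓝 q') := hlim
  have hq'K : q' ∈ K := hclK hq'.1
  -- `p' = Ψ s' q'` for `s' < s`: then `p ≪ Ψ s (w y) ≪ Ψ s (w' y) ≪ Ψ s' q' ≪ q'` for some `y`
  obtain ⟨s, hs1, hs⟩ := ((hU.eventually_chronLT (hU.subset hq) hpq).and
    (eventually_mem_set.2 hU.Ioo_mem)).exists
  obtain ⟨s', hs', hs'N⟩ := ((eventually_mem_set.2 (Ioo_mem_nhdsGT hs.1)).and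
    ((hU.lim q' hq'K).eventually (hN q'))).exists
  have hs's₀ : s' ∈ Ioo 0 s₀ := ⟨hs'.1, hs'.2.trans hs.2⟩
  refine ⟨q', w', Ψ s' q', hq'.2, hlim', hw'.mono fun y hy ↦ hy.2.2.2, ?_,
    hU.lt s' hs's₀ q' hq'K, hs'N⟩
  have h1 : Tendsto (fun y ↦ Ψ s (w y)) 𝒰 (𝓝 (Ψ s q)) :=
    (hU.cont s hs q (hU.subset hq)).tendsto.comp
      (tendsto_nhdsWithin_iff.2 ⟨hw, hwU.mono fun y hy ↦ hU.subset hy⟩)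
  have h2 : Tendsto (fun y ↦ Ψ s (w' y)) 𝒰 (𝓝 (Ψ s q')) :=
    (hU.cont s hs q' hq'K).tendsto.comp
      (tendsto_nhdsWithin_iff.2 ⟨hlim', hw'.mono fun y hy ↦ hclK hy.1⟩)
  obtain ⟨y, hy1, hy2, hy3⟩ := ((h1.eventually ((isOpen_chronFuture p).mem_nhds hs1)).and
    ((h2.eventually ((isOpen_chronPast (Ψ s' q')).mem_nhds
      (hU.anti s' hs's₀ s ⟨hs'.2, hs.2⟩ q' hq'K))).and hw')).exists
  have hle : L.CausalLE K (w y) (w' y) := hy3.2.2.1.mono hclK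
  rcases hU.push s hs _ _ hle with h | h
  · exact ChronLT.trans (h ▸ hy1) hy2
  · exact (ChronLT.trans hy1 h).trans hy2

/-- If causal curves start in a compact set and their end points go to infinity, then a single
endless timelike curve enters the past of almost all the end points. -/
theorem exists_isEndless_of_cocompact {𝒰 : Ultrafilter M} (h𝒰 : (𝒰 : Filter M) ≤ cocompact M)
    {K : Set M} (hK : IsCompact K) (hle : ∀ᶠ y in 𝒰, ∃ x ∈ K, L.CausalLE univ x y) :
    ∃ p, L.IsEndless p ∧ ∀ k, ∀ᶠ y in 𝒰, L.ChronLT (p k) y := by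
  have hmet := metrizableSpace_of_charted m M
  let := TopologicalSpace.metrizableSpaceMetric M
  choose U K' Ψ s₀ hU hc using fun c ↦ L.exists_isPushNhd c
  obtain ⟨s, hs, hesc⟩ := exists_escape U (fun c ↦ (hU c).isOpen) hc
  obtain ⟨w₀, hw₀⟩ := hle.choice
  obtain ⟨q₀, -, hq₀⟩ := hK.ultrafilter_le_nhds (𝒰.map w₀) (by
    rw [Ultrafilter.coe_map, le_principal_iff, mem_map]
    filter_upwards [hw₀] with y hy using hy.1)
  obtain ⟨r₀, hr₀⟩ := (eventually_mem_set.2 (hU q₀).Ioo_mem).exists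
  -- the points `q`, the curves given by their starting points `w`, and the shadow `p` of `q`
  let State := {x : M × (M → M) × M // Tendsto x.2.1 𝒰 (𝓝 x.1) ∧
    (∀ᶠ y in 𝒰, L.CausalLE univ (x.2.1 y) y) ∧ L.ChronLT x.2.2 x.1}
  have hstep : ∀ (k : ℕ) (x : State), ∃ x' : State, x'.1.1 ∉ U (s x.1.1) ∧
      L.ChronLT x.1.2.2 x'.1.2.2 ∧ dist x'.1.2.2 x'.1.1 < 1 / ((k : ℝ) + 1) := by
    rintro k ⟨⟨q, w, p⟩, hw, hwle, hpq⟩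
    obtain ⟨q', w', p', h1, h2, h3, h4, h5, h6⟩ := (hU (s q)).exists_step h𝒰 (hs q) hw hwle hpq
      (N := fun x ↦ Metric.ball x (1 / ((k : ℝ) + 1)))
      (fun x ↦ Metric.ball_mem_nhds x (by positivity))
    exact ⟨⟨⟨q', w', p'⟩, h2, h3, h5⟩, h1, h4, h6⟩
  choose f hf1 hf2 hf3 using hstep
  let x : ℕ → State := fun k ↦ Nat.rec ⟨⟨q₀, w₀, Ψ q₀ r₀ q₀⟩, hq₀, hw₀.mono fun y hy ↦ hy.2,
    (hU q₀).lt r₀ hr₀ q₀ ((hU q₀).subset (hc q₀))⟩ f k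
  refine ⟨fun k ↦ (x k).1.2.2, ⟨fun k ↦ hf2 k (x k), fun l hl ↦ ?_⟩, fun k ↦ ?_⟩
  · -- the sequences `p` and `q` approach each other, and `q` does not converge
    refine hesc (fun k ↦ (x k).1.1) (fun k ↦ hf1 k (x k)) l ?_
    rw [← tendsto_add_atTop_iff_nat 1] at hl ⊢
    refine tendsto_of_tendsto_of_dist hl ?_
    exact squeeze_zero (fun k ↦ dist_nonneg) (fun k ↦ (hf3 k (x k)).le)
      tendsto_one_div_add_atTop_nhds_zero_nat
  · obtain ⟨h1, h2, h3⟩ := (x k).2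
    filter_upwards [h1.eventually ((isOpen_chronFuture _).mem_nhds h3), h2] with y hy hy'
    exact ChronLT.trans_causalLE hy hy'

/-- In a globally hyperbolic spacetime the causal diamonds `J₊(K₁) ∩ J₋(K₂)` of compact sets are
relatively compact. Otherwise points `y` of the diamond go to infinity, and by
`exists_isEndless_of_cocompact`, applied to both time directions, an endless timelike curve from the
past and one from the future shadow the causal curves to `y`. Both cross the Cauchy hypersurface, say
at `a` and `a'`, and then `a ≪ y ≪ a'` contradicts its achronality. -/
theorem IsGloballyHyperbolic.exists_compact_diamond (h : L.IsGloballyHyperbolic univ)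
    {K₁ K₂ : Set M} (hK₁ : IsCompact K₁) (hK₂ : IsCompact K₂) :
    ∃ C, IsCompact C ∧ L.causalFuture univ K₁ ∩ L.causalPast univ K₂ ⊆ C := by
  obtain ⟨A, hA⟩ := h
  by_contra hno
  push Not at hno
  set J := L.causalFuture univ K₁ ∩ L.causalPast univ K₂ with hJ
  have hne : (cocompact M ⊓ 𝓟 J).NeBot := by
    rw [neBot_iff]
    intro hbot
    rw [inf_principal_eq_bot, mem_cocompact] at hbot
    obtain ⟨t, ht, hsub⟩ := hbot
    exact hno t ht (compl_subset_compl.1 hsub)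
  set 𝒰 := Ultrafilter.of (cocompact M ⊓ 𝓟 J) with h𝒰
  have h1 : (𝒰 : Filter M) ≤ cocompact M := (Ultrafilter.of_le _).trans inf_le_left
  have h2 : ∀ᶠ y in (𝒰 : Filter M), y ∈ J :=
    ((Ultrafilter.of_le (cocompact M ⊓ 𝓟 J)).trans inf_le_right) (mem_principal_self J)
  obtain ⟨p, hp, hpy⟩ := exists_isEndless_of_cocompact (L := L) h1 hK₁
    (h2.mono fun y hy ↦ let ⟨x, hx, hxy⟩ := hy.1; ⟨x, hx.1, hxy⟩)
  obtain ⟨p', hp', hpy'⟩ := exists_isEndless_of_cocompact (L := L.dual) h1 hK₂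
    (h2.mono fun y hy ↦ let ⟨x, hx, hxy⟩ := hy.2; ⟨x, hx.1, hxy.dual⟩)
  obtain ⟨a, ha, k, hak⟩ := hA.exists_chronLT hp
  obtain ⟨a', ha', k', hak'⟩ := hA.dual.exists_chronLT hp'
  obtain ⟨y, hy, hy'⟩ := ((hpy k).and (hpy' k')).exists
  exact hA.achronal ha ha' ((hak.trans hy).trans
    ((chronLT_dual_iff.1 hy').trans (chronLT_dual_iff.1 hak')))

end SecondCountable

end Spacetime

end GreenHyp

end

noncomputable section

namespace GreenHyp

/-! ### The volume element -/

namespace Spacetime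

variable {m : ℕ} {M : Type u} [TopologicalSpace M]
  [ChartedSpace (EuclideanSpace ℝ (Fin m)) M] [IsManifold (𝓡 m) ∞ M] {L : Spacetime m M}

/-- The volume of `A` computed in the chart around `c`; it only sees the part of `A` in the domain
of that chart. -/
def coordVol (L : Spacetime m M) (c : M) (A : Set M) : ENNReal :=
  ∫⁻ z in (chartAt (EuclideanSpace ℝ (Fin m)) c).target ∩ chartInv c ⁻¹' A, L.chartDensity c z

theorem measurableSet_chartInv_preimage (c : M) {A : Set M} (hA : MeasurableSet[borel M] A) :
    MeasurableSet ((chartAt (EuclideanSpace ℝ (Fin m)) c).target ∩ chartInv c ⁻¹' A) := by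
  let : MeasurableSpace M := borel M
  have : BorelSpace M := ⟨rfl⟩
  set φ := chartAt (EuclideanSpace ℝ (Fin m)) c
  have h1 : Measurable (φ.target.domRestrict φ.symm) :=
    (continuousOn_iff_continuous_domRestrict.1 φ.continuousOn_symm).measurable
  have h2 := φ.open_target.measurableSet.subtype_image (h1 hA)
  convert h2 using 1
  ext z
  simp [chartInv, φ, and_comm]

theorem coordVol_iUnion (c : M) {A : ℕ → Set M} (hA : ∀ i, MeasurableSet[borel M] (A i))
    (hd : Pairwise (Function.onFun Disjoint A)) :
    L.coordVol c (⋃ i, A i) = ∑' i, L.coordVol c (A i) := by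
  simp only [coordVol, preimage_iUnion, inter_iUnion]
  refine lintegral_iUnion (fun i ↦ measurableSet_chartInv_preimage c (hA i)) ?_ _
  exact fun i j hij ↦ ((hd hij).preimage _).mono inter_subset_right inter_subset_right

theorem chartVolume_apply (c : M) {A B : Set M} (hA : MeasurableSet[borel M] A)
    (hB : MeasurableSet[borel M] B) : L.chartVolume c A B = L.coordVol c (B ∩ A) := by
  let : MeasurableSpace M := borel M
  have : BorelSpace M := ⟨rfl⟩
  have hT := measurableSet_chartInv_preimage (m := m) c hA
  have h1 : AEMeasurable (chartInv c) (volume.restrict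
      ((chartAt (EuclideanSpace ℝ (Fin m)) c).target ∩ chartInv c ⁻¹' A)) :=
    ((chartAt (EuclideanSpace ℝ (Fin m)) c).continuousOn_symm.mono inter_subset_left).aemeasurable
      hT
  rw [chartVolume, Measure.map_apply_of_aemeasurable
    (h1.mono_ac (withDensity_absolutelyContinuous _ _)) hB, withDensity_apply',
    Measure.restrict_restrict' hT, coordVol]
  congr 2
  ext z
  simp only [mem_inter_iff, mem_preimage]
  tauto

/-- The volume element as a sum over countably many disjoint pieces of chart domains. -/
theorem exists_vol_eq_tsum [SecondCountableTopology M] [Nonempty M] (L : Spacetime m M) :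
    ∃ (c : ℕ → M) (D : ℕ → Set M), (∀ i, MeasurableSet[borel M] (D i)) ∧
      Pairwise (Function.onFun Disjoint D) ∧ ⋃ i, D i = univ ∧
      (∀ i, D i ⊆ (chartAt (EuclideanSpace ℝ (Fin m)) (c i)).source) ∧
      ∀ B, MeasurableSet[borel M] B → L.vol B = ∑' i, L.coordVol (c i) (B ∩ D i) := by
  let : MeasurableSpace M := borel M
  have : BorelSpace M := ⟨rfl⟩
  set c := (exists_chart_cover m M).choose with hc
  have hm : ∀ i, MeasurableSet
      (disjointed (fun j ↦ (chartAt (EuclideanSpace ℝ (Fin m)) (c j)).source) i) := fun i ↦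
    MeasurableSet.disjointed
      (fun j ↦ (chartAt (EuclideanSpace ℝ (Fin m)) (c j)).open_source.measurableSet) i
  refine ⟨c, disjointed fun j ↦ (chartAt (EuclideanSpace ℝ (Fin m)) (c j)).source, hm,
    disjoint_disjointed _, ?_, fun i ↦ disjointed_subset _ i, fun B hB ↦ ?_⟩
  · rw [iUnion_disjointed]
    exact (exists_chart_cover m M).choose_spec
  · rw [vol, dif_pos ‹_›]
    change (Measure.sum _) B = _
    rw [Measure.sum_apply _ hB]
    exact tsum_congr fun i ↦ chartVolume_apply _ (hm i) hB

section Isometry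

variable {N : Type u} [TopologicalSpace N]
  [ChartedSpace (EuclideanSpace ℝ (Fin m)) N] [IsManifold (𝓡 m) ∞ N] {L' : Spacetime m N}

theorem chartDensity_eq (c : M) (z : EuclideanSpace ℝ (Fin m)) :
    L.chartDensity c z = ENNReal.ofReal √|(Matrix.of fun i j ↦
      L.chartMetric c z (EuclideanSpace.single i 1) (EuclideanSpace.single j 1)).det| := rfl

/-- The Gram determinant of a bilinear form transforms under a linear map by the square of its
determinant. -/
theorem det_gram_comp (B : EuclideanSpace ℝ (Fin m) →L[ℝ] EuclideanSpace ℝ (Fin m) →L[ℝ] ℝ)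
    (D : EuclideanSpace ℝ (Fin m) →L[ℝ] EuclideanSpace ℝ (Fin m)) :
    (Matrix.of fun i j ↦ B (D (EuclideanSpace.single i 1)) (D (EuclideanSpace.single j 1))).det =
      D.det ^ 2 * (Matrix.of fun i j ↦
        B (EuclideanSpace.single i 1) (EuclideanSpace.single j 1)).det := by
  set b := (EuclideanSpace.basisFun (Fin m) ℝ).toBasis with hb
  let B' : EuclideanSpace ℝ (Fin m) →ₗ[ℝ] EuclideanSpace ℝ (Fin m) →ₗ[ℝ] ℝ :=
    LinearMap.mk₂ ℝ (fun v w ↦ B v w) (by simp) (by simp) (by simp) (by simp)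
  have h1 := LinearMap.toMatrix₂_compl₁₂ b b b b B' D.toLinearMap D.toLinearMap
  have h2 : (Matrix.of fun i j ↦ B (EuclideanSpace.single i 1) (EuclideanSpace.single j 1)) =
      LinearMap.toMatrix₂ b b B' := by
    ext i j
    simp [LinearMap.toMatrix₂_apply, b, B']
  have h3 : (Matrix.of fun i j ↦
      B (D (EuclideanSpace.single i 1)) (D (EuclideanSpace.single j 1))) =
      LinearMap.toMatrix₂ b b (B'.compl₁₂ D.toLinearMap D.toLinearMap) := by
    ext i j
    simp [LinearMap.toMatrix₂_apply, b, B']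
  rw [h2, h3, h1, Matrix.det_mul, Matrix.det_mul, Matrix.det_transpose, LinearMap.det_toMatrix]
  rw [ContinuousLinearMap.det]
  ring

/-- In charts, an isometry pulls the volume density back by the Jacobian determinant. -/
theorem chartDensity_comp {f : M → N} (hf : IsLocalDiffeomorph (𝓡 m) (𝓡 m) ∞ f)
    (hiso : ∀ x v w, L'.metric (f x) (mfderiv (𝓡 m) (𝓡 m) f x v) (mfderiv (𝓡 m) (𝓡 m) f x w) =
      L.metric x v w) {c : M} {d : N} {z : EuclideanSpace ℝ (Fin m)}
    (hz : z ∈ (chartAt (EuclideanSpace ℝ (Fin m)) c).target)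
    (hd : f (chartInv c z) ∈ (chartAt (EuclideanSpace ℝ (Fin m)) d).source) :
    ∃ D : EuclideanSpace ℝ (Fin m) →L[ℝ] EuclideanSpace ℝ (Fin m),
      HasFDerivAt (chartAt (EuclideanSpace ℝ (Fin m)) d ∘ f ∘ chartInv c) D z ∧
      L.chartDensity c z = ENNReal.ofReal |D.det| *
        L'.chartDensity d (chartAt (EuclideanSpace ℝ (Fin m)) d (f (chartInv c z))) := by
  have hIM : IsManifold (𝓡 m) 1 M := .of_le (n := ∞) (by simp)
  have hIN : IsManifold (𝓡 m) 1 N := .of_le (n := ∞) (by simp)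
  set ψ := chartAt (EuclideanSpace ℝ (Fin m)) d with hψ
  have h1 := ((mdifferentiable_chart (I := 𝓡 m) c).mdifferentiableAt_symm hz).hasMFDerivAt
  have h2 := (hf.mdifferentiable (by simp) (chartInv c z)).hasMFDerivAt
  have h3 := ((mdifferentiable_chart (I := 𝓡 m) d).mdifferentiableAt hd).hasMFDerivAt
  have h4 := h3.comp z (h2.comp z h1)
  refine ⟨_, h4.hasFDerivAt, ?_⟩
  set D : EuclideanSpace ℝ (Fin m) →L[ℝ] EuclideanSpace ℝ (Fin m) :=
    (mfderiv (𝓡 m) (𝓡 m) ψ (f (chartInv c z))).comp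
      ((mfderiv (𝓡 m) (𝓡 m) f (chartInv c z)).comp (chartFrame c z)) with hD
  have hmet : ∀ v w, L.chartMetric c z v w =
      L'.chartMetric d (ψ (f (chartInv c z))) (D v) (D w) := by
    intro v w
    have hframe : ∀ (y : N) (_ : y ∈ ψ.source) (z' : EuclideanSpace ℝ (Fin m)) (_ : ψ y = z')
        (u₁ u₂ : TangentSpace (𝓡 m) y), L'.chartMetric d z' (mfderiv (𝓡 m) (𝓡 m) ψ y u₁)
          (mfderiv (𝓡 m) (𝓡 m) ψ y u₂) = L'.metric y u₁ u₂ := by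
      intro y hy z' hz'
      have hz't : z' ∈ ψ.target := hz' ▸ ψ.map_source hy
      obtain rfl : y = chartInv d z' := by rw [← hz']; exact (ψ.left_inv hy).symm
      intro u₁ u₂
      exact congrArg₂ (fun a b ↦ L'.metric (chartInv d z') a b) (chartFrame_mfderiv hz't u₁)
        (chartFrame_mfderiv hz't u₂)
    exact ((hframe _ hd _ rfl _ _).trans (hiso _ _ _)).symm
  change _ = ENNReal.ofReal |D.det| * _
  rw [chartDensity_eq, chartDensity_eq]
  simp only [hmet]
  rw [det_gram_comp, abs_mul, abs_pow, Real.sqrt_mul (by positivity),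
    Real.sqrt_sq (abs_nonneg _), ENNReal.ofReal_mul (abs_nonneg _)]

/-- The change of variables formula: an isometry preserves the volume computed in charts. -/
theorem coordVol_image {f : M → N} (hf : IsLocalDiffeomorph (𝓡 m) (𝓡 m) ∞ f)
    (hinj : Function.Injective f)
    (hiso : ∀ x v w, L'.metric (f x) (mfderiv (𝓡 m) (𝓡 m) f x v) (mfderiv (𝓡 m) (𝓡 m) f x w) =
      L.metric x v w) {c : M} {d : N} {B : Set M} (hB : MeasurableSet[borel M] B)
    (hBc : B ⊆ (chartAt (EuclideanSpace ℝ (Fin m)) c).source)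
    (hBd : f '' B ⊆ (chartAt (EuclideanSpace ℝ (Fin m)) d).source) :
    L'.coordVol d (f '' B) = L.coordVol c B := by
  set φ := chartAt (EuclideanSpace ℝ (Fin m)) c with hφ
  set ψ := chartAt (EuclideanSpace ℝ (Fin m)) d with hψ
  have hex : ∀ z ∈ φ.target ∩ chartInv c ⁻¹' B, ∃ D, HasFDerivAt (ψ ∘ f ∘ chartInv c) D z ∧
      L.chartDensity c z = ENNReal.ofReal |D.det| *
        L'.chartDensity d ((ψ ∘ f ∘ chartInv c) z) := fun z hz ↦
    chartDensity_comp hf hiso hz.1 (hBd (mem_image_of_mem f hz.2))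
  choose! D hD1 hD2 using hex
  have himg : ψ.target ∩ chartInv d ⁻¹' (f '' B) =
      (ψ ∘ f ∘ chartInv c) '' (φ.target ∩ chartInv c ⁻¹' B) := by
    ext y
    constructor
    · rintro ⟨hy, x, hx, hxy⟩
      refine ⟨φ x, ⟨φ.map_source (hBc hx), ?_⟩, ?_⟩
      · rw [mem_preimage, chartInv, φ.left_inv (hBc hx)]
        exact hx
      · simp only [Function.comp, chartInv]
        rw [φ.left_inv (hBc hx), hxy]
        exact ψ.right_inv hy
    · rintro ⟨z, ⟨hz, hzB⟩, rfl⟩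
      have h1 : f (chartInv c z) ∈ ψ.source := hBd (mem_image_of_mem f hzB)
      refine ⟨ψ.map_source h1, ?_⟩
      have h2 : chartInv d (ψ (f (chartInv c z))) = f (chartInv c z) := ψ.left_inv h1
      rw [mem_preimage, Function.comp, Function.comp, h2]
      exact mem_image_of_mem f hzB
  have hinjOn : InjOn (ψ ∘ f ∘ chartInv c) (φ.target ∩ chartInv c ⁻¹' B) := by
    intro z hz z' hz' h
    have h1 := ψ.injOn (hBd (mem_image_of_mem f hz.2)) (hBd (mem_image_of_mem f hz'.2)) h
    exact φ.symm.injOn hz.1 hz'.1 (hinj h1)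
  rw [coordVol, himg, lintegral_image_eq_lintegral_abs_det_fderiv_mul volume
    (measurableSet_chartInv_preimage c hB) (fun z hz ↦ (hD1 z hz).hasFDerivWithinAt) hinjOn,
    coordVol]
  exact setLIntegral_congr_fun (measurableSet_chartInv_preimage c hB)
    fun z hz ↦ (hD2 z hz).symm

/-- On the domain of a chart the volume element is given by the density of that chart. -/
theorem vol_eq_coordVol [SecondCountableTopology M] {d : M} {B : Set M}
    (hB : MeasurableSet[borel M] B)
    (hBd : B ⊆ (chartAt (EuclideanSpace ℝ (Fin m)) d).source) : L.vol B = L.coordVol d B := by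
  have : Nonempty M := ⟨d⟩
  obtain ⟨c, D, hDm, hDd, hDu, hDc, hvol⟩ := L.exists_vol_eq_tsum
  let : MeasurableSpace M := borel M
  have hm : ∀ i, MeasurableSet (B ∩ D i) := fun i ↦ hB.inter (hDm i)
  have h1 : ∀ i, L.coordVol (c i) (B ∩ D i) = L.coordVol d (B ∩ D i) := fun i ↦ by
    have := coordVol_image (L := L) (L' := L) (f := id) (c := d) (d := c i)
      (Diffeomorph.refl (𝓡 m) M ∞).isLocalDiffeomorph Function.injective_id
      (fun x v w ↦ by simp [mfderiv_id]) (hm i) (inter_subset_left.trans hBd)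
      (by rw [image_id]; exact inter_subset_right.trans (hDc i))
    rwa [image_id] at this
  rw [hvol B hB, tsum_congr h1, ← coordVol_iUnion d hm
    (fun i j hij ↦ (hDd hij).mono inter_subset_right inter_subset_right), ← inter_iUnion, hDu,
    inter_univ]

theorem vol_image_of_subset [SecondCountableTopology M] [SecondCountableTopology N] {f : M → N}
    (hf : IsLocalDiffeomorph (𝓡 m) (𝓡 m) ∞ f)
    (hinj : Function.Injective f)
    (hiso : ∀ x v w, L'.metric (f x) (mfderiv (𝓡 m) (𝓡 m) f x v) (mfderiv (𝓡 m) (𝓡 m) f x w) =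
      L.metric x v w) {c : M} {d : N} {B : Set M} (hB : MeasurableSet[borel M] B)
    (hBc : B ⊆ (chartAt (EuclideanSpace ℝ (Fin m)) c).source)
    (hBd : f '' B ⊆ (chartAt (EuclideanSpace ℝ (Fin m)) d).source) :
    L'.vol (f '' B) = L.vol B := by
  let : MeasurableSpace M := borel M
  have : BorelSpace M := ⟨rfl⟩
  let : MeasurableSpace N := borel N
  have : BorelSpace N := ⟨rfl⟩
  have he : IsOpenEmbedding f :=
    .of_continuous_injective_isOpenMap hf.contMDiff.continuous hinj hf.isOpenMap
  rw [vol_eq_coordVol hB hBc, vol_eq_coordVol (he.measurableEmbedding.measurableSet_image' hB) hBd,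
    coordVol_image hf hinj hiso hB hBc hBd]

/-- An isometric open embedding preserves the volume element. -/
theorem map_vol [SecondCountableTopology M] [SecondCountableTopology N] {f : M → N}
    (hf : IsLocalDiffeomorph (𝓡 m) (𝓡 m) ∞ f)
    (hinj : Function.Injective f)
    (hiso : ∀ x v w, L'.metric (f x) (mfderiv (𝓡 m) (𝓡 m) f x v) (mfderiv (𝓡 m) (𝓡 m) f x w) =
      L.metric x v w) :
    @Measure.map M N (borel M) (borel N) f L.vol =
      @Measure.restrict N (borel N) L'.vol (range f) := by
  let : MeasurableSpace M := borel M
  have : BorelSpace M := ⟨rfl⟩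
  let : MeasurableSpace N := borel N
  have : BorelSpace N := ⟨rfl⟩
  have he : IsOpenEmbedding f :=
    .of_continuous_injective_isOpenMap hf.contMDiff.continuous hinj hf.isOpenMap
  have hme := he.measurableEmbedding
  rw [← hme.map_comap]
  congr 1
  -- it suffices to compare the measures on a countable cover by sets `W x` inside chart domains
  set W : M → Set M := fun x ↦ (chartAt (EuclideanSpace ℝ (Fin m)) x).source ∩
    f ⁻¹' (chartAt (EuclideanSpace ℝ (Fin m)) (f x)).source with hW
  have hWo : ∀ x, IsOpen (W x) := fun x ↦ (chartAt _ x).open_source.inter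
    ((chartAt _ (f x)).open_source.preimage he.continuous)
  obtain ⟨s, hs, hU⟩ := TopologicalSpace.countable_cover_nhds
    (fun x ↦ (hWo x).mem_nhds (show x ∈ W x from ⟨mem_chart_source _ x, mem_chart_source _ (f x)⟩))
  have := hs.to_subtype
  rw [Measure.ext_iff_of_iUnion_eq_univ (s := fun x : s ↦ W x) (by rw [← hU, iUnion_subtype])]
  intro x
  ext B hB
  rw [Measure.restrict_apply hB, Measure.restrict_apply hB, hme.comap_apply]
  refine (vol_image_of_subset hf hinj hiso (c := x.1) (d := f x)
    (hB.inter (hWo x).measurableSet) (inter_subset_right.trans inter_subset_left) ?_).symm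
  exact image_subset_iff.2 (inter_subset_right.trans inter_subset_right)

end Isometry

theorem continuousOn_gram_det (c : M) :
    ContinuousOn (fun z ↦ (Matrix.of fun i j ↦ L.chartMetric c z (EuclideanSpace.single i 1)
      (EuclideanSpace.single j 1)).det) (chartAt (EuclideanSpace ℝ (Fin m)) c).target := by
  have hg : ContinuousOn (L.chartMetric c) (chartAt (EuclideanSpace ℝ (Fin m)) c).target :=
    contDiffOn_chartMetric.continuousOn
  have hij : ∀ i j : Fin m, ContinuousOn (fun z ↦ L.chartMetric c z (EuclideanSpace.single i 1)
      (EuclideanSpace.single j 1)) (chartAt (EuclideanSpace ℝ (Fin m)) c).target := fun i j ↦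
    (hg.clm_apply continuousOn_const).clm_apply continuousOn_const
  have hG : ContinuousOn (fun z ↦ (Matrix.of fun i j ↦ L.chartMetric c z
      (EuclideanSpace.single i 1) (EuclideanSpace.single j 1) : Matrix (Fin m) (Fin m) ℝ))
      (chartAt (EuclideanSpace ℝ (Fin m)) c).target :=
    continuousOn_pi.2 fun i ↦ continuousOn_pi.2 fun j ↦ hij i j
  exact (continuous_id.matrix_det).comp_continuousOn hG

/-- A vector in the kernel of the Gram matrix is orthogonal to everything, in particular to a timelike
vector, so that it is spacelike or zero; being orthogonal to itself it is zero. -/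
theorem gram_det_ne_zero {c : M} {z : EuclideanSpace ℝ (Fin m)}
    (hz : z ∈ (chartAt (EuclideanSpace ℝ (Fin m)) c).target) :
    (Matrix.of fun i j ↦ L.chartMetric c z (EuclideanSpace.single i 1)
      (EuclideanSpace.single j 1)).det ≠ 0 := by
  intro h0
  obtain ⟨v, hv0, hv⟩ := Matrix.exists_mulVec_eq_zero_iff.2 h0
  set b := EuclideanSpace.basisFun (Fin m) ℝ with hb
  set w : EuclideanSpace ℝ (Fin m) := ∑ j, v j • EuclideanSpace.single j (1 : ℝ) with hw
  have h1 : ∀ i, L.chartMetric c z (EuclideanSpace.single i 1) w = 0 := fun i ↦ by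
    have := congrFun hv i
    simp only [Matrix.mulVec, dotProduct, Matrix.of_apply, Pi.zero_apply] at this
    rw [hw, map_sum, ← this]
    exact Finset.sum_congr rfl fun j _ ↦ by rw [map_smul, smul_eq_mul, mul_comm]
  have hw0 : w ≠ 0 := by
    intro h
    apply hv0
    ext j
    have := congrArg (fun u : EuclideanSpace ℝ (Fin m) ↦ u j) h
    simpa [hw, Pi.single_apply, Finset.sum_apply] using this
  clear_value w
  have h2 : ∀ u, L.chartMetric c z u w = 0 := fun u ↦ by
    rw [← b.sum_repr u, map_sum, sum_apply]
    refine Finset.sum_eq_zero fun i _ ↦ ?_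
    rw [map_smul, smul_apply, hb, EuclideanSpace.basisFun_apply, h1, smul_zero]
  exact (chartMetric_pos_of_orthogonal hz (h2 _) hw0).ne' (h2 w)

/-- The volume element is locally finite: in a chart its density is bounded on compact sets. -/
theorem isLocallyFiniteMeasure_vol [SecondCountableTopology M] (L : Spacetime m M) :
    @IsLocallyFiniteMeasure M (borel M) _ L.vol := by
  let : MeasurableSpace M := borel M
  have : BorelSpace M := ⟨rfl⟩
  refine ⟨fun x ↦ ?_⟩
  set φ := chartAt (EuclideanSpace ℝ (Fin m)) x with hφ
  have hx : x ∈ φ.source := mem_chart_source _ x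
  obtain ⟨r, hr, hball⟩ := Metric.nhds_basis_closedBall.mem_iff.1
    (φ.open_target.mem_nhds (φ.map_source hx))
  have hso : IsOpen (φ.source ∩ φ ⁻¹' Metric.ball (φ x) r) :=
    φ.isOpen_inter_preimage Metric.isOpen_ball
  refine ⟨φ.source ∩ φ ⁻¹' Metric.ball (φ x) r,
    hso.mem_nhds ⟨hx, Metric.mem_ball_self hr⟩, ?_⟩
  rw [vol_eq_coordVol hso.measurableSet inter_subset_left, coordVol]
  obtain ⟨B, hB⟩ := (isCompact_closedBall (φ x) r).exists_bound_of_continuousOn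
    (((continuousOn_gram_det (L := L) x).mono hball).abs.sqrt)
  have hsub : φ.target ∩ chartInv x ⁻¹' (φ.source ∩ φ ⁻¹' Metric.ball (φ x) r) ⊆
      Metric.closedBall (φ x) r := by
    rintro z ⟨hz, -, hz2⟩
    have h2 : φ (chartInv x z) = z := φ.right_inv hz
    rw [mem_preimage, h2] at hz2
    exact Metric.ball_subset_closedBall hz2
  calc ∫⁻ z in φ.target ∩ chartInv x ⁻¹' (φ.source ∩ φ ⁻¹' Metric.ball (φ x) r), L.chartDensity x z
      ≤ ∫⁻ z in Metric.closedBall (φ x) r, L.chartDensity x z := lintegral_mono_set hsub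
    _ ≤ ∫⁻ _ in Metric.closedBall (φ x) r, ENNReal.ofReal B :=
        setLIntegral_mono' Metric.isClosed_closedBall.measurableSet fun z hz ↦ by
          rw [chartDensity_eq]
          exact ENNReal.ofReal_le_ofReal ((le_abs_self _).trans (hB z hz))
    _ < ⊤ := by
        rw [setLIntegral_const]
        exact ENNReal.mul_lt_top ENNReal.ofReal_lt_top measure_closedBall_lt_top

/-- The volume element charges every non-empty open set, as its density is continuous and positive. -/
theorem isOpenPosMeasure_vol [SecondCountableTopology M] (L : Spacetime m M) :
    @Measure.IsOpenPosMeasure M _ (borel M) L.vol := by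
  let : MeasurableSpace M := borel M
  have : BorelSpace M := ⟨rfl⟩
  refine ⟨fun U hU ⟨x, hxU⟩ h0 ↦ ?_⟩
  set φ := chartAt (EuclideanSpace ℝ (Fin m)) x with hφ
  have hx : x ∈ φ.source := mem_chart_source _ x
  have hxt := φ.map_source hx
  have hUo : IsOpen (U ∩ φ.source) := hU.inter φ.open_source
  have h1 := measure_mono_null inter_subset_left h0 (s := U ∩ φ.source)
  rw [vol_eq_coordVol (d := x) hUo.measurableSet inter_subset_right, coordVol] at h1
  have hSo : IsOpen (φ.target ∩ chartInv x ⁻¹' (U ∩ φ.source)) :=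
    φ.symm.isOpen_inter_preimage hUo
  have hmem : φ x ∈ φ.target ∩ chartInv x ⁻¹' (U ∩ φ.source) := by
    refine ⟨hxt, ?_⟩
    rw [mem_preimage, show chartInv x (φ x) = x from φ.left_inv hx]
    exact ⟨hxU, hx⟩
  have hpos := Real.sqrt_pos.2 (abs_pos.2 (gram_det_ne_zero (L := L) hxt))
  have hev := ((continuousOn_gram_det (L := L) x).abs.sqrt.continuousAt
    (φ.open_target.mem_nhds hxt)).eventually (lt_mem_nhds (half_lt_self hpos))
  obtain ⟨r, hr, hball⟩ := Metric.eventually_nhds_iff_ball.1 (hev.and (hSo.mem_nhds hmem))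
  have h2 : ENNReal.ofReal (√|(Matrix.of fun i j ↦ L.chartMetric x (φ x)
      (EuclideanSpace.single i 1) (EuclideanSpace.single j 1)).det| / 2) *
      volume (Metric.ball (φ x) r) ≤ 0 := by
    rw [← h1, ← setLIntegral_const]
    refine (setLIntegral_mono' measurableSet_ball fun z hz ↦ ?_).trans
      (lintegral_mono_set fun z hz ↦ (hball z hz).2)
    rw [chartDensity_eq]
    exact ENNReal.ofReal_le_ofReal (hball z hz).1.le
  refine (ENNReal.mul_pos ?_ (Metric.measure_ball_pos volume _ hr).ne').not_ge h2
  simpa using hpos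

end Spacetime

end GreenHyp

end

noncomputable section

namespace GreenHyp

/-! ### Locality of differential operators and the pairing of sections -/

section Locality

variable {m : ℕ} {M : Type u} [TopologicalSpace M]
  [ChartedSpace (EuclideanSpace ℝ (Fin m)) M]
  {F : Type w} [NormedAddCommGroup F] [NormedSpace ℝ F]
  {S : M → Type v} [TopologicalSpace (TotalSpace F S)]
  [∀ x, TopologicalSpace (S x)] [∀ x, AddCommGroup (S x)] [∀ x, Module ℝ (S x)]
  [FiberBundle F S] [VectorBundle ℝ F S]

theorem supp_univ (σ : Sec m F S univ) : supp σ = closure {x | σ x ≠ 0} := inter_univ _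

theorem isClosed_supp_univ (σ : Sec m F S univ) : IsClosed (supp σ) := by
  rw [supp_univ]
  exact isClosed_closure

theorem eq_zero_of_notMem_supp {σ : Sec m F S univ} {x : M} (h : x ∉ supp σ) : σ x = 0 := by
  by_contra h0
  exact h ⟨subset_closure h0, mem_univ x⟩

theorem supp_subset_of_forall {σ : Sec m F S univ} {K : Set M} (hK : IsClosed K)
    (h : ∀ x ∉ K, σ x = 0) : supp σ ⊆ K := by
  rw [supp_univ]
  refine closure_minimal (fun x hx ↦ ?_) hK
  by_contra hxK
  exact hx (h x hxK)

theorem supp_sub_subset (σ τ : Sec m F S univ) : supp (σ - τ) ⊆ supp σ ∪ supp τ := by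
  refine supp_subset_of_forall ((isClosed_supp_univ σ).union (isClosed_supp_univ τ)) fun x hx ↦ ?_
  rw [mem_union, not_or] at hx
  change σ x - τ x = 0
  rw [eq_zero_of_notMem_supp hx.1, eq_zero_of_notMem_supp hx.2, sub_zero]

/-- A differential operator is local: in coordinates its value depends on finitely many derivatives. -/
theorem IsDifferentialOperator.apply_congr {P : Sec m F S univ →ₗ[ℝ] Sec m F S univ}
    (hP : IsDifferentialOperator P) {σ τ : Sec m F S univ} {x : M}
    (h : ∀ᶠ y in 𝓝 x, σ y = τ y) : P σ x = P τ x := by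
  obtain ⟨k, H⟩ := hP
  obtain ⟨A, -, hA⟩ := H x
  set φ := chartAt (EuclideanSpace ℝ (Fin m)) x with hφ
  have hx : x ∈ φ.source := mem_chart_source _ x
  have hxz : φ.symm (φ x) = x := φ.left_inv hx
  have hz : φ x ∈ localDomain m F S x := by
    refine ⟨φ.map_source hx, ?_⟩
    rw [mem_preimage, hxz]
    exact FiberBundle.mem_baseSet_trivializationAt' x
  have hev : localRep (F := F) x σ.1 =ᶠ[𝓝 (φ x)] localRep x τ.1 := by
    have hc : Tendsto φ.symm (𝓝 (φ x)) (𝓝 x) := by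
      have := φ.continuousAt_symm (φ.map_source hx)
      rwa [ContinuousAt, hxz] at this
    filter_upwards [hc.eventually h] with z hz
    simp only [localRep]
    rw [hz]
  have key : localRep (F := F) x (P σ).1 (φ x) = localRep x (P τ).1 (φ x) := by
    rw [hA σ _ hz, hA τ _ hz]
    refine Finset.sum_congr rfl fun j _ ↦ Finset.sum_congr rfl fun i _ ↦ ?_
    rw [(hev.iteratedFDeriv ℝ j).eq_of_nhds]
  have hinj : ∀ y ∈ (trivializationAt F S x).baseSet, ∀ a b : S y,
      (trivializationAt F S x ⟨y, a⟩).2 = (trivializationAt F S x ⟨y, b⟩).2 → a = b := by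
    intro y hy a b hab
    exact ((trivializationAt F S x).continuousLinearEquivAt ℝ y hy).injective hab
  have h2 : (P σ) (φ.symm (φ x)) = (P τ) (φ.symm (φ x)) := hinj _ hz.2 _ _ key
  exact (congrArg (fun y ↦ (P σ) y = (P τ) y) hxz).mp h2

theorem IsDifferentialOperator.supp_apply_subset {P : Sec m F S univ →ₗ[ℝ] Sec m F S univ}
    (hP : IsDifferentialOperator P) (σ : Sec m F S univ) : supp (P σ) ⊆ supp σ := by
  refine supp_subset_of_forall (isClosed_supp_univ σ) fun x hx ↦ ?_
  have h : ∀ᶠ y in 𝓝 x, σ y = (0 : Sec m F S univ) y := by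
    filter_upwards [(isClosed_supp_univ σ).isOpen_compl.mem_nhds hx] with y hy
    exact eq_zero_of_notMem_supp hy
  rw [hP.apply_congr h, map_zero, Sec.zero_apply]

theorem mem_SecC_of_supp_subset [T2Space M] {σ : Sec m F S univ} {K : Set M} (hK : IsCompact K)
    (h : supp σ ⊆ K) : σ ∈ SecC m F S univ :=
  hK.of_isClosed_subset (isClosed_supp_univ σ) h

end Locality

namespace GlobHypGreen

variable {X : GlobHypGreen.{u, v}}

/-- The operator `P` restricted to compactly supported sections. -/
def Pc (X : GlobHypGreen.{u, v}) : X.Γc →ₗ[ℝ] X.Γc :=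
  (X.P.domRestrict X.Γc).codRestrict X.Γc fun φ ↦
    mem_SecC_of_supp_subset φ.2 (X.differential.supp_apply_subset φ.1)

theorem coe_Pc (φ : X.Γc) : (X.Pc φ : X.Γ) = X.P φ := rfl

theorem contMDiffAt_inner {s t : ∀ x, X.S x} {x : X.M}
    (hs : ContMDiffAt (𝓡 X.m) ((𝓡 X.m).prod 𝓘(ℝ, X.Fib)) ∞
      (fun y ↦ TotalSpace.mk' X.Fib y (s y)) x)
    (ht : ContMDiffAt (𝓡 X.m) ((𝓡 X.m).prod 𝓘(ℝ, X.Fib)) ∞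
      (fun y ↦ TotalSpace.mk' X.Fib y (t y)) x) :
    ContMDiffAt (𝓡 X.m) 𝓘(ℝ, ℝ) ∞ (fun y ↦ X.inner y (s y) (t y)) x := by
  have : ContMDiffAt (𝓡 X.m) ((𝓡 X.m).prod 𝓘(ℝ, ℝ)) ∞ (fun y ↦ (⟨y, X.inner y (s y) (t y)⟩ :
        TotalSpace ℝ (Bundle.Trivial X.M ℝ))) x := by
    apply ContMDiffAt.clm_bundle_apply₂ (F₁ := X.Fib) (F₂ := X.Fib)
    · exact X.inner_smooth x
    · exact hs
    · exact ht
  rw [Bundle.contMDiffAt_totalSpace] at this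
  exact this.2

theorem Γ.contMDiffAt (σ : X.Γ) (x : X.M) : ContMDiffAt (𝓡 X.m) ((𝓡 X.m).prod 𝓘(ℝ, X.Fib)) ∞
    (fun y ↦ TotalSpace.mk' X.Fib y (σ y)) x := σ.smooth.contMDiffAt univ_mem

theorem continuous_inner (σ τ : X.Γ) : Continuous fun x ↦ X.inner x (σ x) (τ x) :=
  continuous_iff_continuousAt.2 fun x ↦
    (contMDiffAt_inner (Γ.contMDiffAt σ x) (Γ.contMDiffAt τ x)).continuousAt

theorem hasCompactSupport_inner {σ τ : X.Γ} (h : IsCompact (supp σ ∩ supp τ)) :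
    HasCompactSupport fun x ↦ X.inner x (σ x) (τ x) := by
  refine .of_support_subset_isCompact h fun x hx ↦ ?_
  constructor
  · by_contra h0
    rw [Function.mem_support, eq_zero_of_notMem_supp h0] at hx
    simp at hx
  · by_contra h0
    rw [Function.mem_support, eq_zero_of_notMem_supp h0] at hx
    simp at hx

theorem integrable_inner {σ τ : X.Γ} (h : IsCompact (supp σ ∩ supp τ)) :
    Integrable (fun x ↦ X.inner x (σ x) (τ x)) X.L.vol := by
  let : MeasurableSpace X.M := borel X.M
  have : BorelSpace X.M := ⟨rfl⟩
  have := X.L.isLocallyFiniteMeasure_vol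
  exact (continuous_inner σ τ).integrable_of_hasCompactSupport (hasCompactSupport_inner h)

theorem isCompact_supp_inter_right (σ : X.Γ) (φ : X.Γc) : IsCompact (supp σ ∩ supp φ.1) :=
  φ.2.inter_left (isClosed_supp_univ σ)

/-- The pairing `∫ ⟨σ, τ⟩ dV` of two sections. -/
def pairing (X : GlobHypGreen.{u, v}) (σ τ : X.Γ) : ℝ := ∫ x, X.inner x (σ x) (τ x) ∂X.L.vol

theorem pairing_comm (σ τ : X.Γ) : X.pairing σ τ = X.pairing τ σ := by
  simp only [pairing, X.inner_symm _ (σ _)]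

theorem pairing_zero_left (τ : X.Γ) : X.pairing 0 τ = 0 := by
  simp [pairing]

theorem pairing_add_left {σ σ' τ : X.Γ} (h : IsCompact (supp σ ∩ supp τ))
    (h' : IsCompact (supp σ' ∩ supp τ)) :
    X.pairing (σ + σ') τ = X.pairing σ τ + X.pairing σ' τ := by
  rw [pairing, pairing, pairing, ← integral_add (integrable_inner h) (integrable_inner h')]
  simp

theorem pairing_sub_left {σ σ' τ : X.Γ} (h : IsCompact (supp σ ∩ supp τ))
    (h' : IsCompact (supp σ' ∩ supp τ)) :
    X.pairing (σ - σ') τ = X.pairing σ τ - X.pairing σ' τ := by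
  rw [eq_sub_iff_add_eq, ← pairing_add_left _ h', sub_add_cancel]
  refine ((h.union h').of_isClosed_subset
    ((isClosed_supp_univ _).inter (isClosed_supp_univ _)) ?_)
  rw [← union_inter_distrib_right]
  exact inter_subset_inter_left _ (supp_sub_subset _ _)

theorem pairing_smul_left (a : ℝ) (σ τ : X.Γ) : X.pairing (a • σ) τ = a * X.pairing σ τ := by
  rw [pairing, pairing, ← integral_const_mul]
  simp

/-- A section orthogonal to all test sections vanishes: if `σ x ≠ 0`, pair it with a bump function times
a local section `s` such that `⟨σ, s⟩ > 0` near `x`. -/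
theorem eq_zero_of_forall_pairing_eq_zero {σ : X.Γ} (h : ∀ ψ : X.Γc, X.pairing σ ψ = 0) :
    σ = 0 := by
  ext x
  by_contra hx
  obtain ⟨w, hw⟩ : ∃ w, 0 < X.inner x (σ x) w := by
    by_contra! hle
    refine hx (X.inner_nondegenerate x _ fun w ↦ le_antisymm (hle w) ?_)
    simpa using hle (-w)
  let s : ∀ y, X.S y := FiberBundle.extend X.Fib w
  have hsx : s x = w := FiberBundle.extend_apply_self ..
  obtain ⟨u, hu, hus⟩ := FiberBundle.exists_contMDiffOn_extend (k := ∞) (𝓡 X.m) X.Fib w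
  have hs : ContMDiffAt (𝓡 X.m) ((𝓡 X.m).prod 𝓘(ℝ, X.Fib)) ∞
      (fun y ↦ TotalSpace.mk' X.Fib y (s y)) x := hus.contMDiffAt hu
  have hq := (contMDiffAt_inner (Γ.contMDiffAt σ x) hs).continuousAt
  have hpos : ∀ᶠ y in 𝓝 x, 0 < X.inner y (σ y) (s y) :=
    hq.eventually (lt_mem_nhds (by beta_reduce; rwa [hsx]))
  obtain ⟨f, hf⟩ := (SmoothBumpFunction.nhds_basis_support (I := 𝓡 X.m)
    (inter_mem (interior_mem_nhds.2 hu) hpos)).ex_mem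
  have hsm := ContMDiffOn.smul_section_of_tsupport (s := s) (ψ := f) (f.contMDiff.contMDiffOn)
    isOpen_interior (hf.trans inter_subset_left) (hus.mono interior_subset)
  let ψ : X.Γ := ⟨fun y ↦ f y • s y, hsm.contMDiffOn, fun y hy ↦ (hy (mem_univ y)).elim⟩
  have hψ : supp ψ ⊆ tsupport f := supp_subset_of_forall (isClosed_tsupport f) fun y hy ↦ by
    change f y • s y = 0
    rw [image_eq_zero_of_notMem_tsupport hy, zero_smul]
  have hψc : ψ ∈ X.Γc := mem_SecC_of_supp_subset f.hasCompactSupport hψ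
  have h0 := h ⟨ψ, hψc⟩
  refine h0.not_gt ?_
  let : MeasurableSpace X.M := borel X.M
  have : BorelSpace X.M := ⟨rfl⟩
  have := X.L.isLocallyFiniteMeasure_vol
  have := X.L.isOpenPosMeasure_vol
  have hval : ∀ y, X.inner y (σ y) (ψ y) = f y * X.inner y (σ y) (s y) := fun y ↦ by
    change X.inner y (σ y) (f y • s y) = _
    rw [map_smul, smul_eq_mul]
  refine (continuous_inner σ ψ).integral_pos_of_hasCompactSupport_nonneg_nonzero
    (hasCompactSupport_inner (isCompact_supp_inter_right σ ⟨ψ, hψc⟩)) (fun y ↦ ?_) (x := x) ?_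
  · change 0 ≤ X.inner y (σ y) (ψ y)
    rw [hval]
    by_cases hy : y ∈ tsupport f
    · exact mul_nonneg f.nonneg (hf hy).2.le
    · rw [image_eq_zero_of_notMem_tsupport hy, zero_mul]
  · rw [hval, hsx]
    exact mul_ne_zero f.c_mem_support hw.ne'

end GlobHypGreen

end GreenHyp

end

noncomputable section

namespace GreenHyp

/-! ### Green's operators and the symplectic form -/

namespace GlobHypGreen

variable {X : GlobHypGreen.{u, v}}

/-- The intersection of the supports lies in a causal diamond, which global hyperbolicity makes
relatively compact. -/
theorem isCompact_supp_inter_of_green {H K : X.Γc →ₗ[ℝ] X.Γ} (hH : IsAdvancedGreen X.L X.P H)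
    (hK : IsRetardedGreen X.L X.P K) (φ ψ : X.Γc) : IsCompact (supp (H φ) ∩ supp (K ψ)) := by
  obtain ⟨C, hC, hsub⟩ := X.globHyp.exists_compact_diamond φ.2 ψ.2
  exact hC.of_isClosed_subset ((isClosed_supp_univ _).inter (isClosed_supp_univ _))
    ((inter_subset_inter (hH.supp_subset φ) (hK.supp_subset ψ)).trans hsub)

/-- Advanced and retarded Green's operators of a formally self-adjoint operator are formally adjoint
to each other. -/
theorem pairing_advanced_eq {H K : X.Γc →ₗ[ℝ] X.Γ} (hH : IsAdvancedGreen X.L X.P H)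
    (hK : IsRetardedGreen X.L X.P K) (φ ψ : X.Γc) :
    X.pairing (H φ) ψ = X.pairing (K ψ) φ := by
  have h := X.selfAdjoint (H φ) (K ψ) (isCompact_supp_inter_of_green hH hK φ ψ)
  rw [hH.apply_green, hK.apply_green] at h
  rw [pairing_comm (K ψ)]
  exact h.symm

/-- Any advanced Green's operator is the formal adjoint of the same retarded one. -/
theorem advanced_unique {H : X.Γc →ₗ[ℝ] X.Γ} (hH : IsAdvancedGreen X.L X.P H) :
    H = X.Gplus := by
  refine LinearMap.ext fun φ ↦ sub_eq_zero.1 (eq_zero_of_forall_pairing_eq_zero fun ψ ↦ ?_)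
  rw [pairing_sub_left (isCompact_supp_inter_right _ _) (isCompact_supp_inter_right _ _),
    pairing_advanced_eq hH X.isRetardedGreen_Gminus,
    pairing_advanced_eq X.isAdvancedGreen_Gplus X.isRetardedGreen_Gminus, sub_self]

theorem retarded_unique {K : X.Γc →ₗ[ℝ] X.Γ} (hK : IsRetardedGreen X.L X.P K) :
    K = X.Gminus := by
  refine LinearMap.ext fun φ ↦ sub_eq_zero.1 (eq_zero_of_forall_pairing_eq_zero fun ψ ↦ ?_)
  rw [pairing_sub_left (isCompact_supp_inter_right _ _) (isCompact_supp_inter_right _ _),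
    ← pairing_advanced_eq X.isAdvancedGreen_Gplus hK,
    ← pairing_advanced_eq X.isAdvancedGreen_Gplus X.isRetardedGreen_Gminus, sub_self]

theorem pairing_G_antisymm (φ ψ : X.Γc) : X.pairing (X.G φ) ψ = -X.pairing (X.G ψ) φ := by
  have h (φ ψ : X.Γc) : X.pairing (X.G φ) ψ = X.pairing (X.Gplus φ) ψ - X.pairing (X.Gminus φ) ψ :=
    pairing_sub_left (isCompact_supp_inter_right _ _) (isCompact_supp_inter_right _ _)
  rw [h, h, pairing_advanced_eq X.isAdvancedGreen_Gplus X.isRetardedGreen_Gminus φ ψ,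
    pairing_advanced_eq X.isAdvancedGreen_Gplus X.isRetardedGreen_Gminus ψ φ]
  ring

/-- The bilinear form `∫ ⟨Gφ, ψ⟩ dV` on test sections. -/
def preForm (X : GlobHypGreen.{u, v}) : X.Γc →ₗ[ℝ] X.Γc →ₗ[ℝ] ℝ :=
  LinearMap.mk₂ ℝ (fun φ ψ ↦ X.pairing (X.G φ) ψ)
    (fun φ φ' ψ ↦ by
      rw [map_add]
      exact pairing_add_left (isCompact_supp_inter_right _ _) (isCompact_supp_inter_right _ _))
    (fun a φ ψ ↦ by rw [map_smul, pairing_smul_left, smul_eq_mul])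
    (fun φ ψ ψ' ↦ by
      rw [pairing_G_antisymm, pairing_G_antisymm φ ψ, pairing_G_antisymm φ ψ', map_add,
        pairing_add_left (isCompact_supp_inter_right _ _) (isCompact_supp_inter_right _ _), neg_add])
    (fun a φ ψ ↦ by
      rw [pairing_G_antisymm, pairing_G_antisymm φ ψ, map_smul, pairing_smul_left, smul_eq_mul,
        mul_neg])

theorem preForm_apply (φ ψ : X.Γc) : X.preForm φ ψ = X.pairing (X.G φ) ψ := rfl

theorem ker_le_ker_preForm (X : GlobHypGreen.{u, v}) :
    LinearMap.ker X.G ≤ LinearMap.ker X.preForm := fun φ hφ ↦ by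
  ext ψ
  rw [preForm_apply, LinearMap.mem_ker.1 hφ, pairing_zero_left, LinearMap.zero_apply]

/-- The symplectic form on `SYMPL(M, S, P)`. -/
def symplForm (X : GlobHypGreen.{u, v}) : X.SymplSpace →ₗ[ℝ] X.SymplSpace →ₗ[ℝ] ℝ :=
  ((LinearMap.ker X.G).liftQ ((LinearMap.ker X.G).liftQ X.preForm X.ker_le_ker_preForm).flip
    fun ψ hψ ↦ by
      ext φ
      change X.preForm φ ψ = 0
      rw [preForm_apply, pairing_G_antisymm, LinearMap.mem_ker.1 hψ, pairing_zero_left,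
        neg_zero]).flip

theorem symplForm_cls (φ ψ : X.Γc) :
    X.symplForm (X.cls φ) (X.cls ψ) = X.pairing (X.G φ) ψ := rfl

theorem cls_surjective (X : GlobHypGreen.{u, v}) : Function.Surjective X.cls :=
  Submodule.mkQ_surjective _

theorem symplForm_isAlt (X : GlobHypGreen.{u, v}) : X.symplForm.IsAlt := fun x ↦ by
  obtain ⟨φ, rfl⟩ := X.cls_surjective x
  rw [symplForm_cls]
  linarith [pairing_G_antisymm φ φ]

theorem symplForm_nondegenerate (X : GlobHypGreen.{u, v}) : X.symplForm.Nondegenerate := by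
  have h : X.symplForm.SeparatingLeft := fun x hx ↦ by
    obtain ⟨φ, rfl⟩ := X.cls_surjective x
    refine (Submodule.Quotient.mk_eq_zero _).2 (LinearMap.mem_ker.2 ?_)
    exact eq_zero_of_forall_pairing_eq_zero fun ψ ↦ hx (X.cls ψ)
  exact (LinearMap.IsRefl.nondegenerate_iff_separatingLeft X.symplForm_isAlt.isRefl).2 h

/-- `ker G` is the image of `P`: if `G₊φ = G₋φ`, this section has compact support. -/
theorem ker_G_eq_range (X : GlobHypGreen.{u, v}) : LinearMap.ker X.G = LinearMap.range X.Pc := by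
  ext φ
  constructor
  · intro hφ
    have hpm : X.Gplus φ = X.Gminus φ := sub_eq_zero.1 (LinearMap.mem_ker.1 hφ)
    have hc := isCompact_supp_inter_of_green X.isAdvancedGreen_Gplus X.isRetardedGreen_Gminus φ φ
    rw [← hpm, inter_self] at hc
    exact ⟨⟨X.Gplus φ, hc⟩, Subtype.ext (X.isAdvancedGreen_Gplus.apply_green φ)⟩
  · rintro ⟨χ, rfl⟩
    change X.Gplus (X.Pc χ) - X.Gminus (X.Pc χ) = 0
    rw [X.isAdvancedGreen_Gplus.green_apply χ _ rfl, X.isRetardedGreen_Gminus.green_apply χ _ rfl,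
      sub_self]

end GlobHypGreen

end GreenHyp

end

noncomputable section

namespace GreenHyp

/-! ### Extension by zero -/

namespace Spacetime

/-- An isometric open embedding preserves the volume element; its source and its target have the
same dimension, but need not be presented as such. -/
theorem map_vol_of_isometry {m n : ℕ} {M N : Type u} [TopologicalSpace M]
    [ChartedSpace (EuclideanSpace ℝ (Fin m)) M] [IsManifold (𝓡 m) ∞ M] [SecondCountableTopology M]
    [TopologicalSpace N] [ChartedSpace (EuclideanSpace ℝ (Fin n)) N] [IsManifold (𝓡 n) ∞ N]
    [SecondCountableTopology N] {L : Spacetime m M} {L' : Spacetime n N} {f : M → N}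
    (hf : IsLocalDiffeomorph (𝓡 m) (𝓡 n) ∞ f) (hinj : Function.Injective f)
    (hiso : ∀ x v w, L'.metric (f x) (mfderiv (𝓡 m) (𝓡 n) f x v) (mfderiv (𝓡 m) (𝓡 n) f x w) =
      L.metric x v w) :
    @Measure.map M N (borel M) (borel N) f L.vol =
      @Measure.restrict N (borel N) L'.vol (range f) := by
  let : MeasurableSpace M := borel M
  let : MeasurableSpace N := borel N
  rcases isEmpty_or_nonempty M with hM | ⟨⟨x⟩⟩
  · rw [range_eq_empty, Measure.restrict_empty, Measure.eq_zero_of_isEmpty L.vol,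
      Measure.map_zero]
  · have e : EuclideanSpace ℝ (Fin m) ≃L[ℝ] EuclideanSpace ℝ (Fin n) :=
      (hf x).mfderivToContinuousLinearEquiv (by simp)
    obtain rfl : m = n := by simpa using e.toLinearEquiv.finrank_eq
    exact map_vol hf hinj hiso

end Spacetime

namespace GlobHypGreen

section BundleEmbedding

variable {X Y : GlobHypGreen.{u, v}} {f : X.M → Y.M} {F : ∀ x, X.S x ≃ₗ[ℝ] Y.S (f x)}
  (h : IsBundleEmbedding f F)

theorem ext_apply (φ : X.Γc) (x : X.M) : (ext h φ).1 (f x) = F x (φ.1 x) :=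
  extFun_apply h.injective F φ.1 x

theorem ext_apply_of_notMem (φ : X.Γc) {y : Y.M} (hy : y ∉ range f) : (ext h φ).1 y = 0 :=
  extFun_of_notMem F φ.1 hy

theorem res_ext (φ : X.Γc) : res h (ext h φ).1 = φ.1 := Sec.ext fun x ↦ by
  change (F x).symm ((ext h φ).1 (f x)) = _
  rw [ext_apply, LinearEquiv.symm_apply_apply]

theorem supp_ext_subset (φ : X.Γc) : supp (ext h φ).1 ⊆ f '' supp φ.1 := by
  have hc := closure_extFun_subset h φ
  refine supp_subset_of_forall hc.1.isClosed fun y hy ↦ ?_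
  by_contra h0
  exact hy (hc.2 h0)

theorem supp_res_subset (σ : Y.Γ) : supp (res h σ) ⊆ f ⁻¹' supp σ := by
  refine supp_subset_of_forall
    ((isClosed_supp_univ σ).preimage h.localDiffeo.contMDiff.continuous) fun x hx ↦ ?_
  change (F x).symm (σ (f x)) = 0
  rw [eq_zero_of_notMem_supp hx, map_zero]

end BundleEmbedding

namespace Hom

variable {X Y : GlobHypGreen.{u, v}} (f : Hom X Y)

/-- Extension by zero commutes with the operators: inside the image this is the compatibility of
the operators with restriction, outside both sides vanish. -/
theorem P_ext (φ : X.Γc) : Y.Pc (f.ext φ) = f.ext (X.Pc φ) := by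
  refine Subtype.ext (Sec.ext fun y ↦ ?_)
  by_cases hy : y ∈ range f.f
  · obtain ⟨x, rfl⟩ := hy
    have h1 := congrArg (fun σ : X.Γ ↦ σ x) (f.comm (f.ext φ).1)
    rw [res_ext] at h1
    change _ = (GlobHypGreen.ext f.isBundleEmbedding (X.Pc φ)).1 (f.f x)
    rw [ext_apply, coe_Pc, coe_Pc, ← h1]
    exact ((f.F x).apply_symm_apply _).symm
  · change _ = (GlobHypGreen.ext f.isBundleEmbedding (X.Pc φ)).1 y
    rw [ext_apply_of_notMem _ _ hy]
    refine eq_zero_of_notMem_supp fun hys ↦ hy ?_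
    exact image_subset_range _ _ (supp_ext_subset f.isBundleEmbedding φ
      (Y.differential.supp_apply_subset (f.ext φ).1 hys))

/-- Extension by zero is the formal adjoint of restriction. -/
theorem pairing_ext (σ : Y.Γ) (φ : X.Γc) :
    Y.pairing σ (f.ext φ) = X.pairing (res f.isBundleEmbedding σ) φ := by
  let : MeasurableSpace X.M := borel X.M
  have : BorelSpace X.M := ⟨rfl⟩
  let : MeasurableSpace Y.M := borel Y.M
  have : BorelSpace Y.M := ⟨rfl⟩
  have h := f.isBundleEmbedding
  have he : IsOpenEmbedding f.f := .of_continuous_injective_isOpenMap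
    h.localDiffeo.contMDiff.continuous h.injective h.localDiffeo.isOpenMap
  have hvol := Spacetime.map_vol_of_isometry h.localDiffeo h.injective f.isometry
  have h0 : ∀ y ∉ range f.f, Y.inner y (σ y) ((f.ext φ).1 y) = 0 := fun y hy ↦ by
    rw [ext_apply_of_notMem _ _ hy, map_zero]
  rw [pairing, ← setIntegral_eq_integral_of_forall_compl_eq_zero h0]
  refine (congrArg (fun μ : Measure Y.M ↦ ∫ y, Y.inner y (σ y) ((f.ext φ).1 y) ∂μ) hvol).symm.trans
    ((he.measurableEmbedding.integral_map _).trans (integral_congr_ae (.of_forall fun x ↦ ?_)))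
  change Y.inner (f.f x) (σ (f.f x)) ((GlobHypGreen.ext h φ).1 (f.f x)) =
    X.inner x ((f.F x).symm (σ (f.f x))) (φ.1 x)
  rw [ext_apply, ← f.fiber_isometry, LinearEquiv.apply_symm_apply]

theorem causalLE_of_map {x y : X.M} (hxy : Y.L.CausalLE univ (f.f x) (f.f y)) :
    X.L.CausalLE univ x y :=
  Spacetime.CausalLE.of_map f.isBundleEmbedding.localDiffeo f.isBundleEmbedding.injective
    f.map_future (Spacetime.isCausallyCompatible_iff.1 f.causallyCompatible _ (mem_range_self x) _
      (mem_range_self y) hxy)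

/-- `res ∘ G₊ ∘ ext` is an advanced Green's operator on the source, where causal compatibility gives the
support condition; so it is `G₊` by uniqueness. -/
theorem res_Gplus_ext (φ : X.Γc) :
    res f.isBundleEmbedding (Y.Gplus (f.ext φ)) = X.Gplus φ := by
  have hG := Y.isAdvancedGreen_Gplus
  have h : IsAdvancedGreen X.L X.P (res f.isBundleEmbedding ∘ₗ Y.Gplus ∘ₗ f.ext) := by
    refine ⟨fun φ ↦ ?_, fun φ ψ hψ ↦ ?_, fun φ x hx ↦ ?_⟩
    · change X.P (res f.isBundleEmbedding (Y.Gplus (f.ext φ))) = φ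
      rw [← f.comm, hG.apply_green, res_ext]
    · obtain rfl : ψ = X.Pc φ := Subtype.ext hψ
      change res f.isBundleEmbedding (Y.Gplus (f.ext (X.Pc φ))) = φ
      rw [← f.P_ext, hG.green_apply (f.ext φ) _ rfl, res_ext]
    · obtain ⟨y, ⟨hy, -⟩, hle⟩ := hG.supp_subset (f.ext φ)
        (supp_res_subset f.isBundleEmbedding (Y.Gplus (f.ext φ)) hx)
      obtain ⟨x', hx', rfl⟩ := supp_ext_subset _ _ hy
      exact ⟨x', ⟨hx', mem_univ _⟩, f.causalLE_of_map hle⟩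
  exact LinearMap.congr_fun (advanced_unique h) φ

theorem res_Gminus_ext (φ : X.Γc) :
    res f.isBundleEmbedding (Y.Gminus (f.ext φ)) = X.Gminus φ := by
  have hG := Y.isRetardedGreen_Gminus
  have h : IsRetardedGreen X.L X.P (res f.isBundleEmbedding ∘ₗ Y.Gminus ∘ₗ f.ext) := by
    refine ⟨fun φ ↦ ?_, fun φ ψ hψ ↦ ?_, fun φ x hx ↦ ?_⟩
    · change X.P (res f.isBundleEmbedding (Y.Gminus (f.ext φ))) = φ
      rw [← f.comm, hG.apply_green, res_ext]
    · obtain rfl : ψ = X.Pc φ := Subtype.ext hψ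
      change res f.isBundleEmbedding (Y.Gminus (f.ext (X.Pc φ))) = φ
      rw [← f.P_ext, hG.green_apply (f.ext φ) _ rfl, res_ext]
    · obtain ⟨y, ⟨hy, -⟩, hle⟩ := hG.supp_subset (f.ext φ)
        (supp_res_subset f.isBundleEmbedding (Y.Gminus (f.ext φ)) hx)
      obtain ⟨x', hx', rfl⟩ := supp_ext_subset _ _ hy
      exact ⟨x', ⟨hx', mem_univ _⟩, f.causalLE_of_map hle⟩
  exact LinearMap.congr_fun (retarded_unique h) φ

theorem res_G_ext (φ : X.Γc) : res f.isBundleEmbedding (Y.G (f.ext φ)) = X.G φ := by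
  change res f.isBundleEmbedding (Y.Gplus (f.ext φ) - Y.Gminus (f.ext φ)) = _
  rw [map_sub, res_Gplus_ext, res_Gminus_ext]
  rfl

/-- As `ker G` is the image of `P`, extension by zero maps it into the kernel on the target. -/
theorem ker_le_comap_ext : LinearMap.ker X.G ≤ (LinearMap.ker Y.G).comap f.ext := by
  rw [ker_G_eq_range, ker_G_eq_range]
  rintro _ ⟨χ, rfl⟩
  exact ⟨f.ext χ, f.P_ext χ⟩

/-- The linear map of symplectic vector spaces induced by extension by zero. -/
def symplMap : X.SymplSpace →ₗ[ℝ] Y.SymplSpace :=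
  (LinearMap.ker X.G).mapQ (LinearMap.ker Y.G) f.ext f.ker_le_comap_ext

theorem symplMap_cls (φ : X.Γc) : f.symplMap (X.cls φ) = Y.cls (f.ext φ) := rfl

theorem symplForm_symplMap (x y : X.SymplSpace) :
    Y.symplForm (f.symplMap x) (f.symplMap y) = X.symplForm x y := by
  obtain ⟨φ, rfl⟩ := X.cls_surjective x
  obtain ⟨ψ, rfl⟩ := X.cls_surjective y
  rw [symplMap_cls, symplMap_cls, symplForm_cls, symplForm_cls, pairing_ext, res_G_ext]

theorem ext_id (φ : X.Γc) : (Hom.id X).ext φ = φ :=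
  Subtype.ext (Sec.ext fun x ↦ ext_apply (IsBundleEmbedding.refl X) φ x)

theorem ext_comp {Z : GlobHypGreen.{u, v}} (g : Hom Y Z) (φ : X.Γc) :
    (g.comp f).ext φ = g.ext (f.ext φ) := by
  refine Subtype.ext (Sec.ext fun z ↦ ?_)
  by_cases hz : z ∈ range g.f
  · obtain ⟨y, rfl⟩ := hz
    change (GlobHypGreen.ext (g.comp f).isBundleEmbedding φ).1 (g.f y) =
      (GlobHypGreen.ext g.isBundleEmbedding (f.ext φ)).1 (g.f y)
    rw [ext_apply]
    by_cases hy : y ∈ range f.f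
    · obtain ⟨x, rfl⟩ := hy
      rw [ext_apply]
      exact ext_apply (g.comp f).isBundleEmbedding φ x
    · rw [ext_apply_of_notMem _ _ hy, map_zero]
      refine ext_apply_of_notMem _ _ ?_
      rintro ⟨x, hx⟩
      exact hy ⟨x, g.isBundleEmbedding.injective hx⟩
  · change (GlobHypGreen.ext (g.comp f).isBundleEmbedding φ).1 z =
      (GlobHypGreen.ext g.isBundleEmbedding (f.ext φ)).1 z
    rw [ext_apply_of_notMem _ _ hz]
    refine ext_apply_of_notMem _ _ ?_
    rintro ⟨x, hx⟩
    exact hz ⟨f.f x, hx⟩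

theorem symplMap_id (X : GlobHypGreen.{u, v}) : (Hom.id X).symplMap = LinearMap.id := by
  refine LinearMap.ext fun x ↦ ?_
  obtain ⟨φ, rfl⟩ := X.cls_surjective x
  rw [symplMap_cls, ext_id, LinearMap.id_apply]

theorem symplMap_comp {Z : GlobHypGreen.{u, v}} (g : Hom Y Z) :
    (g.comp f).symplMap = g.symplMap ∘ₗ f.symplMap := by
  refine LinearMap.ext fun x ↦ ?_
  obtain ⟨φ, rfl⟩ := X.cls_surjective x
  rw [symplMap_cls, ext_comp, LinearMap.comp_apply, symplMap_cls, symplMap_cls]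

end Hom

end GlobHypGreen

end GreenHyp

end

open GreenHyp
theorem propositionp :
    -- the advanced and the retarded Green's operator of an object are unique
    (∀ X : GlobHypGreen.{u, v},
      (∀ H, IsAdvancedGreen X.L X.P H → H = X.Gplus) ∧
      (∀ H, IsRetardedGreen X.L X.P H → H = X.Gminus)) ∧
    -- the integrals that define the form converge
    (∀ (X : GlobHypGreen.{u, v}) (φ ψ : X.Γc),
      Integrable (fun x ↦ X.inner x (X.G φ x) (ψ.1 x)) X.L.vol) ∧
    -- they induce a symplectic form on the quotient
    ∃ form : ∀ X : GlobHypGreen.{u, v}, X.SymplSpace →ₗ[ℝ] X.SymplSpace →ₗ[ℝ] ℝ,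
      (∀ X (φ ψ : X.Γc),
        form X (X.cls φ) (X.cls ψ) = ∫ x, X.inner x (X.G φ x) (ψ.1 x) ∂X.L.vol) ∧
      ∃ (halt : ∀ X, (form X).IsAlt) (hnd : ∀ X, (form X).Nondegenerate),
        -- extension by zero induces symplectic linear maps
        ∃ T : ∀ {X Y : GlobHypGreen.{u, v}}, (X ⟶ Y) →
            ((⟨X.SymplSpace, form X, halt X, hnd X⟩ : Sympl.{max u v}) ⟶
              ⟨Y.SymplSpace, form Y, halt Y, hnd Y⟩),
          (∀ {X Y : GlobHypGreen.{u, v}} (f : X ⟶ Y) (φ : X.Γc),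
            (T f).toLinearMap (X.cls φ) = Y.cls (GlobHypGreen.Hom.ext f φ)) ∧
          -- and this is a functor
          ∃ SYMPL : GlobHypGreen.{u, v} ⥤ Sympl.{max u v},
            SYMPL.toPrefunctor =
              { obj := fun X ↦ ⟨X.SymplSpace, form X, halt X, hnd X⟩, map := T } := by
  refine ⟨fun X ↦ ⟨fun _ ↦ GlobHypGreen.advanced_unique, fun _ ↦ GlobHypGreen.retarded_unique⟩,
    fun X φ ψ ↦ GlobHypGreen.integrable_inner (GlobHypGreen.isCompact_supp_inter_right _ ψ),
    GlobHypGreen.symplForm, fun _ ↦ GlobHypGreen.symplForm_cls, GlobHypGreen.symplForm_isAlt,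
    GlobHypGreen.symplForm_nondegenerate,
    fun f ↦ ⟨GlobHypGreen.Hom.symplMap f, GlobHypGreen.Hom.symplForm_symplMap f⟩,
    GlobHypGreen.Hom.symplMap_cls, ⟨⟨_, _, fun X ↦ ?_, fun f g ↦ ?_⟩, rfl⟩⟩
  · exact Sympl.Hom.ext (GlobHypGreen.Hom.symplMap_id X)
  · exact Sympl.Hom.ext (GlobHypGreen.Hom.symplMap_comp f g)
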